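/- Let $c_1>0>c_2$, $t_0>0$, $L=c_1-c_2$, and put $p_1(t)=\frac{c_1-c_2e^{L(t-t_0)}}{1-e^{L(t-t_0)}}$, $p_2(t)=\frac{c_2-c_1e^{L(t-t_0)}}{1-e^{L(t-t_0)}}$, $q_1(t)=\ln L+c_1(t-t_0)-\ln(c_1-c_2e^{L(t-t_0)})$, $q_2(t)=-\ln L+c_2(t-t_0)+\ln(c_1e^{L(t-t_0)}-c_2)$, and $u_0(x)=p_1(0)e^{-|x-q_1(0)|}+p_2(0)e^{-|x-q_2(0)|}$. **Lagrangian coordinates.** $\mathcal F$ is the set of $\Theta=(y,U,y_\xi,U_\xi,\bar h,h)$, functions of $\xi\in\mathbb R$, such that $y,U$ are locally absolutely continuous with a.e. derivatives $y_\xi,U_\xi$; $y-\mathrm{id}\in L^\infty$; $U,y_\xi-1,U_\xi,h\in L^2\cap L^\infty$; $h\in L^1$; $\bar h$ is measurable; $y_\xi,h,\bar h\ge0$ a.e.; $y(\xi)-\xi\to0$ as $\xi\to-\infty$; $1/(y_\xi+h)\in L^\infty$; $y_\xi\bar h=U_\xi^2$ and $\bar h\le h$ a.e.; and $y+\int_{-\infty}^{\cdot}h\,d\eta\in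 G$, where $G$ is the group of homeomorphisms $f$ of $\mathbb R$ with $f-\mathrm{id},f^{-1}-\mathrm{id}\in W^{1,\infty}$ and $f_\xi-1\in L^2$. The Eulerian variables $(u,\mu,\nu)$ of $\Theta$ are given by $u(y(\xi))=U(\xi)$ for all $\xi$, $\mu=y_\#(\bar h\,d\xi)$, $\nu=y_\#(h\,d\xi)$. **Fully dissipative ($\alpha=1$) solutions.** A fully dissipative Lagrangian solution of the Camassa–Holm equation $u_t-u_{txx}+3uu_x-2u_xu_{xx}-uu_{xxx}=0$ is a family $\Theta(t)\in\mathcal F$, $t\ge0$, with $y-\xi,U,y_\xi,U_\xi,h$ essentially bounded on $[0,T]\times\mathbb R$ for every $T$ (for a.e. $\xi$, uniformly in $t\in[0,T]$), satisfying in integrated form in $t$ (for all $\xi$ in the first two equations, for a.e. $\xi$ in the others) $$y_t=U,\quad U_t=-Q,\quad y_{\xi,t}=U_\xi,\quad U_{\xi,t}=\tfrac12\bar h+(U^2-P)y_\xi,\quad h_t=2(U^2-P)U_\xi,$$ $$P(t,\xi)=\tfrac14\int_{\mathbb R}e^{-|y(t,\xi)-y(t,\eta)|}(2U^2y_\xi+\bar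 h)(t,\eta)\,d\eta,\qquad Q(t,\xi)=-\tfrac14\int_{\mathbb R}\operatorname{sign}(\xi-\eta)e^{-|y(t,\xi)-y(t,\eta)|}(2U^2y_\xi+\bar h)(t,\eta)\,d\eta,$$ where, for a.e. $\xi$, $\bar h(t,\xi)=h(t,\xi)$ if $y_\xi(s,\xi)\ne0$ for all $s\in[0,t]$, and $\bar h(t,\xi)=0$ otherwise (all energy is removed at wave breaking). **Theorem.** There is a fully dissipative Lagrangian solution with initial data $y(0,\xi)=\xi$, $U(0,\xi)=u_0(\xi)$ for all $\xi$, $h(0,\xi)=\bar h(0,\xi)=u_0'(\xi)^2$ for a.e. $\xi$. Every such solution has the following properties. 1. For a.e. $\xi$ and all $t\ge0$: $y_\xi(t,\xi)=0$ if and only if $t\ge t_0$ and $q_1(0)\le\xi\le q_2(0)$; that is, wave breaking takes place exactly at $t_0$ and for the labels in $[q_1(0),q_2(0)]$. 2. Let $c=c_1+c_2$ and $A(t,\xi)=L+(Le^{-c(t-t_0)}-c_1e^{c_1t_0}+c_2e^{c_2t_0})e^{\xi}$, $B(t,\xi)=L+(Le^{c(t-t_0)}-c_1e^{-c_1t_0}+c_2e^{-c_2t_0})e^{-\xi}$.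 For all $t\ge t_0$ and all $\xi$ (a.e. $\xi$, uniformly in $t$, for $h$ and $\bar h$): - for $\xi<q_1(0)$: $y=\xi+\ln L-\ln A$, $U=\dfrac{cLe^{-c(t-t_0)}e^{\xi}}{A}$, $h=\bar h=\dfrac{c^2L^3e^{-2c(t-t_0)}e^{2\xi}}{A^3}$; - for $q_1(0)\le\xi\le q_2(0)$: $y=c(t-t_0)$, $U=c$, $\bar h=0$, $h=\dfrac{4c_1^2c_2^2(1-e^{-Lt_0})^2e^{\xi}}{\big(Le^{-c_1t_0}+c_2-c_1e^{-Lt_0}+(-c_1+c_2e^{-Lt_0}+Le^{c_2t_0})e^{\xi}\big)^2}$; - for $\xi>q_2(0)$: $y=\xi-\ln L+\ln B$, $U=\dfrac{cLe^{c(t-t_0)}e^{-\xi}}{B}$, $h=\bar h=\dfrac{c^2L^3e^{2c(t-t_0)}e^{-2\xi}}{B^3}$. 3. For every $t\ge t_0$ the Eulerian variables of $\Theta(t)$ exist, are unique, and are $$u(t,x)=(c_1+c_2)e^{-|x-(c_1+c_2)(t-t_0)|},\qquad \mu(t)=u_x^2(t,x)\,dx,\qquad \nu(t)=u_x^2(t,x)\,dx-4c_1c_2\,\delta_{(c_1+c_2)(t-t_0)}.$$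 4. For $t\ge t_0$ this $u$ is differentiable in $x$ for $x\ne(c_1+c_2)(t-t_0)$ with $u_x^2=(c_1+c_2)^2e^{-2|x-(c_1+c_2)(t-t_0)|}$, the function $u^2+u_x^2$ is integrable, and $\int_{\mathbb R}(u^2+u_x^2)\,dx=2c_1^2+2c_2^2+4c_1c_2=2(c_1+c_2)^2$. 5. For every $\xi$, the pair $z(t)=y(t,\xi)-(c_1+c_2)(t-t_0)$, $V(t)=U(t,\xi)-(c_1+c_2)$ is, on $[t_0,\infty)$, the unique continuous solution, in integrated form, of $z_t=V$, $V_t=-\operatorname{sgn}(z)V(V+c_1+c_2)$ with its initial values at $t_0$. -/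

import Mathlib

open MeasureTheory Filter Topology
open scoped NNReal ENNReal

namespace CamassaHolm

noncomputable section

/-! ### Peakons -/

/-- Height of the left peak of the peakon-antipeakon solution (`L = c₁ - c₂`). -/
def p₁ (c₁ c₂ t₀ t : ℝ) : ℝ :=
  (c₁ - c₂ * Real.exp ((c₁ - c₂) * (t - t₀))) / (1 - Real.exp ((c₁ - c₂) * (t - t₀)))

/-- Height of the right peak of the peakon-antipeakon solution. -/
def p₂ (c₁ c₂ t₀ t : ℝ) : ℝ :=
  (c₂ - c₁ * Real.exp ((c₁ - c₂) * (t - t₀))) / (1 - Real.exp ((c₁ - c₂) * (t - t₀)))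

/-- Position of the left peak. -/
def q₁ (c₁ c₂ t₀ t : ℝ) : ℝ :=
  Real.log (c₁ - c₂) + c₁ * (t - t₀) - Real.log (c₁ - c₂ * Real.exp ((c₁ - c₂) * (t - t₀)))

/-- Position of the right peak. -/
def q₂ (c₁ c₂ t₀ t : ℝ) : ℝ :=
  -Real.log (c₁ - c₂) + c₂ * (t - t₀) + Real.log (c₁ * Real.exp ((c₁ - c₂) * (t - t₀)) - c₂)

/-- The peakon-antipeakon profile at time `t` (used for `t < t₀`). -/
def twoPeakon (c₁ c₂ t₀ t x : ℝ) : ℝ :=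
  p₁ c₁ c₂ t₀ t * Real.exp (-|x - q₁ c₁ c₂ t₀ t|) +
    p₂ c₁ c₂ t₀ t * Real.exp (-|x - q₂ c₁ c₂ t₀ t|)

/-- The single peakon of height and speed `c`, located at the origin at time `t₀`. -/
def onePeakon (c t₀ t x : ℝ) : ℝ := c * Real.exp (-|x - c * (t - t₀)|)

/-! ### Lagrangian coordinates -/

/-- `f` is (locally) absolutely continuous with almost everywhere derivative `g`. -/
def IsACWithDeriv (f g : ℝ → ℝ) : Prop :=
  LocallyIntegrable g volume ∧ ∀ a b : ℝ, f b - f a = ∫ x in a..b, g x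

/-- `W^{1,∞}(ℝ)`: bounded Lipschitz functions. -/
def MemW1Inf (g : ℝ → ℝ) : Prop :=
  (∃ C : ℝ, ∀ x, |g x| ≤ C) ∧ ∃ K : ℝ≥0, LipschitzWith K g

/-- The group `G` of relabeling functions: homeomorphisms `f` of `ℝ` with `f - id` and
`f⁻¹ - id` in `W^{1,∞}` and `f' - 1` in `L²`. -/
def MemG (f : ℝ → ℝ) : Prop :=
  ∃ e : ℝ ≃ₜ ℝ, (∀ x, e x = f x) ∧ MemW1Inf (fun x => e x - x) ∧
    MemW1Inf (fun x => e.symm x - x) ∧ MemLp (fun x => deriv e x - 1) 2 volume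

/-- A tuple `(y, U, y_ξ, U_ξ, h̄, h)` of functions of the label `ξ`. -/
structure LagVar where
  y : ℝ → ℝ
  U : ℝ → ℝ
  yξ : ℝ → ℝ
  Uξ : ℝ → ℝ
  hbar : ℝ → ℝ
  h : ℝ → ℝ

/-- The set `𝓕` of Lagrangian coordinates. -/
structure MemF (Θ : LagVar) : Prop where
  y_ac : IsACWithDeriv Θ.y Θ.yξ
  U_ac : IsACWithDeriv Θ.U Θ.Uξ
  zeta_bdd : ∃ C : ℝ, ∀ ξ, |Θ.y ξ - ξ| ≤ C
  U_L2 : MemLp Θ.U 2 volume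
  U_Linf : MemLp Θ.U ⊤ volume
  zetaξ_L2 : MemLp (fun ξ => Θ.yξ ξ - 1) 2 volume
  zetaξ_Linf : MemLp (fun ξ => Θ.yξ ξ - 1) ⊤ volume
  Uξ_L2 : MemLp Θ.Uξ 2 volume
  Uξ_Linf : MemLp Θ.Uξ ⊤ volume
  h_L2 : MemLp Θ.h 2 volume
  h_Linf : MemLp Θ.h ⊤ volume
  h_L1 : Integrable Θ.h volume
  hbar_meas : AEStronglyMeasurable Θ.hbar volume
  yξ_nonneg : ∀ᵐ ξ, 0 ≤ Θ.yξ ξ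
  h_nonneg : ∀ᵐ ξ, 0 ≤ Θ.h ξ
  hbar_nonneg : ∀ᵐ ξ, 0 ≤ Θ.hbar ξ
  zeta_lim : Tendsto (fun ξ => Θ.y ξ - ξ) atBot (𝓝 0)
  /-- `1 / (y_ξ + h) ∈ L^∞` -/
  inv_Linf : ∃ δ : ℝ, 0 < δ ∧ ∀ᵐ ξ, δ ≤ Θ.yξ ξ + Θ.h ξ
  energy_eq : ∀ᵐ ξ, Θ.yξ ξ * Θ.hbar ξ = Θ.Uξ ξ ^ 2
  hbar_le : ∀ᵐ ξ, Θ.hbar ξ ≤ Θ.h ξ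
  relabel : MemG (fun ξ => Θ.y ξ + ∫ η in Set.Iic ξ, Θ.h η)

/-- The pressure `P`, with the energy density `h̄`. -/
def LagVar.P (Θ : LagVar) (ξ : ℝ) : ℝ :=
  1 / 4 * ∫ η, Real.exp (-|Θ.y ξ - Θ.y η|) * (2 * Θ.U η ^ 2 * Θ.yξ η + Θ.hbar η)

/-- The term `Q`, with the energy density `h̄`. -/
def LagVar.Q (Θ : LagVar) (ξ : ℝ) : ℝ :=
  -(1 / 4) * ∫ η, Real.sign (ξ - η) * Real.exp (-|Θ.y ξ - Θ.y η|) *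
    (2 * Θ.U η ^ 2 * Θ.yξ η + Θ.hbar η)

/-- `f' = g` on `[a, ∞)` in integrated form. -/
def SolvesFrom (a : ℝ) (f g : ℝ → ℝ) : Prop :=
  ∀ t, a ≤ t → IntervalIntegrable g volume a t ∧ f t = f a + ∫ s in a..t, g s

/-- Fully dissipative (`α = 1`) solutions, on the time interval `[0, ∞)`, of the Lagrangian
system of the Camassa-Holm equation: the energy density `h̄` which drives the system equals `h`
at a label as long as `y_ξ` has not vanished there, and is set to `0` from the first time on
at which `y_ξ` vanishes (wave breaking at that label). -/
structure IsDissipativeSolution (Θ : ℝ → LagVar) : Prop where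
  memF : ∀ t, 0 ≤ t → MemF (Θ t)
  bounded : ∀ T : ℝ, ∃ C : ℝ, ∀ᵐ ξ, ∀ t ∈ Set.Icc 0 T,
    |(Θ t).y ξ - ξ| ≤ C ∧ |(Θ t).U ξ| ≤ C ∧ |(Θ t).yξ ξ| ≤ C ∧ |(Θ t).Uξ ξ| ≤ C ∧
      |(Θ t).h ξ| ≤ C
  eq_y : ∀ ξ, SolvesFrom 0 (fun t => (Θ t).y ξ) (fun t => (Θ t).U ξ)
  eq_U : ∀ ξ, SolvesFrom 0 (fun t => (Θ t).U ξ) (fun t => -(Θ t).Q ξ)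
  eq_yξ : ∀ᵐ ξ, SolvesFrom 0 (fun t => (Θ t).yξ ξ) (fun t => (Θ t).Uξ ξ)
  eq_Uξ : ∀ᵐ ξ, SolvesFrom 0 (fun t => (Θ t).Uξ ξ)
    (fun t => 1 / 2 * (Θ t).hbar ξ + ((Θ t).U ξ ^ 2 - (Θ t).P ξ) * (Θ t).yξ ξ)
  eq_h : ∀ᵐ ξ, SolvesFrom 0 (fun t => (Θ t).h ξ)
    (fun t => 2 * ((Θ t).U ξ ^ 2 - (Θ t).P ξ) * (Θ t).Uξ ξ)
  hbar_eq : ∀ᵐ ξ, ∀ t, 0 ≤ t →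
    ((∀ s ∈ Set.Icc 0 t, (Θ s).yξ ξ ≠ 0) → (Θ t).hbar ξ = (Θ t).h ξ) ∧
    ((∃ s ∈ Set.Icc 0 t, (Θ s).yξ ξ = 0) → (Θ t).hbar ξ = 0)

/-- Lagrangian initial data, labelled by the position at time `0`, of the velocity `u₀` whose
energy measures are both `u₀'² dx`. -/
structure HasInitialVelocity (Θ : LagVar) (u₀ : ℝ → ℝ) : Prop where
  y_eq : ∀ ξ, Θ.y ξ = ξ
  U_eq : ∀ ξ, Θ.U ξ = u₀ ξ
  h_eq : ∀ᵐ ξ, Θ.h ξ = deriv u₀ ξ ^ 2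
  hbar_eq : ∀ᵐ ξ, Θ.hbar ξ = deriv u₀ ξ ^ 2

/-- `(u, μ, ν)` are the Eulerian variables belonging to `Θ`: `u (y ξ) = U ξ` for all `ξ`,
`μ = y_#(h̄ dξ)` and `ν = y_#(h dξ)`. -/
def IsEulerianOf (Θ : LagVar) (u : ℝ → ℝ) (μ ν : Measure ℝ) : Prop :=
  (∀ ξ, u (Θ.y ξ) = Θ.U ξ) ∧
  μ = (volume.withDensity fun ξ => ENNReal.ofReal (Θ.hbar ξ)).map Θ.y ∧
  ν = (volume.withDensity fun ξ => ENNReal.ofReal (Θ.h ξ)).map Θ.y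

/-! ### Explicit Lagrangian variables after wave breaking -/

/-- `L + (L e^{-(c₁+c₂)(t-t₀)} - c₁ e^{c₁t₀} + c₂ e^{c₂t₀}) e^ξ`. -/
def denL (c₁ c₂ t₀ t ξ : ℝ) : ℝ :=
  (c₁ - c₂) + ((c₁ - c₂) * Real.exp (-((c₁ + c₂) * (t - t₀))) - c₁ * Real.exp (c₁ * t₀)
    + c₂ * Real.exp (c₂ * t₀)) * Real.exp ξ

/-- `L + (L e^{(c₁+c₂)(t-t₀)} - c₁ e^{-c₁t₀} + c₂ e^{-c₂t₀}) e^{-ξ}`. -/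
def denR (c₁ c₂ t₀ t ξ : ℝ) : ℝ :=
  (c₁ - c₂) + ((c₁ - c₂) * Real.exp ((c₁ + c₂) * (t - t₀)) - c₁ * Real.exp (-(c₁ * t₀))
    + c₂ * Real.exp (-(c₂ * t₀))) * Real.exp (-ξ)

/-- The characteristics for `t ≥ t₀`. -/
def yAfter (c₁ c₂ t₀ t ξ : ℝ) : ℝ :=
  if ξ < q₁ c₁ c₂ t₀ 0 then ξ + Real.log (c₁ - c₂) - Real.log (denL c₁ c₂ t₀ t ξ)
  else if ξ ≤ q₂ c₁ c₂ t₀ 0 then (c₁ + c₂) * (t - t₀)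
  else ξ - Real.log (c₁ - c₂) + Real.log (denR c₁ c₂ t₀ t ξ)

/-- The Lagrangian velocity for `t ≥ t₀`. -/
def UAfter (c₁ c₂ t₀ t ξ : ℝ) : ℝ :=
  if ξ < q₁ c₁ c₂ t₀ 0 then
    (c₁ + c₂) * (c₁ - c₂) * Real.exp (-((c₁ + c₂) * (t - t₀))) * Real.exp ξ / denL c₁ c₂ t₀ t ξ
  else if ξ ≤ q₂ c₁ c₂ t₀ 0 then c₁ + c₂
  else
    (c₁ + c₂) * (c₁ - c₂) * Real.exp ((c₁ + c₂) * (t - t₀)) * Real.exp (-ξ) / denR c₁ c₂ t₀ t ξ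

/-- The energy density `h` for `t ≥ t₀`, with the value `m` between the two peaks' labels. -/
def hAfterWith (m : ℝ) (c₁ c₂ t₀ t ξ : ℝ) : ℝ :=
  if ξ < q₁ c₁ c₂ t₀ 0 then
    (c₁ + c₂) ^ 2 * (c₁ - c₂) ^ 3 * Real.exp (-(2 * (c₁ + c₂) * (t - t₀))) * Real.exp (2 * ξ)
      / denL c₁ c₂ t₀ t ξ ^ 3
  else if ξ ≤ q₂ c₁ c₂ t₀ 0 then m
  else
    (c₁ + c₂) ^ 2 * (c₁ - c₂) ^ 3 * Real.exp (2 * (c₁ + c₂) * (t - t₀)) * Real.exp (-(2 * ξ))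
      / denR c₁ c₂ t₀ t ξ ^ 3

/-- The energy density between the labels of the two peaks at and after wave breaking. -/
def hMid (c₁ c₂ t₀ ξ : ℝ) : ℝ :=
  4 * c₁ ^ 2 * c₂ ^ 2 * (1 - Real.exp (-((c₁ - c₂) * t₀))) ^ 2 * Real.exp ξ
    / ((c₁ - c₂) * Real.exp (-(c₁ * t₀)) + c₂ - c₁ * Real.exp (-((c₁ - c₂) * t₀))
      + (-c₁ + c₂ * Real.exp (-((c₁ - c₂) * t₀)) + (c₁ - c₂) * Real.exp (c₂ * t₀))
        * Real.exp ξ) ^ 2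

/-- `h` for `t ≥ t₀`. -/
def hAfter (c₁ c₂ t₀ t ξ : ℝ) : ℝ := hAfterWith (hMid c₁ c₂ t₀ ξ) c₁ c₂ t₀ t ξ

/-- `h̄` for `t ≥ t₀`. -/
def hbarAfter (c₁ c₂ t₀ t ξ : ℝ) : ℝ := hAfterWith 0 c₁ c₂ t₀ t ξ

/-- Locally Lipschitz solutions on `[t₀, ∞)` of the planar system
`z' = V`, `V' = -sgn(z) V (V + c)`. -/
def IsPlanarSolution (c t₀ : ℝ) (z V : ℝ → ℝ) : Prop :=
  ContinuousOn z (Set.Ici t₀) ∧ ContinuousOn V (Set.Ici t₀) ∧ SolvesFrom t₀ z V ∧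
    SolvesFrom t₀ V (fun t => -Real.sign (z t) * V t * (V t + c))

end

end CamassaHolm

/-! ### Exponential weights, integrated equations, absolutely continuous functions -/

namespace CamassaHolm

/-! The solution is written down explicitly and then shown to be the only one.

Existence. Outside the peaks the velocity is a multiple of e^{-x} or e^x, so e^y (on the right) or
e^{-y} (on the left) is its initial value plus a function of time (`outer`). Between the peaks u =
αe^x + βe^{-x}, so w = e^y solves a Riccati equation with the particular solution b = e^{q₂}. The
substitution w = b - D²r, with D = `gap` vanishing at t₀, leaves r_t = L D r², which is solved by
`midRho`. No formula in `mid` divides by D, so all of them extend to t₀. There y_ξ = D²s/w vanishes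
exactly between the peaks, whereas h keeps a positive limit of total mass -4c₁c₂. After t₀ these
labels ride on the peak with h̄ = 0. The outer labels continue with e^{±c(t-t₀)} in place of e^{q₂}
and e^{-q₁}; at t₀ values and first derivatives agree, which is all that y, U, y_ξ, U_ξ and h see.

The nonlocal terms are identified without computing integrals case by case: bounded continuous p, q
with p_ξ = q y_ξ and q_ξ = (p - U²)y_ξ - h̄/2 off a countable set must be P and Q
(`IsProfile.P_eq_and_Q_eq`). What remains is to check these equations in each region and to match y,
U, p, q at the two peak labels (`isProfile_glue`).

Uniqueness. P and Q are Lipschitz for the supremum over labels, provided that the difference of h̄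
is controlled by that of h; this gives a short-time contraction
(`IsDissipativeSolution.closeAt_half`). The proviso concerns only labels where one solution has
broken and the other has not. Before t₀, and afterwards at the outer labels, y_ξ of the explicit
solution is bounded below on compact time intervals, and the bound on U_ξ keeps y_ξ of the other
solution nonzero for a further time uniform in the label. Between the peaks both solutions have
broken at t₀. `IsDissipativeSolution.closeAt_zero_of_extend` turns this into agreement for all
times.

The Eulerian statement is then a change of variables by y off the collapsed labels. For the planar
system, whose right side is discontinuous, the invariant curve V = c(e^{-|z|} - 1) replaces a
Lipschitz condition: it forces an explicit formula off the peak, and Grönwall's inequality applies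
on it. -/

lemma integral_exp_neg_abs_sub (x : ℝ) : ∫ η : ℝ, Real.exp (-|x - η|) = 2 := by
  rw [integral_sub_left_eq_self (fun η : ℝ => Real.exp (-|η|)) volume x,
    integral_comp_abs (f := fun η : ℝ => Real.exp (-η)), integral_exp_neg_Ioi_zero]
  norm_num

lemma integrable_exp_neg_abs_sub (x : ℝ) : Integrable fun η : ℝ => Real.exp (-|x - η|) := by
  by_contra h
  have := integral_exp_neg_abs_sub x
  rw [integral_undef h] at this
  norm_num at this

lemma abs_integral_le_of_le_exp_neg_abs {f : ℝ → ℝ} {A x : ℝ}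
    (h : ∀ᵐ η, |f η| ≤ A * Real.exp (-|x - η|)) : |∫ η, f η| ≤ A * 2 := by
  have := norm_integral_le_of_norm_le (f := f) ((integrable_exp_neg_abs_sub x).const_mul A) h
  rwa [integral_const_mul, integral_exp_neg_abs_sub] at this

lemma SolvesFrom.abs_sub_le {f g f' g' : ℝ → ℝ} {a b M : ℝ} (h : SolvesFrom 0 f g)
    (h' : SolvesFrom 0 f' g') (ha : 0 ≤ a) (hab : a ≤ b) (hfa : f a = f' a)
    (hM : ∀ s ∈ Set.Icc a b, |g s - g' s| ≤ M) : |f b - f' b| ≤ M * (b - a) := by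
  have key : ∀ {f g : ℝ → ℝ}, SolvesFrom 0 f g →
      IntervalIntegrable g volume a b ∧ f b = f a + ∫ s in a..b, g s := by
    intro f g h
    obtain ⟨h1, h2⟩ := h a ha
    obtain ⟨h3, h4⟩ := h b (ha.trans hab)
    have h5 : IntervalIntegrable g volume a b := h1.symm.trans h3
    refine ⟨h5, ?_⟩
    rw [h4, h2, ← intervalIntegral.integral_add_adjacent_intervals h1 h5]
    ring
  obtain ⟨h1, h2⟩ := key h
  obtain ⟨h3, h4⟩ := key h'
  have : f b - f' b = ∫ s in a..b, (g s - g' s) := by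
    rw [intervalIntegral.integral_sub h1 h3, h2, h4, hfa]; ring
  rw [this]
  have := intervalIntegral.norm_integral_le_of_norm_le_const (a := a) (b := b)
    (f := fun s => g s - g' s) (C := M) (fun x hx => by
      rw [Set.uIoc_of_le hab] at hx
      exact hM x ⟨hx.1.le, hx.2⟩)
  rwa [abs_of_nonneg (sub_nonneg.2 hab)] at this

lemma IsACWithDeriv.continuous {f g : ℝ → ℝ} (h : IsACWithDeriv f g) : Continuous f := by
  have : f = fun x => f 0 + ∫ t in (0 : ℝ)..x, g t := by
    funext x
    rw [← h.2 0 x]; ring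
  rw [this]
  exact continuous_const.add
    (intervalIntegral.continuous_primitive (fun a b =>
      (h.1.integrableOn_isCompact isCompact_uIcc).intervalIntegrable) 0)

lemma IsACWithDeriv.ae_hasDerivAt {f g : ℝ → ℝ} (h : IsACWithDeriv f g) :
    ∀ᵐ x, HasDerivAt f (g x) x := by
  filter_upwards [LocallyIntegrable.ae_hasDerivAt_integral h.1] with x hx
  have : f = fun x => f 0 + ∫ t in (0 : ℝ)..x, g t := by
    funext x
    rw [← h.2 0 x]; ring
  rw [this]
  exact (hx 0).const_add _

lemma IsACWithDeriv.ae_eq {f g g' : ℝ → ℝ} (h : IsACWithDeriv f g) (h' : IsACWithDeriv f g') :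
    g =ᵐ[volume] g' := by
  filter_upwards [h.ae_hasDerivAt, h'.ae_hasDerivAt] with x h1 h2 using h1.unique h2

/-- A Lipschitz bound for e^{-|·|} that retains the factor e^{-|d|}. With d = ξ - η this factor
makes the difference of two kernels integrable in η. -/
lemma abs_exp_neg_abs_sub_le {p q d C K : ℝ} (hp : |p - d| ≤ 2 * C) (hq : |q - d| ≤ 2 * C)
    (hpq : |p - q| ≤ 2 * K) :
    |Real.exp (-|p|) - Real.exp (-|q|)| ≤ Real.exp (2 * C) * Real.exp (-|d|) * (2 * K) := by
  have aux : ∀ p q : ℝ, |p - d| ≤ 2 * C → |p| ≤ |q| → |p - q| ≤ 2 * K →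
      |Real.exp (-|p|) - Real.exp (-|q|)| ≤ Real.exp (2 * C) * Real.exp (-|d|) * (2 * K) := by
    intro p q hp hle hpq
    rw [abs_of_nonneg (sub_nonneg.2 (Real.exp_le_exp.2 (neg_le_neg hle))), ← Real.exp_add]
    have h1 : Real.exp (-|q|) = Real.exp (-|p|) * Real.exp (-(|q| - |p|)) := by
      rw [← Real.exp_add]; ring_nf
    have h2 : 1 - Real.exp (-(|q| - |p|)) ≤ |q| - |p| := by
      linarith [Real.add_one_le_exp (-(|q| - |p|))]
    have h3 : |q| - |p| ≤ 2 * K := by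
      rw [abs_sub_comm] at hpq; linarith [abs_sub_abs_le_abs_sub q p]
    have h4 : Real.exp (-|p|) ≤ Real.exp (2 * C + -|d|) := by
      apply Real.exp_le_exp.2
      rw [abs_sub_comm] at hp; linarith [abs_sub_abs_le_abs_sub d p]
    calc Real.exp (-|p|) - Real.exp (-|q|)
        = Real.exp (-|p|) * (1 - Real.exp (-(|q| - |p|))) := by rw [h1]; ring
      _ ≤ Real.exp (-|p|) * (2 * K) := by gcongr; exact h2.trans h3
      _ ≤ _ := by
        have : 0 ≤ 2 * K := (abs_nonneg _).trans hpq
        gcongr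
  rcases le_total |p| |q| with h | h
  · exact aux p q hp h hpq
  · rw [abs_sub_comm]
    exact aux q p hq h (by rwa [abs_sub_comm])

lemma exp_neg_abs_le {p d C : ℝ} (hp : |p - d| ≤ 2 * C) :
    Real.exp (-|p|) ≤ Real.exp (2 * C) * Real.exp (-|d|) := by
  rw [← Real.exp_add]
  apply Real.exp_le_exp.2
  rw [abs_sub_comm] at hp; linarith [abs_sub_abs_le_abs_sub d p]

/-- The energy density driving the pressure. -/
noncomputable def LagVar.density (Θ : LagVar) (η : ℝ) : ℝ := 2 * Θ.U η ^ 2 * Θ.yξ η + Θ.hbar η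

/-- All Lagrangian variables at the label `ξ` are bounded by `C`. -/
structure LagVar.BddAt (Θ : LagVar) (C ξ : ℝ) : Prop where
  y : |Θ.y ξ - ξ| ≤ C
  U : |Θ.U ξ| ≤ C
  yξ : |Θ.yξ ξ| ≤ C
  Uξ : |Θ.Uξ ξ| ≤ C
  h : |Θ.h ξ| ≤ C
  hbar : |Θ.hbar ξ| ≤ C

/-- The evolving Lagrangian variables at the label `ξ` differ by at most `K`. -/
structure LagVar.CloseAt (Θ Θ' : LagVar) (K ξ : ℝ) : Prop where
  y : |Θ.y ξ - Θ'.y ξ| ≤ K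
  U : |Θ.U ξ - Θ'.U ξ| ≤ K
  yξ : |Θ.yξ ξ - Θ'.yξ ξ| ≤ K
  Uξ : |Θ.Uξ ξ - Θ'.Uξ ξ| ≤ K
  h : |Θ.h ξ - Θ'.h ξ| ≤ K

lemma MemF.aestronglyMeasurable_density {Θ : LagVar} (h : MemF Θ) :
    AEStronglyMeasurable Θ.density volume :=
  (((h.U_L2.1.pow 2).const_mul 2).mul h.y_ac.1.aestronglyMeasurable).add h.hbar_meas

lemma LagVar.BddAt.density_le {Θ : LagVar} {C ξ : ℝ} (hC : 1 ≤ C) (h : Θ.BddAt C ξ) :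
    |Θ.density ξ| ≤ 3 * C ^ 3 := by
  have h1 : |Θ.density ξ| ≤ 2 * |Θ.U ξ| ^ 2 * |Θ.yξ ξ| + |Θ.hbar ξ| := by
    refine (abs_add_le _ _).trans (le_of_eq ?_)
    rw [abs_mul, abs_mul, abs_pow, abs_two]
  have h2 : 2 * |Θ.U ξ| ^ 2 * |Θ.yξ ξ| ≤ 2 * C ^ 2 * C := by
    gcongr
    exacts [h.U, h.yξ]
  nlinarith [h.hbar, mul_nonneg (sub_nonneg.2 hC) (sub_nonneg.2 hC)]

lemma LagVar.BddAt.density_sub_le {Θ Θ' : LagVar} {C K ξ : ℝ} (hC : 1 ≤ C) (h : Θ.BddAt C ξ)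
    (h' : Θ'.BddAt C ξ) (hK : Θ.CloseAt Θ' K ξ) (hb : |Θ.hbar ξ - Θ'.hbar ξ| ≤ K) :
    |Θ.density ξ - Θ'.density ξ| ≤ 7 * C ^ 2 * K := by
  have K0 : 0 ≤ K := (abs_nonneg _).trans hb
  have e : Θ.density ξ - Θ'.density ξ = 2 * (Θ.U ξ - Θ'.U ξ) * (Θ.U ξ + Θ'.U ξ) * Θ.yξ ξ
      + 2 * Θ'.U ξ ^ 2 * (Θ.yξ ξ - Θ'.yξ ξ) + (Θ.hbar ξ - Θ'.hbar ξ) := by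
    unfold LagVar.density; ring
  have h1 : |2 * (Θ.U ξ - Θ'.U ξ) * (Θ.U ξ + Θ'.U ξ) * Θ.yξ ξ| ≤ 2 * K * (C + C) * C := by
    rw [abs_mul, abs_mul, abs_mul, abs_two]
    have : |Θ.U ξ + Θ'.U ξ| ≤ C + C := (abs_add_le _ _).trans (add_le_add h.U h'.U)
    gcongr
    exacts [hK.U, h.yξ]
  have h2 : |2 * Θ'.U ξ ^ 2 * (Θ.yξ ξ - Θ'.yξ ξ)| ≤ 2 * C ^ 2 * K := by
    rw [abs_mul, abs_mul, abs_pow, abs_two]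
    gcongr
    exacts [h'.U, hK.yξ]
  rw [e]
  have h3 := abs_add_three (2 * (Θ.U ξ - Θ'.U ξ) * (Θ.U ξ + Θ'.U ξ) * Θ.yξ ξ)
    (2 * Θ'.U ξ ^ 2 * (Θ.yξ ξ - Θ'.yξ ξ)) (Θ.hbar ξ - Θ'.hbar ξ)
  have h4 : K ≤ C ^ 2 * K := le_mul_of_one_le_left K0 (one_le_pow₀ hC)
  linarith

/-! ### Bounds and Lipschitz estimates for the pressure terms -/

section Kernel

variable {Θ Θ' : LagVar} {C : ℝ} {σ : ℝ → ℝ}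

/-- The weight σ lets one estimate serve both P (σ = 1) and Q (σ = sign(ξ - ·)). As y stays within C
of the label, the kernel in y is at most e^{2C} times the kernel in the labels. -/
lemma abs_kernel_le {ξ : ℝ} (hC : 1 ≤ C) (hσ : ∀ η, |σ η| ≤ 1) (hξ : |Θ.y ξ - ξ| ≤ C) {η : ℝ}
    (hη : Θ.BddAt C η) :
    |σ η * Real.exp (-|Θ.y ξ - Θ.y η|) * Θ.density η| ≤
      Real.exp (2 * C) * (3 * C ^ 3) * Real.exp (-|ξ - η|) := by
  rw [abs_mul, abs_mul, Real.abs_exp]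
  have h1 : Real.exp (-|Θ.y ξ - Θ.y η|) ≤ Real.exp (2 * C) * Real.exp (-|ξ - η|) := by
    apply exp_neg_abs_le
    have := abs_sub (Θ.y ξ - ξ) (Θ.y η - η)
    have h2 := hη.y
    rw [show Θ.y ξ - Θ.y η - (ξ - η) = Θ.y ξ - ξ - (Θ.y η - η) by ring]
    linarith
  calc _ ≤ 1 * (Real.exp (2 * C) * Real.exp (-|ξ - η|)) * (3 * C ^ 3) := by
        gcongr
        exacts [hσ η, hη.density_le hC]
    _ = _ := by ring

lemma integrable_kernel {ξ : ℝ} (hΘ : MemF Θ) (hC : 1 ≤ C) (hσm : Measurable σ)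
    (hσ : ∀ η, |σ η| ≤ 1) (hξ : |Θ.y ξ - ξ| ≤ C) (hB : ∀ᵐ η, Θ.BddAt C η) :
    Integrable fun η => σ η * Real.exp (-|Θ.y ξ - Θ.y η|) * Θ.density η := by
  refine Integrable.mono' (g := fun η => Real.exp (2 * C) * (3 * C ^ 3) * Real.exp (-|ξ - η|))
    ((integrable_exp_neg_abs_sub ξ).const_mul _) ?_ ?_
  · have := hΘ.y_ac.continuous
    refine (hσm.aestronglyMeasurable.mul ?_).mul hΘ.aestronglyMeasurable_density
    exact Continuous.aestronglyMeasurable (by fun_prop)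
  · filter_upwards [hB] with η hη using abs_kernel_le hC hσ hξ hη

lemma abs_integral_kernel_le {ξ : ℝ} (hC : 1 ≤ C)
    (hσ : ∀ η, |σ η| ≤ 1) (hξ : |Θ.y ξ - ξ| ≤ C) (hB : ∀ᵐ η, Θ.BddAt C η) :
    |∫ η, σ η * Real.exp (-|Θ.y ξ - Θ.y η|) * Θ.density η| ≤
      Real.exp (2 * C) * (3 * C ^ 3) * 2 := by
  exact abs_integral_le_of_le_exp_neg_abs (hB.mono fun η hη => abs_kernel_le hC hσ hξ hη)

/-- The constant is 13 = 2·3 + 7: the kernels differ by a multiple of 2K and multiply a density of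
size 3C³, and the densities differ by 7C²K ≤ 7C³K. The last factor 2 is the integral of e^{-|ξ -
η|}. -/
lemma abs_integral_kernel_sub_le {ξ K : ℝ} (hΘ : MemF Θ) (hΘ' : MemF Θ') (hC : 1 ≤ C)
    (hσm : Measurable σ) (hσ : ∀ η, |σ η| ≤ 1) (hξ : |Θ.y ξ - ξ| ≤ C) (hξ' : |Θ'.y ξ - ξ| ≤ C)
    (hK : |Θ.y ξ - Θ'.y ξ| ≤ K)
    (hB : ∀ᵐ η, Θ.BddAt C η) (hB' : ∀ᵐ η, Θ'.BddAt C η) (hcl : ∀ᵐ η, Θ.CloseAt Θ' K η)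
    (hb : ∀ᵐ η, |Θ.hbar η - Θ'.hbar η| ≤ K) :
    |(∫ η, σ η * Real.exp (-|Θ.y ξ - Θ.y η|) * Θ.density η) -
      ∫ η, σ η * Real.exp (-|Θ'.y ξ - Θ'.y η|) * Θ'.density η| ≤
      Real.exp (2 * C) * (13 * C ^ 3 * K) * 2 := by
  have K0 : 0 ≤ K := (abs_nonneg _).trans hK
  rw [← integral_sub (integrable_kernel hΘ hC hσm hσ hξ hB)
    (integrable_kernel hΘ' hC hσm hσ hξ' hB')]
  refine abs_integral_le_of_le_exp_neg_abs (x := ξ) ?_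
  filter_upwards [hB, hB', hcl, hb] with η h1 h2 h3 h4
  have e : σ η * Real.exp (-|Θ.y ξ - Θ.y η|) * Θ.density η -
      σ η * Real.exp (-|Θ'.y ξ - Θ'.y η|) * Θ'.density η =
      σ η * ((Real.exp (-|Θ.y ξ - Θ.y η|) - Real.exp (-|Θ'.y ξ - Θ'.y η|)) * Θ.density η +
      Real.exp (-|Θ'.y ξ - Θ'.y η|) * (Θ.density η - Θ'.density η)) := by ring
  have a1 : |Θ.y ξ - Θ.y η - (ξ - η)| ≤ 2 * C := by
    rw [show Θ.y ξ - Θ.y η - (ξ - η) = Θ.y ξ - ξ - (Θ.y η - η) by ring]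
    linarith [abs_sub (Θ.y ξ - ξ) (Θ.y η - η), h1.y]
  have a2 : |Θ'.y ξ - Θ'.y η - (ξ - η)| ≤ 2 * C := by
    rw [show Θ'.y ξ - Θ'.y η - (ξ - η) = Θ'.y ξ - ξ - (Θ'.y η - η) by ring]
    linarith [abs_sub (Θ'.y ξ - ξ) (Θ'.y η - η), h2.y]
  have a3 : |Θ.y ξ - Θ.y η - (Θ'.y ξ - Θ'.y η)| ≤ 2 * K := by
    rw [show Θ.y ξ - Θ.y η - (Θ'.y ξ - Θ'.y η) = Θ.y ξ - Θ'.y ξ - (Θ.y η - Θ'.y η) by ring]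
    linarith [abs_sub (Θ.y ξ - Θ'.y ξ) (Θ.y η - Θ'.y η), h3.y]
  have b1 := abs_exp_neg_abs_sub_le a1 a2 a3
  have b2 := exp_neg_abs_le a2
  have b3 := h1.density_le hC
  have b4 := h1.density_sub_le hC h2 h3 h4
  rw [e, abs_mul]
  have c1 : |(Real.exp (-|Θ.y ξ - Θ.y η|) - Real.exp (-|Θ'.y ξ - Θ'.y η|)) * Θ.density η +
      Real.exp (-|Θ'.y ξ - Θ'.y η|) * (Θ.density η - Θ'.density η)| ≤
      Real.exp (2 * C) * Real.exp (-|ξ - η|) * (2 * K) * (3 * C ^ 3) +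
      Real.exp (2 * C) * Real.exp (-|ξ - η|) * (7 * C ^ 2 * K) := by
    refine (abs_add_le _ _).trans ?_
    rw [abs_mul, abs_mul, Real.abs_exp]
    gcongr
  have c2 : 7 * C ^ 2 * K ≤ 7 * C ^ 3 * K := by
    gcongr
    norm_num
  calc _ ≤ 1 * (Real.exp (2 * C) * Real.exp (-|ξ - η|) * (2 * K) * (3 * C ^ 3) +
      Real.exp (2 * C) * Real.exp (-|ξ - η|) * (7 * C ^ 2 * K)) := by
        gcongr
        exact hσ η
    _ ≤ 1 * (Real.exp (2 * C) * Real.exp (-|ξ - η|) * (2 * K) * (3 * C ^ 3) +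
      Real.exp (2 * C) * Real.exp (-|ξ - η|) * (7 * C ^ 3 * K)) := by gcongr
    _ = _ := by ring

lemma LagVar.P_eq_kernel (Θ : LagVar) (ξ : ℝ) :
    Θ.P ξ = 1 / 4 * ∫ η, (fun _ => (1 : ℝ)) η * Real.exp (-|Θ.y ξ - Θ.y η|) * Θ.density η := by
  simp only [LagVar.P, LagVar.density, one_mul]

lemma LagVar.Q_eq_kernel (Θ : LagVar) (ξ : ℝ) :
    Θ.Q ξ = -(1 / 4) * ∫ η, (fun η => Real.sign (ξ - η)) η * Real.exp (-|Θ.y ξ - Θ.y η|) *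
      Θ.density η := by
  simp only [LagVar.Q, LagVar.density]

lemma abs_sign_le_one (x : ℝ) : |Real.sign x| ≤ 1 := by
  rcases Real.sign_apply_eq x with h | h | h <;> simp [h]

lemma measurable_sign_sub (ξ : ℝ) : Measurable fun η => Real.sign (ξ - η) := by
  have : Measurable Real.sign := by
    unfold Real.sign
    exact Measurable.ite measurableSet_Iio measurable_const
      (Measurable.ite measurableSet_Ioi measurable_const measurable_const)
  exact this.comp (measurable_const.sub measurable_id)

lemma LagVar.abs_P_le {ξ : ℝ} (hC : 1 ≤ C) (hξ : |Θ.y ξ - ξ| ≤ C) (hB : ∀ᵐ η, Θ.BddAt C η) :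
    |Θ.P ξ| ≤ 7 * C ^ 3 * Real.exp (2 * C) := by
  rw [LagVar.P_eq_kernel, abs_mul, abs_of_pos (by norm_num : (0 : ℝ) < 1 / 4)]
  have := abs_integral_kernel_le (σ := fun _ => 1) hC (by simp) hξ hB
  have : 0 < C ^ 3 * Real.exp (2 * C) := by positivity
  nlinarith

lemma LagVar.abs_P_sub_le {ξ K : ℝ} (hΘ : MemF Θ) (hΘ' : MemF Θ') (hC : 1 ≤ C)
    (hξ : |Θ.y ξ - ξ| ≤ C) (hξ' : |Θ'.y ξ - ξ| ≤ C) (hK : |Θ.y ξ - Θ'.y ξ| ≤ K)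
    (hB : ∀ᵐ η, Θ.BddAt C η) (hB' : ∀ᵐ η, Θ'.BddAt C η) (hcl : ∀ᵐ η, Θ.CloseAt Θ' K η)
    (hb : ∀ᵐ η, |Θ.hbar η - Θ'.hbar η| ≤ K) :
    |Θ.P ξ - Θ'.P ξ| ≤ 7 * C ^ 3 * Real.exp (2 * C) * K := by
  rw [LagVar.P_eq_kernel, LagVar.P_eq_kernel, ← mul_sub, abs_mul,
    abs_of_pos (by norm_num : (0 : ℝ) < 1 / 4)]
  have := abs_integral_kernel_sub_le (σ := fun _ => 1) hΘ hΘ' hC measurable_const (by simp)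
    hξ hξ' hK hB hB' hcl hb
  have K0 : 0 ≤ K := (abs_nonneg _).trans hK
  have : 0 ≤ C ^ 3 * Real.exp (2 * C) * K := by positivity
  nlinarith

lemma LagVar.abs_Q_sub_le {ξ K : ℝ} (hΘ : MemF Θ) (hΘ' : MemF Θ') (hC : 1 ≤ C)
    (hξ : |Θ.y ξ - ξ| ≤ C) (hξ' : |Θ'.y ξ - ξ| ≤ C) (hK : |Θ.y ξ - Θ'.y ξ| ≤ K)
    (hB : ∀ᵐ η, Θ.BddAt C η) (hB' : ∀ᵐ η, Θ'.BddAt C η) (hcl : ∀ᵐ η, Θ.CloseAt Θ' K η)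
    (hb : ∀ᵐ η, |Θ.hbar η - Θ'.hbar η| ≤ K) :
    |Θ.Q ξ - Θ'.Q ξ| ≤ 7 * C ^ 3 * Real.exp (2 * C) * K := by
  rw [LagVar.Q_eq_kernel, LagVar.Q_eq_kernel, ← mul_sub, abs_mul, abs_neg,
    abs_of_pos (by norm_num : (0 : ℝ) < 1 / 4)]
  have := abs_integral_kernel_sub_le (σ := fun η => Real.sign (ξ - η)) hΘ hΘ' hC
    (measurable_sign_sub ξ) (fun η => abs_sign_le_one _) hξ hξ' hK hB hB' hcl hb
  have K0 : 0 ≤ K := (abs_nonneg _).trans hK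
  have : 0 ≤ C ^ 3 * Real.exp (2 * C) * K := by positivity
  nlinarith

end Kernel

/-! ### Short-time contraction and continuation of agreement -/

section Step

variable {Θ Θ' : ℝ → LagVar}

lemma abs_mul_sub_mul_le {x y x' y' A B a b : ℝ} (hx : |x| ≤ A) (hy : |y'| ≤ B)
    (hxx : |x - x'| ≤ a) (hyy : |y - y'| ≤ b) : |x * y - x' * y'| ≤ A * b + a * B := by
  have e : x * y - x' * y' = x * (y - y') + (x - x') * y' := by ring
  rw [e]
  refine (abs_add_le _ _).trans ?_
  rw [abs_mul, abs_mul]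
  have := (abs_nonneg _).trans hx
  have := (abs_nonneg _).trans hxx
  gcongr

/-- One contraction step: on a short time interval the distance of two solutions is halved. -/
lemma IsDissipativeSolution.closeAt_half (hΘ : IsDissipativeSolution Θ)
    (hΘ' : IsDissipativeSolution Θ') {a b C K : ℝ} (ha : 0 ≤ a) (hC : 1 ≤ C)
    (hB : ∀ᵐ ξ, ∀ t ∈ Set.Icc a b, (Θ t).BddAt C ξ)
    (hB' : ∀ᵐ ξ, ∀ t ∈ Set.Icc a b, (Θ' t).BddAt C ξ)
    (h0 : ∀ᵐ ξ, (Θ a).CloseAt (Θ' a) 0 ξ)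
    (hb : ∀ᵐ ξ, ∀ t ∈ Set.Icc a b,
      |(Θ t).hbar ξ - (Θ' t).hbar ξ| ≤ |(Θ t).h ξ - (Θ' t).h ξ|)
    (hab : 42 * C ^ 4 * Real.exp (2 * C) * (b - a) ≤ 1 / 2)
    (hK : ∀ᵐ ξ, ∀ t ∈ Set.Icc a b, (Θ t).CloseAt (Θ' t) K ξ) :
    ∀ᵐ ξ, ∀ t ∈ Set.Icc a b, (Θ t).CloseAt (Θ' t) (K / 2) ξ := by
  -- B bounds P and is a Lipschitz constant of P and Q. It turns out that all five right-hand sides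
  -- differ by at most 6BCK, and 6BC = 42C⁴e^{2C} is the constant in `hab`.
  set B : ℝ := 7 * C ^ 3 * Real.exp (2 * C) with hBdef
  have hBC : 7 * C ^ 3 ≤ B := le_mul_of_one_le_right (by positivity) (Real.one_le_exp (by linarith))
  have hC2 : C ≤ C ^ 2 := by nlinarith
  have hC3 : C ^ 2 ≤ C ^ 3 := by nlinarith [sq_nonneg C]
  have hBB : 7 * C ≤ B := by linarith
  filter_upwards [hB, hB', h0, hb, hK, hΘ.eq_yξ, hΘ'.eq_yξ, hΘ.eq_Uξ, hΘ'.eq_Uξ, hΘ.eq_h,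
    hΘ'.eq_h] with ξ i1 i2 i3 i4 i5 e1 e1' e2 e2' e3 e3' t ht
  have hPt : ∀ s ∈ Set.Icc a b, |(Θ s).P ξ - (Θ' s).P ξ| ≤ B * K ∧
      |(Θ s).Q ξ - (Θ' s).Q ξ| ≤ B * K ∧ |(Θ s).P ξ| ≤ B ∧ |(Θ' s).P ξ| ≤ B := by
    intro s hs
    have hs0 : 0 ≤ s := ha.trans hs.1
    have j1 : ∀ᵐ η, (Θ s).BddAt C η := hB.mono fun η h => h s hs
    have j2 : ∀ᵐ η, (Θ' s).BddAt C η := hB'.mono fun η h => h s hs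
    have j3 : ∀ᵐ η, (Θ s).CloseAt (Θ' s) K η := hK.mono fun η h => h s hs
    have j4 : ∀ᵐ η, |(Θ s).hbar η - (Θ' s).hbar η| ≤ K := by
      filter_upwards [hb, j3] with η k1 k2 using (k1 s hs).trans k2.h
    exact ⟨LagVar.abs_P_sub_le (hΘ.memF s hs0) (hΘ'.memF s hs0) hC (i1 s hs).y (i2 s hs).y
      (i5 s hs).y j1 j2 j3 j4, LagVar.abs_Q_sub_le (hΘ.memF s hs0) (hΘ'.memF s hs0) hC
      (i1 s hs).y (i2 s hs).y (i5 s hs).y j1 j2 j3 j4, LagVar.abs_P_le hC (i1 s hs).y j1,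
      LagVar.abs_P_le hC (i2 s hs).y j2⟩
  have K0 : 0 ≤ K := (abs_nonneg _).trans (i5 t ht).y
  have hBCK : 7 * C * K ≤ B * K := by gcongr
  have hBCK' : B * K ≤ B * C * K := by
    have : B * 1 * K ≤ B * C * K := by gcongr
    linarith
  have hCC : 7 * C * C * K ≤ B * C * K := by gcongr
  have hKK : K ≤ C * K := le_mul_of_one_le_left K0 hC
  have fin : ∀ {x : ℝ}, |x| ≤ 6 * B * C * K * (t - a) → |x| ≤ K / 2 := by
    intro x hx
    have h1 : 6 * B * C * K * (t - a) ≤ 6 * B * C * K * (b - a) := by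
      have := ht.2
      gcongr
    have h2 : 42 * C ^ 4 * Real.exp (2 * C) * (b - a) * K ≤ 1 / 2 * K := by gcongr
    calc |x| ≤ _ := hx
      _ ≤ _ := h1
      _ = 42 * C ^ 4 * Real.exp (2 * C) * (b - a) * K := by rw [hBdef]; ring
      _ ≤ _ := by linarith
  -- The factor U² - P multiplies y_ξ in the equation for U_ξ and U_ξ in the equation for h, so x
  -- stands for either. The bound 5/2 uses 7C ≤ B.
  have prod : ∀ s ∈ Set.Icc a b, ∀ {x x' : ℝ}, |x| ≤ C → |x'| ≤ C → |x - x'| ≤ K →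
      |((Θ s).U ξ ^ 2 - (Θ s).P ξ) * x - ((Θ' s).U ξ ^ 2 - (Θ' s).P ξ) * x'| ≤
        5 / 2 * (B * C * K) := by
    intro s hs x x' hx hx' hxx
    obtain ⟨p1, p2, p3, p4⟩ := hPt s hs
    have u1 : |(Θ s).U ξ ^ 2 - (Θ' s).U ξ ^ 2| ≤ C * K + K * C := by
      rw [sq, sq]
      exact abs_mul_sub_mul_le (i1 s hs).U (i2 s hs).U (i5 s hs).U (i5 s hs).U
    have u2 : |((Θ s).U ξ ^ 2 - (Θ s).P ξ) - ((Θ' s).U ξ ^ 2 - (Θ' s).P ξ)| ≤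
        2 * C * K + B * K := by
      rw [show ((Θ s).U ξ ^ 2 - (Θ s).P ξ) - ((Θ' s).U ξ ^ 2 - (Θ' s).P ξ) =
        ((Θ s).U ξ ^ 2 - (Θ' s).U ξ ^ 2) - ((Θ s).P ξ - (Θ' s).P ξ) by ring]
      refine (abs_sub _ _).trans ?_
      linarith
    have u3 : |(Θ s).U ξ ^ 2 - (Θ s).P ξ| ≤ C ^ 2 + B := by
      refine (abs_sub _ _).trans ?_
      rw [abs_pow]
      have := (i1 s hs).U
      gcongr
    refine (abs_mul_sub_mul_le u3 hx' u2 hxx).trans ?_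
    have : C ^ 2 * K = C * C * K := by ring
    nlinarith
  refine ⟨fin ?_, fin ?_, fin ?_, fin ?_, fin ?_⟩
  · refine (hΘ.eq_y ξ).abs_sub_le (hΘ'.eq_y ξ) ha ht.1
      (sub_eq_zero.1 (abs_nonpos_iff.1 i3.y)) fun s hs => ?_
    have hs' : s ∈ Set.Icc a b := ⟨hs.1, hs.2.trans ht.2⟩
    have := (i5 s hs').U
    linarith
  · refine (hΘ.eq_U ξ).abs_sub_le (hΘ'.eq_U ξ) ha ht.1
      (sub_eq_zero.1 (abs_nonpos_iff.1 i3.U)) fun s hs => ?_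
    have hs' : s ∈ Set.Icc a b := ⟨hs.1, hs.2.trans ht.2⟩
    rw [neg_sub_neg, abs_sub_comm]
    have := (hPt s hs').2.1
    linarith
  · refine e1.abs_sub_le e1' ha ht.1
      (sub_eq_zero.1 (abs_nonpos_iff.1 i3.yξ)) fun s hs => ?_
    have hs' : s ∈ Set.Icc a b := ⟨hs.1, hs.2.trans ht.2⟩
    have := (i5 s hs').Uξ
    linarith
  · refine e2.abs_sub_le e2' ha ht.1
      (sub_eq_zero.1 (abs_nonpos_iff.1 i3.Uξ)) fun s hs => ?_
    have hs' : s ∈ Set.Icc a b := ⟨hs.1, hs.2.trans ht.2⟩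
    have q1 := prod s hs' (i1 s hs').yξ (i2 s hs').yξ (i5 s hs').yξ
    have q2 := (i4 s hs').trans (i5 s hs').h
    rw [abs_le] at *
    constructor <;> linarith [q1.1, q1.2, q2.1, q2.2]
  · refine e3.abs_sub_le e3' ha ht.1
      (sub_eq_zero.1 (abs_nonpos_iff.1 i3.h)) fun s hs => ?_
    have hs' : s ∈ Set.Icc a b := ⟨hs.1, hs.2.trans ht.2⟩
    have q1 := prod s hs' (i1 s hs').Uξ (i2 s hs').Uξ (i5 s hs').Uξ
    rw [mul_assoc, mul_assoc, ← mul_sub, abs_mul, abs_two]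
    linarith

/-- Solutions which agree at time `a` agree on a short time interval. -/
lemma IsDissipativeSolution.closeAt_zero (hΘ : IsDissipativeSolution Θ)
    (hΘ' : IsDissipativeSolution Θ') {a b C : ℝ} (ha : 0 ≤ a) (hC : 1 ≤ C)
    (hB : ∀ᵐ ξ, ∀ t ∈ Set.Icc a b, (Θ t).BddAt C ξ)
    (hB' : ∀ᵐ ξ, ∀ t ∈ Set.Icc a b, (Θ' t).BddAt C ξ)
    (h0 : ∀ᵐ ξ, (Θ a).CloseAt (Θ' a) 0 ξ)
    (hb : ∀ᵐ ξ, ∀ t ∈ Set.Icc a b,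
      |(Θ t).hbar ξ - (Θ' t).hbar ξ| ≤ |(Θ t).h ξ - (Θ' t).h ξ|)
    (hab : 42 * C ^ 4 * Real.exp (2 * C) * (b - a) ≤ 1 / 2) :
    ∀ᵐ ξ, ∀ t ∈ Set.Icc a b, (Θ t).CloseAt (Θ' t) 0 ξ := by
  -- The bounds alone give distance 2C, which is then halved repeatedly. Only countably many null
  -- sets of labels are discarded.
  have key : ∀ n : ℕ, ∀ᵐ ξ, ∀ t ∈ Set.Icc a b, (Θ t).CloseAt (Θ' t) (2 * C / 2 ^ n) ξ := by
    intro n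
    induction n with
    | zero =>
      filter_upwards [hB, hB'] with ξ h1 h2 t ht
      have k1 := h1 t ht
      have k2 := h2 t ht
      have aux : ∀ {x y : ℝ}, |x| ≤ C → |y| ≤ C → |x - y| ≤ 2 * C / 2 ^ 0 := by
        intro x y hx hy
        rw [pow_zero, div_one]
        linarith [abs_sub x y]
      refine ⟨?_, aux k1.U k2.U, aux k1.yξ k2.yξ, aux k1.Uξ k2.Uξ, aux k1.h k2.h⟩
      have := aux k1.y k2.y
      rwa [sub_sub_sub_cancel_right] at this
    | succ n ih =>
      have := hΘ.closeAt_half hΘ' ha hC hB hB' h0 hb hab ih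
      rwa [div_div, ← pow_succ] at this
  have lim : Tendsto (fun n : ℕ => 2 * C / 2 ^ n) atTop (𝓝 0) :=
    tendsto_const_nhds.div_atTop (tendsto_pow_atTop_atTop_of_one_lt (by norm_num))
  filter_upwards [ae_all_iff.2 key] with ξ h t ht
  exact ⟨ge_of_tendsto' lim fun n => (h n t ht).y, ge_of_tendsto' lim fun n => (h n t ht).U,
    ge_of_tendsto' lim fun n => (h n t ht).yξ, ge_of_tendsto' lim fun n => (h n t ht).Uξ,
    ge_of_tendsto' lim fun n => (h n t ht).h⟩

/-- The bound on h̄ is not part of `bounded`; it follows because h̄ is either h or 0. -/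
lemma IsDissipativeSolution.exists_bddAt (hΘ : IsDissipativeSolution Θ) (T : ℝ) :
    ∃ C : ℝ, ∀ᵐ ξ, ∀ t ∈ Set.Icc 0 T, (Θ t).BddAt C ξ := by
  obtain ⟨C, hC⟩ := hΘ.bounded T
  refine ⟨C, ?_⟩
  filter_upwards [hC, hΘ.hbar_eq] with ξ h1 h2 t ht
  obtain ⟨k1, k2, k3, k4, k5⟩ := h1 t ht
  refine ⟨k1, k2, k3, k4, k5, ?_⟩
  by_cases h : ∀ s ∈ Set.Icc 0 t, (Θ s).yξ ξ ≠ 0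
  · rw [(h2 t ht.1).1 h]; exact k5
  · push Not at h
    rw [(h2 t ht.1).2 h, abs_zero]
    exact (abs_nonneg _).trans k1

lemma LagVar.BddAt.mono {Θ : LagVar} {C C' ξ : ℝ} (h : Θ.BddAt C ξ) (hC : C ≤ C') :
    Θ.BddAt C' ξ :=
  ⟨h.y.trans hC, h.U.trans hC, h.yξ.trans hC, h.Uξ.trans hC, h.h.trans hC, h.hbar.trans hC⟩

/-- If the wave breaking of `Θ` up to time `b` is that of `Θ'` as long as the two solutions agree
and, for a short time `δ`, afterwards, then agreement up to time `a` extends to time `b`. -/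
lemma IsDissipativeSolution.closeAt_zero_of_extend (hΘ : IsDissipativeSolution Θ)
    (hΘ' : IsDissipativeSolution Θ') {a b δ : ℝ} (ha : 0 ≤ a) (hδ : 0 < δ)
    (h0 : ∀ᵐ ξ, ∀ t ∈ Set.Icc 0 a, (Θ t).CloseAt (Θ' t) 0 ξ)
    (hb : ∀ T ∈ Set.Icc a b, (∀ᵐ ξ, ∀ t ∈ Set.Icc 0 T, (Θ t).CloseAt (Θ' t) 0 ξ) →
      ∀ᵐ ξ, ∀ t ∈ Set.Icc T (min (T + δ) b),
        |(Θ t).hbar ξ - (Θ' t).hbar ξ| ≤ |(Θ t).h ξ - (Θ' t).h ξ|) :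
    ∀ᵐ ξ, ∀ t ∈ Set.Icc 0 b, (Θ t).CloseAt (Θ' t) 0 ξ := by
  obtain ⟨C₁, hC₁⟩ := hΘ.exists_bddAt b
  obtain ⟨C₂, hC₂⟩ := hΘ'.exists_bddAt b
  obtain ⟨C, hC, h1, h2⟩ : ∃ C : ℝ, 1 ≤ C ∧ C₁ ≤ C ∧ C₂ ≤ C :=
    ⟨max 1 (max C₁ C₂), le_max_left _ _, (le_max_left _ _).trans (le_max_right _ _),
      (le_max_right _ _).trans (le_max_right _ _)⟩
  set R : ℝ := 42 * C ^ 4 * Real.exp (2 * C) with hR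
  have R0 : 0 < R := by positivity
  -- The step length depends only on δ and on the bound C valid on all of [0, b]. It does not shrink
  -- along the way, so finitely many steps reach b.
  obtain ⟨ε, hε, hε1, hε2⟩ : ∃ ε : ℝ, 0 < ε ∧ ε ≤ δ ∧ R * ε ≤ 1 / 2 := by
    refine ⟨min δ (1 / (2 * R)), by positivity, min_le_left _ _, ?_⟩
    calc R * min δ (1 / (2 * R)) ≤ R * (1 / (2 * R)) := by gcongr; exact min_le_right _ _
      _ = 1 / 2 := by field_simp
  have key : ∀ n : ℕ, ∀ᵐ ξ, ∀ t ∈ Set.Icc 0 (min (a + n * ε) b), (Θ t).CloseAt (Θ' t) 0 ξ := by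
    intro n
    induction n with
    | zero =>
      filter_upwards [h0] with ξ h t ht
      refine h t ⟨ht.1, ht.2.trans ((min_le_left _ _).trans (by simp))⟩
    | succ n ih =>
      by_cases hn : b ≤ a + n * ε
      · filter_upwards [ih] with ξ h t ht
        refine h t ⟨ht.1, ?_⟩
        rw [min_eq_right hn]
        exact ht.2.trans (min_le_right _ _)
      push Not at hn
      rw [min_eq_left hn.le] at ih
      set T := a + n * ε with hT
      have haT : a ≤ T := by rw [hT]; linarith [show (0 : ℝ) ≤ n * ε by positivity]
      have hT0 : 0 ≤ T := ha.trans haT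
      set b' := min (T + ε) b with hb'
      have hTb' : T ≤ b' := le_min (by linarith) hn.le
      have e1 : ∀ᵐ ξ, ∀ t ∈ Set.Icc T b', (Θ t).CloseAt (Θ' t) 0 ξ := by
        refine hΘ.closeAt_zero hΘ' hT0 hC ?_ ?_ ?_ ?_ ?_
        · filter_upwards [hC₁] with ξ h t ht
          exact (h t ⟨hT0.trans ht.1, ht.2.trans (min_le_right _ _)⟩).mono h1
        · filter_upwards [hC₂] with ξ h t ht
          exact (h t ⟨hT0.trans ht.1, ht.2.trans (min_le_right _ _)⟩).mono h2
        · filter_upwards [ih] with ξ h using h T ⟨hT0, le_rfl⟩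
        · filter_upwards [hb T ⟨haT, hn.le⟩ ih] with ξ h t ht
          exact h t ⟨ht.1, ht.2.trans (min_le_min_right _ (by linarith))⟩
        · calc R * (b' - T) ≤ R * ε := by
                gcongr
                have := min_le_left (T + ε) b
                linarith
            _ ≤ _ := hε2
      filter_upwards [ih, e1] with ξ k1 k2 t ht
      rcases le_total t T with h | h
      · exact k1 t ⟨ht.1, h⟩
      · refine k2 t ⟨h, ht.2.trans (le_of_eq ?_)⟩
        rw [hb', hT]; push_cast; ring_nf
  obtain ⟨n, hn⟩ := exists_nat_gt ((b - a) / ε)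
  have := key n
  rwa [min_eq_right] at this
  rw [div_lt_iff₀ hε] at hn
  linarith

end Step

/-! ### Membership in 𝓕 and identification of P and Q for piecewise smooth profiles -/

section Profile

lemma integrable_exp_neg_abs : Integrable fun η : ℝ => Real.exp (-|η|) := by
  simpa using integrable_exp_neg_abs_sub 0

lemma aestronglyMeasurable_of_continuousAt_off {f : ℝ → ℝ} {S : Set ℝ} (hS : S.Countable)
    (hf : ∀ ξ ∉ S, ContinuousAt f ξ) : AEStronglyMeasurable f volume := by
  have h1 : AEStronglyMeasurable f (volume.restrict Sᶜ) :=
    ContinuousOn.aestronglyMeasurable (fun ξ hξ => (hf ξ hξ).continuousWithinAt)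
      hS.measurableSet.compl
  rwa [Measure.restrict_eq_self_of_ae_mem] at h1
  exact (hS.ae_notMem volume)

lemma integrable_of_le_exp {f : ℝ → ℝ} {C : ℝ} (hf : AEStronglyMeasurable f volume)
    (h : ∀ ξ, |f ξ| ≤ C * Real.exp (-|ξ|)) : Integrable f :=
  (integrable_exp_neg_abs.const_mul C).mono' hf (ae_of_all _ h)

lemma memLp_two_of_le_exp {f : ℝ → ℝ} {C : ℝ} (hf : AEStronglyMeasurable f volume)
    (h : ∀ ξ, |f ξ| ≤ C * Real.exp (-|ξ|)) : MemLp f 2 volume := by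
  rw [memLp_two_iff_integrable_sq hf]
  refine integrable_of_le_exp (C := C ^ 2) (hf.pow 2) fun ξ => ?_
  rw [abs_pow]
  calc |f ξ| ^ 2 ≤ (C * Real.exp (-|ξ|)) ^ 2 := by gcongr; exact h ξ
    _ = C ^ 2 * (Real.exp (-|ξ|) * Real.exp (-|ξ|)) := by ring
    _ ≤ C ^ 2 * (Real.exp (-|ξ|) * 1) := by
      gcongr
      exact Real.exp_le_one_iff.2 (neg_nonpos.2 (abs_nonneg _))
    _ = _ := by rw [mul_one]

lemma le_of_le_exp {f : ℝ → ℝ} {C : ℝ} (h : ∀ ξ, |f ξ| ≤ C * Real.exp (-|ξ|)) (ξ : ℝ) :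
    |f ξ| ≤ C := by
  have hC : 0 ≤ C := by simpa using (abs_nonneg _).trans (h 0)
  exact (h ξ).trans (mul_le_of_le_one_right hC
    (Real.exp_le_one_iff.2 (neg_nonpos.2 (abs_nonneg _))))

lemma memLp_top_of_le_exp {f : ℝ → ℝ} {C : ℝ} (hf : AEStronglyMeasurable f volume)
    (h : ∀ ξ, |f ξ| ≤ C * Real.exp (-|ξ|)) : MemLp f ⊤ volume :=
  memLp_top_of_bound hf C (ae_of_all _ (le_of_le_exp h))

lemma isACWithDeriv_of_hasDerivAt_off {f g : ℝ → ℝ} {S : Set ℝ} (hS : S.Countable)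
    (hf : Continuous f) (hd : ∀ ξ ∉ S, HasDerivAt f (g ξ) ξ) (hg : LocallyIntegrable g volume) :
    IsACWithDeriv f g := by
  refine ⟨hg, fun a b => ?_⟩
  rw [integral_eq_of_hasDerivAt_off_countable f g hS hf.continuousOn (fun x hx => hd x hx.2)
    (hg.integrableOn_isCompact isCompact_uIcc).intervalIntegrable]

/-- A derivative between δ > 0 and C makes f strictly increasing and bi-Lipschitz, and bounded
distance from the identity makes it onto. -/
lemma memG_of_isACWithDeriv {f g : ℝ → ℝ} {δ C B : ℝ} (hf : IsACWithDeriv f g) (hδ : 0 < δ)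
    (hg : ∀ᵐ ξ, δ ≤ g ξ) (hg' : ∀ᵐ ξ, g ξ ≤ C) (hB : ∀ ξ, |f ξ - ξ| ≤ B)
    (h2 : MemLp (fun ξ => g ξ - 1) 2 volume) : MemG f := by
  have hint : ∀ a b, IntervalIntegrable g volume a b := fun a b =>
    (hf.1.integrableOn_isCompact isCompact_uIcc).intervalIntegrable
  have lower : ∀ a b, a ≤ b → δ * (b - a) ≤ f b - f a := by
    intro a b hab
    rw [hf.2 a b]
    have := intervalIntegral.integral_mono_ae (μ := volume) hab
      (intervalIntegrable_const (c := δ)) (hint a b) hg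
    rw [intervalIntegral.integral_const, smul_eq_mul] at this
    linarith
  have upper : ∀ a b, a ≤ b → f b - f a ≤ C * (b - a) := by
    intro a b hab
    rw [hf.2 a b]
    have := intervalIntegral.integral_mono_ae (μ := volume) hab (hint a b)
      (intervalIntegrable_const (c := C)) hg'
    rw [intervalIntegral.integral_const, smul_eq_mul] at this
    linarith
  have mono : StrictMono f := fun a b hab => by
    have := lower a b hab.le
    have : 0 < δ * (b - a) := mul_pos hδ (sub_pos.2 hab)
    linarith
  have surj : Function.Surjective f := by
    refine hf.continuous.surjective ?_ ?_
    · refine tendsto_atTop_mono (f := fun x => x - B) (fun x => ?_)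
        (tendsto_atTop_add_const_right _ (-B) tendsto_id)
      have := (abs_le.1 (hB x)).1
      linarith
    · refine tendsto_atBot_mono (fun x => ?_)
        (tendsto_atBot_add_const_right _ B tendsto_id : Tendsto (fun x : ℝ => x + B) atBot atBot)
      have := (abs_le.1 (hB x)).2
      linarith
  set e : ℝ ≃ₜ ℝ := (mono.orderIsoOfSurjective f surj).toHomeomorph with he
  have hef : ∀ x, e x = f x := fun x => rfl
  have hef' : (e : ℝ → ℝ) = f := rfl
  have hfs : ∀ x, f (e.symm x) = x := fun x => e.apply_symm_apply x
  have lipf : ∀ x y, |f x - f y| ≤ C * |x - y| := by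
    intro x y
    rcases le_total x y with h | h
    · rw [abs_sub_comm, abs_sub_comm x, abs_of_nonneg (sub_nonneg.2 (mono.monotone h)),
        abs_of_nonneg (sub_nonneg.2 h)]
      exact upper x y h
    · rw [abs_of_nonneg (sub_nonneg.2 (mono.monotone h)), abs_of_nonneg (sub_nonneg.2 h)]
      exact upper y x h
  have lips : ∀ x y, δ * |x - y| ≤ |f x - f y| := by
    intro x y
    rcases le_total x y with h | h
    · rw [abs_sub_comm, abs_sub_comm (f x), abs_of_nonneg (sub_nonneg.2 (mono.monotone h)),
        abs_of_nonneg (sub_nonneg.2 h)]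
      exact lower x y h
    · rw [abs_of_nonneg (sub_nonneg.2 (mono.monotone h)), abs_of_nonneg (sub_nonneg.2 h)]
      exact lower y x h
  have hC0 : 0 ≤ C := by
    have h1 := lower 0 1 zero_le_one
    have h2 := upper 0 1 zero_le_one
    linarith
  refine ⟨e, hef, ⟨⟨B, fun x => hB x⟩, (C + 1).toNNReal, ?_⟩,
    ⟨⟨B, fun x => ?_⟩, (δ⁻¹ + 1).toNNReal, ?_⟩, ?_⟩
  · refine LipschitzWith.of_dist_le_mul fun x y => ?_
    rw [Real.dist_eq, Real.dist_eq, Real.coe_toNNReal _ (by linarith), hef, hef]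
    have := abs_sub (f x - f y) (x - y)
    rw [show f x - x - (f y - y) = f x - f y - (x - y) by ring]
    linarith [lipf x y]
  · rw [abs_sub_comm]
    have := hB (e.symm x)
    rwa [hfs] at this
  · refine LipschitzWith.of_dist_le_mul fun x y => ?_
    rw [Real.dist_eq, Real.dist_eq, Real.coe_toNNReal _ (by positivity)]
    have := abs_sub (e.symm x - e.symm y) (x - y)
    rw [show e.symm x - x - (e.symm y - y) = e.symm x - e.symm y - (x - y) by ring]
    have h3 := lips (e.symm x) (e.symm y)
    rw [hfs, hfs] at h3
    have h4 : |e.symm x - e.symm y| ≤ δ⁻¹ * |x - y| := by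
      rw [← div_eq_inv_mul, le_div_iff₀ hδ]; linarith
    linarith
  · refine h2.ae_eq ?_
    filter_upwards [hf.ae_hasDerivAt] with ξ hξ
    rw [hef', hξ.deriv]

/-- Piecewise smooth, exponentially decaying Lagrangian variables, with functions `p`, `q` which
satisfy the differential equations of the pressure. -/
structure IsProfile (Θ : LagVar) (p q : ℝ → ℝ) (S : Set ℝ) : Prop where
  countable : S.Countable
  cont_y : Continuous Θ.y
  cont_U : Continuous Θ.U
  cont_p : Continuous p
  cont_q : Continuous q
  deriv_y : ∀ ξ ∉ S, HasDerivAt Θ.y (Θ.yξ ξ) ξ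
  deriv_U : ∀ ξ ∉ S, HasDerivAt Θ.U (Θ.Uξ ξ) ξ
  deriv_p : ∀ ξ ∉ S, HasDerivAt p (q ξ * Θ.yξ ξ) ξ
  deriv_q : ∀ ξ ∉ S, HasDerivAt q ((p ξ - Θ.U ξ ^ 2) * Θ.yξ ξ - 1 / 2 * Θ.hbar ξ) ξ
  cont_yξ : ∀ ξ ∉ S, ContinuousAt Θ.yξ ξ
  cont_Uξ : ∀ ξ ∉ S, ContinuousAt Θ.Uξ ξ
  cont_h : ∀ ξ ∉ S, ContinuousAt Θ.h ξ
  cont_hbar : ∀ ξ ∉ S, ContinuousAt Θ.hbar ξ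
  bound_y : ∃ C, ∀ ξ, |Θ.y ξ - ξ| ≤ C
  bound_U : ∃ C, ∀ ξ, |Θ.U ξ| ≤ C * Real.exp (-|ξ|)
  bound_yξ : ∃ C, ∀ ξ, |Θ.yξ ξ - 1| ≤ C * Real.exp (-|ξ|)
  bound_Uξ : ∃ C, ∀ ξ, |Θ.Uξ ξ| ≤ C * Real.exp (-|ξ|)
  bound_h : ∃ C, ∀ ξ, |Θ.h ξ| ≤ C * Real.exp (-|ξ|)
  bound_p : ∃ C, ∀ ξ, |p ξ| ≤ C
  bound_q : ∃ C, ∀ ξ, |q ξ| ≤ C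
  yξ_nonneg : ∀ ξ, 0 ≤ Θ.yξ ξ
  hbar_nonneg : ∀ ξ, 0 ≤ Θ.hbar ξ
  hbar_le : ∀ ξ, Θ.hbar ξ ≤ Θ.h ξ
  energy_eq : ∀ ξ, Θ.yξ ξ * Θ.hbar ξ = Θ.Uξ ξ ^ 2
  lim : Tendsto (fun ξ => Θ.y ξ - ξ) atBot (𝓝 0)
  lower : ∃ δ, 0 < δ ∧ ∀ ξ, δ ≤ Θ.yξ ξ + Θ.h ξ

variable {Θ : LagVar} {p q : ℝ → ℝ} {S : Set ℝ}

lemma IsProfile.memF (H : IsProfile Θ p q S) : MemF Θ := by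
  obtain ⟨Cy, hCy⟩ := H.bound_y
  obtain ⟨CU, hCU⟩ := H.bound_U
  obtain ⟨Cyξ, hCyξ⟩ := H.bound_yξ
  obtain ⟨CUξ, hCUξ⟩ := H.bound_Uξ
  obtain ⟨Ch, hCh⟩ := H.bound_h
  obtain ⟨δ, hδ, hδ'⟩ := H.lower
  have mU := H.cont_U.aestronglyMeasurable (μ := volume)
  have myξ := aestronglyMeasurable_of_continuousAt_off H.countable H.cont_yξ
  have mUξ := aestronglyMeasurable_of_continuousAt_off H.countable H.cont_Uξ
  have mh := aestronglyMeasurable_of_continuousAt_off H.countable H.cont_h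
  have mhb := aestronglyMeasurable_of_continuousAt_off H.countable H.cont_hbar
  have myξ1 : AEStronglyMeasurable (fun ξ => Θ.yξ ξ - 1) volume :=
    myξ.sub aestronglyMeasurable_const
  have iyξ1 := integrable_of_le_exp myξ1 hCyξ
  have ih := integrable_of_le_exp mh hCh
  have iUξ := integrable_of_le_exp mUξ hCUξ
  have lyξ : LocallyIntegrable Θ.yξ volume := by
    have : LocallyIntegrable (fun ξ => (Θ.yξ ξ - 1) + 1) volume :=
      iyξ1.locallyIntegrable.add (locallyIntegrable_const 1)
    simpa using this
  have ay := isACWithDeriv_of_hasDerivAt_off H.countable H.cont_y H.deriv_y lyξ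
  have h0 : ∀ ξ, 0 ≤ Θ.h ξ := fun ξ => (H.hbar_nonneg ξ).trans (H.hbar_le ξ)
  have ah : IsACWithDeriv (fun ξ => Θ.y ξ + ∫ η in Set.Iic ξ, Θ.h η)
      (fun ξ => Θ.yξ ξ + Θ.h ξ) := by
    refine ⟨lyξ.add ih.locallyIntegrable, fun a b => ?_⟩
    rw [intervalIntegral.integral_add
      ((lyξ.integrableOn_isCompact isCompact_uIcc).intervalIntegrable) ih.intervalIntegrable,
      ← ay.2 a b, ← intervalIntegral.integral_Iic_sub_Iic ih.integrableOn ih.integrableOn]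
    ring
  refine
  { y_ac := ay
    U_ac := isACWithDeriv_of_hasDerivAt_off H.countable H.cont_U H.deriv_U iUξ.locallyIntegrable
    zeta_bdd := ⟨Cy, hCy⟩
    U_L2 := memLp_two_of_le_exp mU hCU
    U_Linf := memLp_top_of_le_exp mU hCU
    zetaξ_L2 := memLp_two_of_le_exp myξ1 hCyξ
    zetaξ_Linf := memLp_top_of_le_exp myξ1 hCyξ
    Uξ_L2 := memLp_two_of_le_exp mUξ hCUξ
    Uξ_Linf := memLp_top_of_le_exp mUξ hCUξ
    h_L2 := memLp_two_of_le_exp mh hCh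
    h_Linf := memLp_top_of_le_exp mh hCh
    h_L1 := ih
    hbar_meas := mhb
    yξ_nonneg := ae_of_all _ H.yξ_nonneg
    h_nonneg := ae_of_all _ h0
    hbar_nonneg := ae_of_all _ H.hbar_nonneg
    zeta_lim := H.lim
    inv_Linf := ⟨δ, hδ, ae_of_all _ hδ'⟩
    energy_eq := ae_of_all _ H.energy_eq
    hbar_le := ae_of_all _ H.hbar_le
    relabel := memG_of_isACWithDeriv (δ := δ) (C := Cyξ + 1 + Ch) (B := Cy + ∫ η, Θ.h η) ah hδ
      (ae_of_all _ hδ') (ae_of_all _ fun ξ => ?_) (fun ξ => ?_) ?_ }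
  · have h1 := (abs_le.1 (le_of_le_exp hCyξ ξ)).2
    have h2 := (abs_le.1 (le_of_le_exp hCh ξ)).2
    linarith
  · rw [show Θ.y ξ + (∫ η in Set.Iic ξ, Θ.h η) - ξ = Θ.y ξ - ξ + ∫ η in Set.Iic ξ, Θ.h η by ring]
    refine (abs_add_le _ _).trans (add_le_add (hCy ξ) ?_)
    rw [abs_of_nonneg (integral_nonneg h0)]
    exact setIntegral_le_integral ih (ae_of_all _ h0)
  · have := (memLp_two_of_le_exp myξ1 hCyξ).add (memLp_two_of_le_exp mh hCh)
    refine this.ae_eq (ae_of_all _ fun ξ => ?_)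
    simp only [Pi.add_apply]; ring

lemma MemF.monotone_y (h : MemF Θ) : Monotone Θ.y := by
  intro a b hab
  have := h.y_ac.2 a b
  have h2 : 0 ≤ ∫ x in a..b, Θ.yξ x :=
    intervalIntegral.integral_nonneg_of_ae hab h.yξ_nonneg
  linarith

lemma MemF.tendsto_y_atBot (h : MemF Θ) : Tendsto Θ.y atBot atBot := by
  obtain ⟨C, hC⟩ := h.zeta_bdd
  refine tendsto_atBot_mono (fun x => ?_)
    (tendsto_atBot_add_const_right _ C tendsto_id : Tendsto (fun x : ℝ => x + C) atBot atBot)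
  have := (abs_le.1 (hC x)).2
  linarith

lemma MemF.tendsto_y_atTop (h : MemF Θ) : Tendsto Θ.y atTop atTop := by
  obtain ⟨C, hC⟩ := h.zeta_bdd
  refine tendsto_atTop_mono (f := fun x => x - C) (fun x => ?_)
    (tendsto_atTop_add_const_right _ (-C) tendsto_id)
  have := (abs_le.1 (hC x)).1
  linarith

lemma IsProfile.exists_bddAt (H : IsProfile Θ p q S) : ∃ C, 1 ≤ C ∧ ∀ ξ, Θ.BddAt C ξ := by
  obtain ⟨Cy, hCy⟩ := H.bound_y
  obtain ⟨CU, hCU⟩ := H.bound_U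
  obtain ⟨Cyξ, hCyξ⟩ := H.bound_yξ
  obtain ⟨CUξ, hCUξ⟩ := H.bound_Uξ
  obtain ⟨Ch, hCh⟩ := H.bound_h
  refine ⟨1 + |Cy| + |CU| + |Cyξ| + |CUξ| + |Ch|, ?_, fun ξ => ?_⟩
  · have := abs_nonneg Cy
    have := abs_nonneg CU
    have := abs_nonneg Cyξ
    have := abs_nonneg CUξ
    have := abs_nonneg Ch
    linarith
  have n1 := abs_nonneg Cy
  have n2 := abs_nonneg CU
  have n3 := abs_nonneg Cyξ
  have n4 := abs_nonneg CUξ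
  have n5 := abs_nonneg Ch
  have a1 := le_abs_self Cy
  have a2 := le_abs_self CU
  have a3 := le_abs_self Cyξ
  have a4 := le_abs_self CUξ
  have a5 := le_abs_self Ch
  have b1 := hCy ξ
  have b2 := le_of_le_exp hCU ξ
  have b3 := le_of_le_exp hCyξ ξ
  have b4 := le_of_le_exp hCUξ ξ
  have b5 := le_of_le_exp hCh ξ
  refine ⟨by linarith, by linarith, ?_, by linarith, by linarith, ?_⟩
  · have := abs_sub_abs_le_abs_sub (Θ.yξ ξ) 1
    rw [abs_one] at this
    linarith
  · rw [abs_of_nonneg (H.hbar_nonneg ξ)]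
    linarith [H.hbar_le ξ, le_abs_self (Θ.h ξ)]

/-- The equations for p and q say that 2e^y(p - q) is a primitive of e^y times the density.
Monotonicity of y removes the absolute value, and the boundary term at -∞ vanishes because y → -∞
while p and q are bounded. -/
lemma IsProfile.setIntegral_Iic (H : IsProfile Θ p q S) (ξ : ℝ)
    (hi : Integrable fun η => Real.exp (-|Θ.y ξ - Θ.y η|) * Θ.density η) :
    ∫ η in Set.Iic ξ, Real.exp (-|Θ.y ξ - Θ.y η|) * Θ.density η = 2 * (p ξ - q ξ) := by
  have hF := H.memF
  have key : ∀ a ≤ ξ, ∫ η in a..ξ, Real.exp (-|Θ.y ξ - Θ.y η|) * Θ.density η =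
      2 * (p ξ - q ξ) - 2 * (Real.exp (Θ.y a - Θ.y ξ) * (p a - q a)) := by
    intro a ha
    have hcongr : ∀ η ∈ Set.uIcc a ξ, Real.exp (-|Θ.y ξ - Θ.y η|) * Θ.density η =
        Real.exp (Θ.y η - Θ.y ξ) * Θ.density η := by
      intro η hη
      rw [Set.uIcc_of_le ha] at hη
      rw [abs_of_nonneg (sub_nonneg.2 (hF.monotone_y hη.2)), neg_sub]
    rw [intervalIntegral.integral_congr hcongr]
    have := integral_eq_of_hasDerivAt_off_countable (a := a) (b := ξ)
      (fun η => 2 * (Real.exp (Θ.y η - Θ.y ξ) * (p η - q η)))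
      (fun η => Real.exp (Θ.y η - Θ.y ξ) * Θ.density η) H.countable ?_ ?_ ?_
    · rw [this, sub_self, Real.exp_zero]; ring
    · have := H.cont_y
      have := H.cont_p
      have := H.cont_q
      exact Continuous.continuousOn (by fun_prop)
    · intro x hx
      have := ((((H.deriv_y x hx.2).sub_const (Θ.y ξ)).exp).mul
        ((H.deriv_p x hx.2).sub (H.deriv_q x hx.2))).const_mul 2
      refine HasDerivAt.congr_deriv this ?_
      simp only [LagVar.density, Pi.sub_apply]; ring
    · exact (hi.intervalIntegrable (a := a) (b := ξ)).congr (fun η hη => hcongr η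
        (Set.uIoc_subset_uIcc hη))
  have l1 := intervalIntegral_tendsto_integral_Iic ξ hi.integrableOn
    (tendsto_id : Tendsto (fun a : ℝ => a) atBot atBot)
  refine tendsto_nhds_unique l1 ?_
  have l2 : Tendsto (fun a => 2 * (p ξ - q ξ) - 2 * (Real.exp (Θ.y a - Θ.y ξ) * (p a - q a)))
      atBot (𝓝 (2 * (p ξ - q ξ) - 2 * 0)) := by
    refine tendsto_const_nhds.sub (Tendsto.const_mul 2 ?_)
    obtain ⟨Cp, hCp⟩ := H.bound_p
    obtain ⟨Cq, hCq⟩ := H.bound_q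
    have h1 : ∀ a, |p a - q a| ≤ Cp + Cq := fun a =>
      (abs_sub _ _).trans (add_le_add (hCp a) (hCq a))
    have h2 : Tendsto (fun a => Real.exp (Θ.y a - Θ.y ξ)) atBot (𝓝 0) :=
      Real.tendsto_exp_atBot.comp (tendsto_atBot_add_const_right _ _ hF.tendsto_y_atBot)
    simpa only [mul_comm] using bdd_le_mul_tendsto_zero' (Cp + Cq) (Eventually.of_forall h1) h2
  rw [mul_zero, sub_zero] at l2
  refine l2.congr' ?_
  filter_upwards [eventually_le_atBot ξ] with a ha using (key a ha).symm

/-- The mirror image, with primitive -2e^{-y}(p + q). -/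
lemma IsProfile.setIntegral_Ioi (H : IsProfile Θ p q S) (ξ : ℝ)
    (hi : Integrable fun η => Real.exp (-|Θ.y ξ - Θ.y η|) * Θ.density η) :
    ∫ η in Set.Ioi ξ, Real.exp (-|Θ.y ξ - Θ.y η|) * Θ.density η = 2 * (p ξ + q ξ) := by
  have hF := H.memF
  have key : ∀ a, ξ ≤ a → ∫ η in ξ..a, Real.exp (-|Θ.y ξ - Θ.y η|) * Θ.density η =
      2 * (p ξ + q ξ) - 2 * (Real.exp (Θ.y ξ - Θ.y a) * (p a + q a)) := by
    intro a ha
    have hcongr : ∀ η ∈ Set.uIcc ξ a, Real.exp (-|Θ.y ξ - Θ.y η|) * Θ.density η =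
        Real.exp (Θ.y ξ - Θ.y η) * Θ.density η := by
      intro η hη
      rw [Set.uIcc_of_le ha] at hη
      rw [abs_of_nonpos (sub_nonpos.2 (hF.monotone_y hη.1)), neg_neg]
    rw [intervalIntegral.integral_congr hcongr]
    have := integral_eq_of_hasDerivAt_off_countable (a := ξ) (b := a)
      (fun η => (-2) * (Real.exp (Θ.y ξ - Θ.y η) * (p η + q η)))
      (fun η => Real.exp (Θ.y ξ - Θ.y η) * Θ.density η) H.countable ?_ ?_ ?_
    · rw [this, sub_self, Real.exp_zero]; ring
    · have := H.cont_y
      have := H.cont_p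
      have := H.cont_q
      exact Continuous.continuousOn (by fun_prop)
    · intro x hx
      have := ((((H.deriv_y x hx.2).const_sub (Θ.y ξ)).exp).mul
        ((H.deriv_p x hx.2).add (H.deriv_q x hx.2))).const_mul (-2)
      refine HasDerivAt.congr_deriv this ?_
      simp only [LagVar.density, Pi.add_apply]; ring
    · exact (hi.intervalIntegrable (a := ξ) (b := a)).congr (fun η hη => hcongr η
        (Set.uIoc_subset_uIcc hη))
  have l1 := intervalIntegral_tendsto_integral_Ioi ξ hi.integrableOn
    (tendsto_id : Tendsto (fun a : ℝ => a) atTop atTop)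
  refine tendsto_nhds_unique l1 ?_
  have l2 : Tendsto (fun a => 2 * (p ξ + q ξ) - 2 * (Real.exp (Θ.y ξ - Θ.y a) * (p a + q a)))
      atTop (𝓝 (2 * (p ξ + q ξ) - 2 * 0)) := by
    refine tendsto_const_nhds.sub (Tendsto.const_mul 2 ?_)
    obtain ⟨Cp, hCp⟩ := H.bound_p
    obtain ⟨Cq, hCq⟩ := H.bound_q
    have h1 : ∀ a, |p a + q a| ≤ Cp + Cq := fun a =>
      (abs_add_le _ _).trans (add_le_add (hCp a) (hCq a))
    have h2 : Tendsto (fun a => Real.exp (Θ.y ξ - Θ.y a)) atTop (𝓝 0) :=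
      Real.tendsto_exp_atBot.comp (tendsto_atBot_add_const_left _ _
        (tendsto_neg_atTop_atBot.comp hF.tendsto_y_atTop))
    simpa only [mul_comm] using bdd_le_mul_tendsto_zero' (Cp + Cq) (Eventually.of_forall h1) h2
  rw [mul_zero, sub_zero] at l2
  refine l2.congr' ?_
  filter_upwards [eventually_ge_atTop ξ] with a ha using (key a ha).symm

/-- P is a quarter of the sum of the two half-line integrals, Q a quarter of right minus left. This
replaces every direct evaluation of the nonlocal terms. -/
lemma IsProfile.P_eq_and_Q_eq (H : IsProfile Θ p q S) (ξ : ℝ) : Θ.P ξ = p ξ ∧ Θ.Q ξ = q ξ := by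
  obtain ⟨C, hC, hB⟩ := H.exists_bddAt
  have hi : Integrable fun η => Real.exp (-|Θ.y ξ - Θ.y η|) * Θ.density η := by
    simpa only [one_mul] using integrable_kernel (σ := fun _ => 1) H.memF hC measurable_const
      (by simp) (hB ξ).y (ae_of_all _ hB)
  have hi' := integrable_kernel (σ := fun η => Real.sign (ξ - η)) H.memF hC (measurable_sign_sub ξ)
    (fun η => abs_sign_le_one _) (hB ξ).y (ae_of_all _ hB)
  have h1 := H.setIntegral_Iic ξ hi
  have h2 := H.setIntegral_Ioi ξ hi
  constructor
  · rw [LagVar.P_eq_kernel]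
    simp only [one_mul]
    rw [← intervalIntegral.integral_Iic_add_Ioi (b := ξ) hi.integrableOn hi.integrableOn, h1, h2]
    ring
  · rw [LagVar.Q_eq_kernel, ← intervalIntegral.integral_Iic_add_Ioi (b := ξ) hi'.integrableOn
      hi'.integrableOn]
    have e1 : ∫ η in Set.Iic ξ, Real.sign (ξ - η) * Real.exp (-|Θ.y ξ - Θ.y η|) * Θ.density η =
        2 * (p ξ - q ξ) := by
      rw [← h1, integral_Iic_eq_integral_Iio, integral_Iic_eq_integral_Iio]
      refine setIntegral_congr_fun measurableSet_Iio fun η hη => ?_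
      simp only [Real.sign_of_pos (sub_pos.2 (Set.mem_Iio.1 hη)), one_mul]
    have e2 : ∫ η in Set.Ioi ξ, Real.sign (ξ - η) * Real.exp (-|Θ.y ξ - Θ.y η|) * Θ.density η =
        -(2 * (p ξ + q ξ)) := by
      rw [← h2, ← integral_neg]
      refine setIntegral_congr_fun measurableSet_Ioi fun η hη => ?_
      simp only [Real.sign_of_neg (sub_neg.2 (Set.mem_Ioi.1 hη)), neg_mul, one_mul]
    rw [e1, e2]
    ring

end Profile

/-! ### Pointwise conditions, and explicit variables outside the peaks -/

section Pieces

/-- The local part of `IsProfile`. -/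
structure SmoothAt (Θ : LagVar) (p q : ℝ → ℝ) (ξ : ℝ) : Prop where
  deriv_y : HasDerivAt Θ.y (Θ.yξ ξ) ξ
  deriv_U : HasDerivAt Θ.U (Θ.Uξ ξ) ξ
  deriv_p : HasDerivAt p (q ξ * Θ.yξ ξ) ξ
  deriv_q : HasDerivAt q ((p ξ - Θ.U ξ ^ 2) * Θ.yξ ξ - 1 / 2 * Θ.hbar ξ) ξ
  cont_yξ : ContinuousAt Θ.yξ ξ
  cont_Uξ : ContinuousAt Θ.Uξ ξ
  cont_h : ContinuousAt Θ.h ξ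
  cont_hbar : ContinuousAt Θ.hbar ξ

/-- The pointwise constraints of `IsProfile`. -/
structure AdmissibleAt (Θ : LagVar) (ξ : ℝ) : Prop where
  yξ_nonneg : 0 ≤ Θ.yξ ξ
  hbar_nonneg : 0 ≤ Θ.hbar ξ
  hbar_le : Θ.hbar ξ ≤ Θ.h ξ
  energy_eq : Θ.yξ ξ * Θ.hbar ξ = Θ.Uξ ξ ^ 2

/-- The bounds of `IsProfile`, at a label. -/
structure DecayAt (Θ : LagVar) (p q : ℝ → ℝ) (C ξ : ℝ) : Prop where
  y : |Θ.y ξ - ξ| ≤ C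
  U : |Θ.U ξ| ≤ C * Real.exp (-|ξ|)
  yξ : |Θ.yξ ξ - 1| ≤ C * Real.exp (-|ξ|)
  Uξ : |Θ.Uξ ξ| ≤ C * Real.exp (-|ξ|)
  h : |Θ.h ξ| ≤ C * Real.exp (-|ξ|)
  p : |p ξ| ≤ C
  q : |q ξ| ≤ C

/-- The Lagrangian system with pressure `p`, `q` at the label `ξ`, for times in `I`. -/
structure TimeODE (Θ : ℝ → LagVar) (p q : ℝ → ℝ → ℝ) (I : Set ℝ) (ξ : ℝ) : Prop where
  y : ∀ t ∈ I, HasDerivAt (fun t => (Θ t).y ξ) ((Θ t).U ξ) t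
  U : ∀ t ∈ I, HasDerivAt (fun t => (Θ t).U ξ) (-q t ξ) t
  yξ : ∀ t ∈ I, HasDerivAt (fun t => (Θ t).yξ ξ) ((Θ t).Uξ ξ) t
  Uξ : ∀ t ∈ I, HasDerivAt (fun t => (Θ t).Uξ ξ)
    (1 / 2 * (Θ t).hbar ξ + ((Θ t).U ξ ^ 2 - p t ξ) * (Θ t).yξ ξ) t
  h : ∀ t ∈ I, HasDerivAt (fun t => (Θ t).h ξ) (2 * ((Θ t).U ξ ^ 2 - p t ξ) * (Θ t).Uξ ξ) t
  cont_p : ContinuousOn (fun t => p t ξ) I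
  cont_q : ContinuousOn (fun t => q t ξ) I
  cont_hbar : ContinuousOn (fun t => (Θ t).hbar ξ) I

lemma DecayAt.mono {Θ : LagVar} {p q : ℝ → ℝ} {C C' ξ : ℝ} (h : DecayAt Θ p q C ξ) (hC : C ≤ C') :
    DecayAt Θ p q C' ξ := by
  have : C * Real.exp (-|ξ|) ≤ C' * Real.exp (-|ξ|) := by gcongr
  exact ⟨h.y.trans hC, h.U.trans this, h.yξ.trans this, h.Uξ.trans this, h.h.trans this,
    h.p.trans hC, h.q.trans hC⟩

/-! ### The region outside the two peaks -/

/-- `e^{εy}` outside the two peaks, where `ε = -1` on the left and `ε = 1` on the right. -/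
noncomputable def outerV (ε k φ ξ : ℝ) : ℝ := Real.exp (ε * ξ) + (φ - k)

/-- Lagrangian variables in a region where the velocity is a multiple of `e^{-εx}`. -/
noncomputable def outer (ε k φ φ₁ : ℝ) : LagVar where
  y ξ := ε * Real.log (outerV ε k φ ξ)
  U ξ := ε * φ₁ / outerV ε k φ ξ
  yξ ξ := Real.exp (ε * ξ) / outerV ε k φ ξ
  Uξ ξ := -φ₁ * Real.exp (ε * ξ) / outerV ε k φ ξ ^ 2
  hbar ξ := φ₁ ^ 2 * Real.exp (ε * ξ) / outerV ε k φ ξ ^ 3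
  h ξ := φ₁ ^ 2 * Real.exp (ε * ξ) / outerV ε k φ ξ ^ 3

/-- `outerQ` is read off from U_t = -Q, and `outerP` from the equation for U_ξ; φ₁ and φ₂ stand for
the time derivatives of φ. -/
noncomputable def outerP (ε k φ φ₁ φ₂ ξ : ℝ) : ℝ :=
  φ₂ / outerV ε k φ ξ - φ₁ ^ 2 / outerV ε k φ ξ ^ 2 / 2

noncomputable def outerQ (ε k φ φ₁ φ₂ ξ : ℝ) : ℝ :=
  ε * (φ₁ ^ 2 / outerV ε k φ ξ ^ 2 - φ₂ / outerV ε k φ ξ)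

lemma hasDerivAt_outerV (ε k φ ξ : ℝ) :
    HasDerivAt (outerV ε k φ) (ε * Real.exp (ε * ξ)) ξ := by
  have := ((hasDerivAt_id ξ).const_mul ε).exp.add_const (φ - k)
  refine HasDerivAt.congr_deriv this ?_
  simp [mul_comm]

lemma outer_smoothAt {ε k φ φ₁ φ₂ ξ : ℝ} (hε : ε * ε = 1) (hv : 0 < outerV ε k φ ξ) :
    SmoothAt (outer ε k φ φ₁) (outerP ε k φ φ₁ φ₂) (outerQ ε k φ φ₁ φ₂) ξ := by
  have hV := hasDerivAt_outerV ε k φ ξ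
  have v0 := hv.ne'
  have hc := hV.continuousAt
  have hE : ContinuousAt (fun ξ => Real.exp (ε * ξ)) ξ := by fun_prop
  refine ⟨?_, ?_, ?_, ?_, ?_, ?_, ?_, ?_⟩
  · refine ((hV.log v0).const_mul ε).congr_deriv ?_
    simp only [outer]
    rw [← mul_div_assoc, ← mul_assoc, hε, one_mul]
  · refine ((hasDerivAt_const ξ (ε * φ₁)).div hV v0).congr_deriv ?_
    simp only [outer]
    field_simp
    linear_combination (-φ₁ * Real.exp (ε * ξ)) * hε
  · refine (((hasDerivAt_const ξ φ₂).div hV v0).sub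
      (((hasDerivAt_const ξ (φ₁ ^ 2)).div (hV.pow 2) (pow_ne_zero 2 v0)).div_const 2)).congr_deriv ?_
    simp only [outer, outerQ, Pi.pow_apply]
    field_simp
    ring
  · refine ((((hasDerivAt_const ξ (φ₁ ^ 2)).div (hV.pow 2) (pow_ne_zero 2 v0)).sub
      ((hasDerivAt_const ξ φ₂).div hV v0)).const_mul ε).congr_deriv ?_
    simp only [outer, outerP, Pi.pow_apply]
    have : (ε * φ₁) ^ 2 = φ₁ ^ 2 := by linear_combination φ₁ ^ 2 * hε
    rw [div_pow, this]
    field_simp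
    linear_combination (2 * φ₂ * outerV ε k φ ξ ^ 2 * Real.exp (ε * ξ) -
      4 * φ₁ ^ 2 * outerV ε k φ ξ * Real.exp (ε * ξ)) * hε
  · exact hE.div hc v0
  · exact (continuousAt_const.mul hE).div (hc.pow 2) (pow_ne_zero 2 v0)
  · exact (continuousAt_const.mul hE).div (hc.pow 3) (pow_ne_zero 3 v0)
  · exact (continuousAt_const.mul hE).div (hc.pow 3) (pow_ne_zero 3 v0)

lemma outer_admissibleAt {ε k φ φ₁ ξ : ℝ} (hv : 0 < outerV ε k φ ξ) :
    AdmissibleAt (outer ε k φ φ₁) ξ := by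
  refine ⟨?_, ?_, le_rfl, ?_⟩ <;> simp only [outer]
  · positivity
  · positivity
  · field_simp

/-- If u = M(t)e^{-εx}, then (e^{εy})_t = εM does not depend on the label, so e^{εy} moves by a
shift φ with φ₁ = εM. Since φ is arbitrary, the same computation serves before and after breaking.
-/
lemma outer_timeODE {ε k ξ : ℝ} {φ φ₁ φ₂ : ℝ → ℝ} {I : Set ℝ} (hε : ε * ε = 1)
    (h0 : ∀ t, HasDerivAt φ (φ₁ t) t) (h1 : ∀ t, HasDerivAt φ₁ (φ₂ t) t) (h2 : Continuous φ₂)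
    (hv : ∀ t ∈ I, 0 < outerV ε k (φ t) ξ) :
    TimeODE (fun t => outer ε k (φ t) (φ₁ t)) (fun t => outerP ε k (φ t) (φ₁ t) (φ₂ t))
      (fun t => outerQ ε k (φ t) (φ₁ t) (φ₂ t)) I ξ := by
  have hV : ∀ t, HasDerivAt (fun t => outerV ε k (φ t) ξ) (φ₁ t) t := fun t =>
    ((h0 t).sub_const k).const_add _
  have cV : Continuous fun t => outerV ε k (φ t) ξ :=
    continuous_iff_continuousAt.2 fun t => (hV t).continuousAt
  have c1 : Continuous φ₁ := continuous_iff_continuousAt.2 fun t => (h1 t).continuousAt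
  have n0 : ∀ t ∈ I, outerV ε k (φ t) ξ ≠ 0 := fun t ht => (hv t ht).ne'
  have hsq : ∀ x, (ε * x) ^ 2 = x ^ 2 := fun x => by linear_combination x ^ 2 * hε
  refine ⟨fun t ht => ?_, fun t ht => ?_, fun t ht => ?_, fun t ht => ?_, fun t ht => ?_,
    ?_, ?_, ?_⟩
  · refine (((hV t).log (n0 t ht)).const_mul ε).congr_deriv ?_
    simp only [outer]; ring
  · refine (((h1 t).const_mul ε).div (hV t) (n0 t ht)).congr_deriv ?_
    have := n0 t ht
    simp only [outerQ]
    field_simp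
    ring
  · refine ((hasDerivAt_const t (Real.exp (ε * ξ))).div (hV t) (n0 t ht)).congr_deriv ?_
    simp only [outer]; ring
  · refine (((h1 t).neg.mul_const (Real.exp (ε * ξ))).div ((hV t).pow 2)
      (pow_ne_zero 2 (n0 t ht))).congr_deriv ?_
    have := n0 t ht
    simp only [outer, outerP, Pi.pow_apply, Pi.neg_apply, div_pow, hsq]
    field_simp
    ring
  · refine ((((h1 t).pow 2).mul_const (Real.exp (ε * ξ))).div ((hV t).pow 3)
      (pow_ne_zero 3 (n0 t ht))).congr_deriv ?_
    have := n0 t ht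
    simp only [outer, outerP, Pi.pow_apply, div_pow, hsq]
    field_simp
    ring
  · exact (h2.continuousOn.div cV.continuousOn n0).sub ((((c1.pow 2).continuousOn).div
      (cV.pow 2).continuousOn (fun t ht => pow_ne_zero 2 (n0 t ht))).div_const 2)
  · exact continuousOn_const.mul ((((c1.pow 2).continuousOn).div
      (cV.pow 2).continuousOn (fun t ht => pow_ne_zero 2 (n0 t ht))).sub
      (h2.continuousOn.div cV.continuousOn n0))
  · exact ((c1.pow 2).mul continuous_const).continuousOn.div (cV.pow 3).continuousOn
      (fun t ht => pow_ne_zero 3 (n0 t ht))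

/-- On a half line bounded below, one-sided decay is two-sided: for x ≤ 0 one has e^{-x} ≤ e^x/k².
-/
lemma exp_neg_le_mul_exp_neg_abs {k x : ℝ} (hk : 0 < k) (hx : k ≤ Real.exp x) :
    Real.exp (-x) ≤ (1 + 1 / k ^ 2) * Real.exp (-|x|) := by
  rcases le_total 0 x with h | h
  · rw [abs_of_nonneg h]
    exact le_mul_of_one_le_left (Real.exp_pos _).le (by
      have : 0 < 1 / k ^ 2 := by positivity
      linarith)
  · rw [abs_of_nonpos h, neg_neg, Real.exp_neg]
    have h1 : (Real.exp x)⁻¹ ≤ 1 / k ^ 2 * Real.exp x := by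
      rw [inv_le_iff_one_le_mul₀ (Real.exp_pos x), mul_assoc, div_mul_eq_mul_div, one_mul,
        le_div_iff₀ (by positivity), one_mul, sq]
      gcongr
    linarith [Real.exp_pos x]

lemma outerV_lower {ε k φ m ξ : ℝ} (hk : 0 < k) (hm : m ≤ φ) (hξ : k ≤ Real.exp (ε * ξ)) :
    min 1 (m / k) * Real.exp (ε * ξ) ≤ outerV ε k φ ξ := by
  have h1 : min 1 (m / k) ≤ 1 := min_le_left _ _
  have h2 : min 1 (m / k) * k ≤ m := by
    rw [← le_div_iff₀ hk]; exact min_le_right _ _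
  unfold outerV
  nlinarith

lemma outerV_upper {ε k φ M ξ : ℝ} (hk : 0 < k) (hM : φ ≤ M) (hM0 : 0 ≤ M)
    (hξ : k ≤ Real.exp (ε * ξ)) : outerV ε k φ ξ ≤ (1 + M / k) * Real.exp (ε * ξ) := by
  have h2 : M ≤ M / k * Real.exp (ε * ξ) := by
    rw [div_mul_eq_mul_div, le_div_iff₀ hk]
    gcongr
  unfold outerV
  linarith

/-- The condition k ≤ e^{εξ} selects the labels beyond the peak. There `outerV` lies between two
positive multiples of e^{εξ}, so U, y_ξ - 1, U_ξ and h are O(e^{-εξ}), which is O(e^{-|ξ|}) on this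
half line. -/
lemma outer_decayAt {ε k m M B : ℝ} (hε : |ε| = 1) (hk : 0 < k) (hm : 0 < m) :
    ∃ C, ∀ φ φ₁ φ₂ ξ : ℝ, m ≤ φ → φ ≤ M → |φ₁| ≤ B → |φ₂| ≤ B → k ≤ Real.exp (ε * ξ) →
      DecayAt (outer ε k φ φ₁) (outerP ε k φ φ₁ φ₂) (outerQ ε k φ φ₁ φ₂) C ξ := by
  -- If M or B is negative, no φ, φ₁ satisfy the hypotheses and any C will do.
  by_cases hMB : 0 ≤ M ∧ 0 ≤ B
  swap
  · refine ⟨0, fun φ φ₁ φ₂ ξ h1 h2 h3 => ?_⟩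
    exact absurd ⟨hm.le.trans (h1.trans h2), (abs_nonneg _).trans h3⟩ hMB
  obtain ⟨hM0, hB0⟩ := hMB
  set n := min 1 (m / k) with hn
  have n0 : 0 < n := lt_min one_pos (div_pos hm hk)
  set R := 1 + 1 / k ^ 2 with hR
  have R0 : 0 < R := by positivity
  set C₁ := |Real.log n| + |Real.log (1 + M / k)|
  set C₂ := (B / n + (k + M) / n + B / n ^ 2 + B ^ 2 / (n ^ 3 * k)) * R
  set C₃ := B / (n * k) + (B / (n * k)) ^ 2
  have C₁0 : 0 ≤ C₁ := by positivity
  have C₃0 : 0 ≤ C₃ := by positivity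
  have p1 : 0 ≤ B / n := by positivity
  have p2 : 0 ≤ (k + M) / n := by positivity
  have p3 : 0 ≤ B / n ^ 2 := by positivity
  have p4 : 0 ≤ B ^ 2 / (n ^ 3 * k) := by positivity
  have C₂0 : 0 ≤ C₂ := by positivity
  refine ⟨C₁ + C₂ + C₃, fun φ φ₁ φ₂ ξ h1 h2 h3 h4 h5 => ?_⟩
  have hV := outerV_lower (φ := φ) hk h1 h5
  have hV' := outerV_upper hk h2 hM0 h5
  rw [← hn] at hV
  have e0 := Real.exp_pos (ε * ξ)
  have v0 : 0 < outerV ε k φ ξ := (mul_pos n0 e0).trans_le hV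
  have hr : (Real.exp (ε * ξ))⁻¹ ≤ R * Real.exp (-|ξ|) := by
    have := exp_neg_le_mul_exp_neg_abs hk h5
    rwa [abs_mul, hε, one_mul, Real.exp_neg (ε * ξ)] at this
  have hrk : (Real.exp (ε * ξ))⁻¹ ≤ 1 / k := by
    rw [one_div]; exact inv_anti₀ hk h5
  set e := Real.exp (ε * ξ) with he
  set v := outerV ε k φ ξ with hv
  have hvi : v⁻¹ ≤ (n * e)⁻¹ := inv_anti₀ (by positivity) hV
  have hvk : v⁻¹ ≤ 1 / (n * k) := by
    rw [one_div]
    refine inv_anti₀ (by positivity) (le_trans ?_ hV)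
    gcongr
  have fin : ∀ {x A : ℝ}, |x| ≤ A * e⁻¹ → 0 ≤ A →
      A ≤ B / n + (k + M) / n + B / n ^ 2 + B ^ 2 / (n ^ 3 * k) →
      |x| ≤ (C₁ + C₂ + C₃) * Real.exp (-|ξ|) := by
    intro x A hx hA hA'
    calc |x| ≤ A * e⁻¹ := hx
      _ ≤ (B / n + (k + M) / n + B / n ^ 2 + B ^ 2 / (n ^ 3 * k)) * (R * Real.exp (-|ξ|)) := by
        gcongr
      _ = C₂ * Real.exp (-|ξ|) := by rw [mul_assoc]
      _ ≤ _ := by gcongr; linarith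
  have hpq1 : |φ₂ / v| ≤ B / (n * k) := by
    rw [abs_div, abs_of_pos v0, div_eq_mul_inv, div_eq_mul_one_div]
    gcongr
  have hpq2 : |φ₁ ^ 2 / v ^ 2| ≤ (B / (n * k)) ^ 2 := by
    rw [← div_pow, abs_pow, abs_div, abs_of_pos v0, div_eq_mul_inv, div_eq_mul_one_div B]
    gcongr
  refine ⟨?_, ?_, ?_, ?_, ?_, ?_, ?_⟩
  · have : (outer ε k φ φ₁).y ξ - ξ = ε * Real.log (v / e) := by
      rw [Real.log_div v0.ne' e0.ne', he, Real.log_exp]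
      have : ε * ε = 1 := by rw [← abs_mul_abs_self, hε, one_mul]
      simp only [outer]
      linear_combination ξ * this
    rw [this, abs_mul, hε, one_mul]
    have l1 : Real.log n ≤ Real.log (v / e) :=
      Real.log_le_log n0 (by rwa [le_div_iff₀ e0])
    have l2 : Real.log (v / e) ≤ Real.log (1 + M / k) :=
      Real.log_le_log (by positivity) (by rwa [div_le_iff₀ e0])
    have : |Real.log (v / e)| ≤ C₁ := by
      rw [abs_le]
      constructor
      · linarith [neg_abs_le (Real.log n), abs_nonneg (Real.log (1 + M / k))]
      · linarith [le_abs_self (Real.log (1 + M / k)), abs_nonneg (Real.log n)]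
    linarith
  · refine fin (A := B / n) ?_ (by positivity) (by linarith)
    simp only [outer]
    rw [abs_div, abs_mul, hε, one_mul, ← hv, abs_of_pos v0, div_eq_mul_inv]
    calc |φ₁| * v⁻¹ ≤ B * (n * e)⁻¹ := by gcongr
      _ = _ := by rw [mul_inv]; ring
  · refine fin (A := (k + M) / n) ?_ (by positivity) (by linarith)
    simp only [outer]
    rw [← hv, ← he, div_sub_one v0.ne', abs_div, abs_of_pos v0, div_eq_mul_inv]
    have : |e - v| ≤ k + M := by
      rw [hv, outerV, ← he, abs_le]
      constructor <;> linarith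
    calc |e - v| * v⁻¹ ≤ (k + M) * (n * e)⁻¹ := by gcongr
      _ = _ := by rw [mul_inv]; ring
  · refine fin (A := B / n ^ 2) ?_ (by positivity) (by linarith)
    simp only [outer]
    rw [← hv, ← he, abs_div, abs_mul, abs_neg, abs_pow, abs_of_pos v0, abs_of_pos e0,
      div_eq_mul_inv, ← inv_pow]
    calc |φ₁| * e * v⁻¹ ^ 2 ≤ B * e * (n * e)⁻¹ ^ 2 := by gcongr
      _ = _ := by field_simp
  · refine fin (A := B ^ 2 / (n ^ 3 * k)) ?_ (by positivity) (by linarith)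
    simp only [outer]
    rw [← hv, ← he, abs_div, abs_mul, abs_pow, abs_pow, abs_of_pos v0, abs_of_pos e0,
      div_eq_mul_inv, ← inv_pow]
    calc |φ₁| ^ 2 * e * v⁻¹ ^ 3 ≤ B ^ 2 * e * (n * e)⁻¹ ^ 3 := by gcongr
      _ = B ^ 2 / n ^ 3 * e⁻¹ * e⁻¹ := by field_simp
      _ ≤ B ^ 2 / n ^ 3 * (1 / k) * e⁻¹ := by gcongr
      _ = _ := by field_simp
  · unfold outerP
    rw [← hv]
    have := abs_sub (φ₂ / v) (φ₁ ^ 2 / v ^ 2 / 2)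
    rw [abs_div (φ₁ ^ 2 / v ^ 2), abs_two] at this
    have : 0 ≤ |φ₁ ^ 2 / v ^ 2| := abs_nonneg _
    linarith
  · unfold outerQ
    rw [← hv, abs_mul, hε, one_mul]
    have := abs_sub (φ₁ ^ 2 / v ^ 2) (φ₂ / v)
    linarith

lemma outer_yξ_lower {ε k φ φ₁ m M ξ : ℝ} (hk : 0 < k) (hm : 0 < m) (hm' : m ≤ φ) (hM : φ ≤ M)
    (hξ : k ≤ Real.exp (ε * ξ)) : 1 / (1 + M / k) ≤ (outer ε k φ φ₁).yξ ξ := by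
  have hM0 : 0 ≤ M := hm.le.trans (hm'.trans hM)
  have e0 := Real.exp_pos (ε * ξ)
  have v0 : 0 < outerV ε k φ ξ :=
    (mul_pos (lt_min one_pos (div_pos hm hk)) e0).trans_le (outerV_lower hk hm' hξ)
  simp only [outer]
  rw [div_le_div_iff₀ (by positivity) v0, one_mul, mul_comm]
  exact outerV_upper hk hM hM0 hξ

lemma outer_left_tendsto {k φ φ₁ : ℝ} :
    Tendsto (fun ξ => (outer (-1) k φ φ₁).y ξ - ξ) atBot (𝓝 0) := by
  have h1 : Tendsto (fun ξ => 1 + (φ - k) * Real.exp ξ) atBot (𝓝 (1 + (φ - k) * 0)) :=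
    tendsto_const_nhds.add (Real.tendsto_exp_atBot.const_mul _)
  rw [mul_zero, add_zero] at h1
  have h2 := (h1.log one_ne_zero).neg
  rw [Real.log_one, neg_zero] at h2
  refine h2.congr' ?_
  have h3 : ∀ᶠ ξ in atBot, 0 < 1 + (φ - k) * Real.exp ξ := h1.eventually (lt_mem_nhds one_pos)
  filter_upwards [h3] with ξ hξ
  have : outerV (-1) k φ ξ = Real.exp (-ξ) * (1 + (φ - k) * Real.exp ξ) := by
    rw [mul_add, mul_left_comm, ← Real.exp_add, neg_add_cancel, Real.exp_zero, outerV]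
    ring_nf
  simp only [outer]
  rw [this, Real.log_mul (Real.exp_pos _).ne' hξ.ne', Real.log_exp]
  ring

end Pieces

/-! ### Explicit variables between the peaks -/

section Mid

/-! ### The region between the two peaks, before wave breaking -/

/-- `e^y` between the peaks, in terms of `b = e^{q₂}`, `D` and the label function `r`. -/
noncomputable def midW (b D r : ℝ) : ℝ := b - D ^ 2 * r

/-- For the actual b and D this is e^{c(t - t₀)}, see `midE_eq`. It is kept as a polynomial in b and
D so that the identities below need only the differential equations of b and D. -/
noncomputable def midE (L c K b D : ℝ) : ℝ := b ^ 2 + c * b * D / L - K * D ^ 2 / L ^ 2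

/-- The time derivative of `midW`. -/
noncomputable def midN (L c K b D r : ℝ) : ℝ :=
  c * b - K * D / L + 2 * L * b * D * r - L * D ^ 3 * r ^ 2

noncomputable def midA (L c K b D r : ℝ) : ℝ := K - L ^ 2 * r * (b + midW b D r) - L * c * D * r

/-- Lagrangian variables between the peaks. -/
noncomputable def mid (L c K b D : ℝ) (r s : ℝ → ℝ) : LagVar where
  y ξ := Real.log (midW b D (r ξ))
  U ξ := midN L c K b D (r ξ) / midW b D (r ξ)
  yξ ξ := D ^ 2 * s ξ / midW b D (r ξ)
  Uξ ξ := -L * (D * s ξ * (midE L c K b D / midW b D (r ξ) + midW b D (r ξ))) / midW b D (r ξ)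
  hbar ξ := L ^ 2 * (s ξ * (midE L c K b D / midW b D (r ξ) + midW b D (r ξ)) ^ 2) /
    midW b D (r ξ)
  h ξ := L ^ 2 * (s ξ * (midE L c K b D / midW b D (r ξ) + midW b D (r ξ)) ^ 2) /
    midW b D (r ξ)

/-- P and Q contain the same term `midE * midA / midW ^ 2` with opposite signs. D occurs in no
denominator, so the formulas persist at wave breaking, where D = 0. -/
noncomputable def midP (L c K b D r : ℝ) : ℝ :=
  L ^ 2 * r * (midW b D r + midE L c K b D / midW b D r) +
    (midN L c K b D r / midW b D r) ^ 2 / 2 +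
    midE L c K b D * midA L c K b D r / midW b D r ^ 2

noncomputable def midQ (L c K b D r : ℝ) : ℝ :=
  -(midE L c K b D * midA L c K b D r / midW b D r ^ 2) -
    L * D * r * (midN L c K b D r / midW b D r)

section Curve

variable {L c K t b' D' r' s' : ℝ} {b D r s : ℝ → ℝ}

lemma HasDerivAt.midW (hb : HasDerivAt b b' t) (hD : HasDerivAt D D' t) (hr : HasDerivAt r r' t) :
    HasDerivAt (fun t => midW (b t) (D t) (r t))
      (b' - (2 * D t * D' * r t + D t ^ 2 * r')) t := by
  refine (hb.sub ((hD.pow 2).mul hr)).congr_deriv ?_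
  simp only [Pi.pow_apply]
  ring

lemma HasDerivAt.midE (hb : HasDerivAt b b' t) (hD : HasDerivAt D D' t) :
    HasDerivAt (fun t => midE L c K (b t) (D t))
      (2 * b t * b' + c * (b' * D t + b t * D') / L - 2 * K * D t * D' / L ^ 2) t := by
  refine (((hb.pow 2).add (((hb.const_mul c).mul hD).div_const L)).sub
    (((hD.pow 2).const_mul K).div_const (L ^ 2))).congr_deriv ?_
  ring

lemma HasDerivAt.midN (hb : HasDerivAt b b' t) (hD : HasDerivAt D D' t) (hr : HasDerivAt r r' t) :
    HasDerivAt (fun t => midN L c K (b t) (D t) (r t))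
      (c * b' - K * D' / L + 2 * L * (b' * D t * r t + b t * D' * r t + b t * D t * r')
        - L * (3 * D t ^ 2 * D' * r t ^ 2 + 2 * D t ^ 3 * r t * r')) t := by
  refine ((((hb.const_mul c).sub ((hD.const_mul K).div_const L)).add
    (((hb.const_mul (2 * L)).mul hD).mul hr)).sub
    (((hD.pow 3).const_mul L).mul (hr.pow 2))).congr_deriv ?_
  simp only [Pi.pow_apply, Pi.mul_apply]
  ring

lemma HasDerivAt.midA (hb : HasDerivAt b b' t) (hD : HasDerivAt D D' t) (hr : HasDerivAt r r' t) :
    HasDerivAt (fun t => midA L c K (b t) (D t) (r t))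
      (-(L ^ 2 * (r' * (b t + CamassaHolm.midW (b t) (D t) (r t)) +
        r t * (b' + (b' - (2 * D t * D' * r t + D t ^ 2 * r'))))) -
        L * c * (D' * r t + D t * r')) t := by
  refine ((((hr.const_mul (L ^ 2)).mul (hb.add (HasDerivAt.midW hb hD hr))).const_sub K).sub
    ((hD.const_mul (L * c)).mul hr)).congr_deriv ?_
  simp only [Pi.add_apply]
  ring

end Curve

lemma mid_smoothAt {L c K b D ξ : ℝ} {r s : ℝ → ℝ} (hL : L ≠ 0)
    (hw : 0 < midW b D (r ξ)) (hr : HasDerivAt r (-s ξ) ξ) (hs : ContinuousAt s ξ) :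
    SmoothAt (mid L c K b D r s) (fun ξ => midP L c K b D (r ξ)) (fun ξ => midQ L c K b D (r ξ))
      ξ := by
  have w0 := hw.ne'
  have hb := hasDerivAt_const ξ b
  have hD := hasDerivAt_const ξ D
  have dW := HasDerivAt.midW hb hD hr
  have dN := HasDerivAt.midN (L := L) (c := c) (K := K) hb hD hr
  have dE := HasDerivAt.midE (L := L) (c := c) (K := K) hb hD
  have dA := HasDerivAt.midA (L := L) (c := c) (K := K) hb hD hr
  have cW := dW.continuousAt
  have cZ : ContinuousAt (fun ξ => midE L c K b D / midW b D (r ξ) + midW b D (r ξ)) ξ :=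
    (continuousAt_const.div cW w0).add cW
  obtain ⟨x, hx⟩ : ∃ x, x = r ξ := ⟨_, rfl⟩
  obtain ⟨y, hy⟩ : ∃ y, y = s ξ := ⟨_, rfl⟩
  obtain ⟨w, hwe⟩ : ∃ w, midW b D x = w := ⟨_, rfl⟩
  -- Eliminating b in favour of w makes the only label-dependent denominator an independent
  -- variable, and each claim becomes a polynomial identity.
  have hbw : b = w + D ^ 2 * x := by rw [← hwe, midW]; ring
  have w0' : w ≠ 0 := by rwa [← hwe, hx]
  refine ⟨?_, ?_, ?_, ?_, ?_, ?_, ?_, ?_⟩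
  · refine (dW.log w0).congr_deriv ?_
    simp only [mid]
    ring
  · refine (dN.div dW w0).congr_deriv ?_
    simp only [mid, midN, midE, ← hx, ← hy, hwe]
    rw [hbw]
    field_simp
    ring
  · refine ((((hr.const_mul (L ^ 2)).mul (dW.add (dE.div dW w0))).add
      (((dN.div dW w0).pow 2).div_const 2)).add
      ((dE.mul dA).div (dW.pow 2) (pow_ne_zero 2 w0))).congr_deriv ?_
    simp only [mid, midN, midE, midQ, midA, Pi.add_apply, Pi.pow_apply, Pi.div_apply,
      Nat.reduceSub, pow_one,
      Pi.mul_apply, ← hx, ← hy, hwe]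
    rw [hbw]
    field_simp
    ring
  · refine (((dE.mul dA).div (dW.pow 2) (pow_ne_zero 2 w0)).neg.sub
      ((hr.const_mul (L * D)).mul (dN.div dW w0))).congr_deriv ?_
    simp only [mid, midN, midE, midP, midA, Pi.pow_apply, Pi.div_apply,
      Nat.reduceSub, pow_one,
      Pi.mul_apply, ← hx, ← hy, hwe]
    rw [hbw]
    field_simp
    ring
  · exact (continuousAt_const.mul hs).div cW w0
  · exact (continuousAt_const.mul ((continuousAt_const.mul hs).mul cZ)).div cW w0
  · exact (continuousAt_const.mul (hs.mul (cZ.pow 2))).div cW w0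
  · exact (continuousAt_const.mul (hs.mul (cZ.pow 2))).div cW w0

lemma mid_admissibleAt {L c K b D ξ : ℝ} {r s : ℝ → ℝ} (hw : 0 < midW b D (r ξ)) (hs : 0 ≤ s ξ) :
    AdmissibleAt (mid L c K b D r s) ξ := by
  refine ⟨?_, ?_, le_rfl, ?_⟩ <;> simp only [mid]
  · positivity
  · positivity
  · field_simp

/-- Between the peaks u = αe^x + βe^{-x}, so w = e^y satisfies the Riccati equation w_t = αw² + β,
of which b = e^{q₂} is a particular solution. Writing w = b - D²r reduces it to r_t = L D r², and s
= -r_ξ satisfies the linearization. -/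
lemma mid_timeODE {L c K ξ : ℝ} {b D : ℝ → ℝ} {r s : ℝ → ℝ → ℝ} {I : Set ℝ} (hL : L ≠ 0)
    (hb : ∀ t, HasDerivAt b (c * b t - K * D t / L) t) (hD : ∀ t, HasDerivAt D (-L * b t) t)
    (hr : ∀ t ∈ I, HasDerivAt (fun t => r t ξ) (L * D t * r t ξ ^ 2) t)
    (hs : ∀ t ∈ I, HasDerivAt (fun t => s t ξ) (2 * L * D t * r t ξ * s t ξ) t)
    (hw : ∀ t ∈ I, 0 < midW (b t) (D t) (r t ξ)) :
    TimeODE (fun t => mid L c K (b t) (D t) (r t) (s t))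
      (fun t ξ => midP L c K (b t) (D t) (r t ξ))
      (fun t ξ => midQ L c K (b t) (D t) (r t ξ)) I ξ := by
  have dW := fun t ht => HasDerivAt.midW (hb t) (hD t) (hr t ht)
  have dE := fun t => HasDerivAt.midE (L := L) (c := c) (K := K) (hb t) (hD t)
  have dN := fun t ht => HasDerivAt.midN (L := L) (c := c) (K := K) (hb t) (hD t) (hr t ht)
  have dA := fun t ht => HasDerivAt.midA (L := L) (c := c) (K := K) (hb t) (hD t) (hr t ht)
  have w0 : ∀ t ∈ I, midW (b t) (D t) (r t ξ) ≠ 0 := fun t ht => (hw t ht).ne'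
  have cW : ContinuousOn (fun t => midW (b t) (D t) (r t ξ)) I := fun t ht =>
    (dW t ht).continuousAt.continuousWithinAt
  have cE : ContinuousOn (fun t => midE L c K (b t) (D t)) I := fun t ht =>
    (dE t).continuousAt.continuousWithinAt
  have cN : ContinuousOn (fun t => midN L c K (b t) (D t) (r t ξ)) I := fun t ht =>
    (dN t ht).continuousAt.continuousWithinAt
  have cA : ContinuousOn (fun t => midA L c K (b t) (D t) (r t ξ)) I := fun t ht =>
    (dA t ht).continuousAt.continuousWithinAt
  have cr : ContinuousOn (fun t => r t ξ) I := fun t ht =>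
    (hr t ht).continuousAt.continuousWithinAt
  have cs : ContinuousOn (fun t => s t ξ) I := fun t ht =>
    (hs t ht).continuousAt.continuousWithinAt
  have cD : ContinuousOn D I := fun t ht => (hD t).continuousAt.continuousWithinAt
  have cU := cN.div cW w0
  have cAE := (cE.mul cA).div (cW.pow 2) fun t ht => pow_ne_zero 2 (w0 t ht)
  have dZ := fun t ht => ((dE t).div (dW t ht) (w0 t ht)).add (dW t ht)
  refine ⟨fun t ht => ?_, fun t ht => ?_, fun t ht => ?_, fun t ht => ?_, fun t ht => ?_,
    ?_, ?_, ?_⟩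
  rotate_left 5
  · exact ((cr.const_mul _).mul (cW.add (cE.div cW w0))).add ((cU.pow 2).div_const 2) |>.add cAE
  · exact cAE.neg.sub (((cD.const_mul L).mul cr).mul cU)
  · exact (continuousOn_const.mul (cs.mul (((cE.div cW w0).add cW).pow 2))).div cW w0
  all_goals
    obtain ⟨x, hx⟩ : ∃ x, x = r t ξ := ⟨_, rfl⟩
    obtain ⟨y, hy⟩ : ∃ y, y = s t ξ := ⟨_, rfl⟩
    obtain ⟨d, hd⟩ : ∃ d, d = D t := ⟨_, rfl⟩
    obtain ⟨w, hwe⟩ : ∃ w, midW (b t) d x = w := ⟨_, rfl⟩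
    have hbw : b t = w + d ^ 2 * x := by rw [← hwe, midW]; ring
    have w0' : w ≠ 0 := by rw [← hwe, hx, hd]; exact w0 t ht
    have hw0 := w0 t ht
  · refine ((dW t ht).log hw0).congr_deriv ?_
    simp only [mid, midN, ← hx, ← hd, hwe]
    rw [hbw]
    field_simp
    ring
  · refine ((dN t ht).div (dW t ht) hw0).congr_deriv ?_
    simp only [midQ, midN, midE, midA, ← hx, ← hd, hwe]
    rw [hbw]
    field_simp
    ring
  · refine ((((hD t).pow 2).mul (hs t ht)).div (dW t ht) hw0).congr_deriv ?_
    simp only [mid, midE, Pi.pow_apply, Pi.mul_apply, ← hx, ← hy, ← hd, hwe]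
    rw [hbw]
    field_simp
    ring
  · refine (((((hD t).mul (hs t ht)).mul (dZ t ht)).const_mul (-L)).div (dW t ht)
      hw0).congr_deriv ?_
    simp only [mid, midP, midN, midE, midA, Pi.add_apply, Pi.div_apply, Pi.mul_apply, ← hx, ← hy,
      ← hd, hwe]
    rw [hbw]
    field_simp
    ring
  · refine ((((hs t ht).mul ((dZ t ht).pow 2)).const_mul (L ^ 2)).div (dW t ht)
      hw0).congr_deriv ?_
    simp only [mid, midP, midN, midE, midA, Pi.add_apply, Pi.div_apply, Pi.mul_apply, Pi.pow_apply,
      Nat.reduceSub, pow_one,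
      ← hx, ← hy, ← hd, hwe]
    rw [hbw]
    field_simp
    ring

/-! ### The region between the two peaks, after wave breaking -/

/-- All labels between the peaks move with the peakon, located at `x`, of height `c`. -/
noncomputable def midAfter (c x : ℝ) (m : ℝ → ℝ) : LagVar where
  y _ := x
  U _ := c
  yξ _ := 0
  Uξ _ := 0
  hbar _ := 0
  h := m

/-- With y_ξ = h̄ = 0 any constants p, q satisfy the pressure equations; c²/2 and 0 are the values
that match the outer regions at the peak. -/
lemma midAfter_smoothAt {c x ξ : ℝ} {m : ℝ → ℝ} (hm : ContinuousAt m ξ) :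
    SmoothAt (midAfter c x m) (fun _ => c ^ 2 / 2) (fun _ => 0) ξ where
  deriv_y := hasDerivAt_const _ _
  deriv_U := hasDerivAt_const _ _
  deriv_p := by simpa using hasDerivAt_const ξ (c ^ 2 / 2)
  deriv_q := by simpa [midAfter] using hasDerivAt_const ξ (0 : ℝ)
  cont_yξ := continuousAt_const
  cont_Uξ := continuousAt_const
  cont_h := hm
  cont_hbar := continuousAt_const

lemma midAfter_admissibleAt {c x ξ : ℝ} {m : ℝ → ℝ} (hm : 0 ≤ m ξ) :
    AdmissibleAt (midAfter c x m) ξ :=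
  ⟨le_rfl, le_rfl, hm, by simp [midAfter]⟩

lemma midAfter_timeODE {c t₀ ξ : ℝ} {m : ℝ → ℝ} {I : Set ℝ} :
    TimeODE (fun t => midAfter c (c * (t - t₀)) m) (fun _ _ => c ^ 2 / 2) (fun _ _ => 0) I ξ where
  y t _ := by simpa [midAfter] using ((hasDerivAt_id t).sub_const t₀).const_mul c
  U t _ := by simpa [midAfter] using hasDerivAt_const t c
  yξ t _ := hasDerivAt_const _ _
  Uξ t _ := by simpa [midAfter] using hasDerivAt_const t (0 : ℝ)
  h t _ := by simpa [midAfter] using hasDerivAt_const t (m ξ)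
  cont_p := continuousOn_const
  cont_q := continuousOn_const
  cont_hbar := continuousOn_const

end Mid

/-! ### Gluing in the label and in time -/

section Glue

/-- The function which is `f` on the left of `q₁`, `g` on `[q₁, q₂]` and `h` on the right of
`q₂`. -/
noncomputable def glue (q₁ q₂ : ℝ) (f g h : ℝ → ℝ) (ξ : ℝ) : ℝ :=
  if ξ < q₁ then f ξ else if ξ ≤ q₂ then g ξ else h ξ

/-- Lagrangian variables glued at two labels. -/
noncomputable def LagVar.glue (q₁ q₂ : ℝ) (A B C : LagVar) : LagVar where
  y := CamassaHolm.glue q₁ q₂ A.y B.y C.y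
  U := CamassaHolm.glue q₁ q₂ A.U B.U C.U
  yξ := CamassaHolm.glue q₁ q₂ A.yξ B.yξ C.yξ
  Uξ := CamassaHolm.glue q₁ q₂ A.Uξ B.Uξ C.Uξ
  hbar := CamassaHolm.glue q₁ q₂ A.hbar B.hbar C.hbar
  h := CamassaHolm.glue q₁ q₂ A.h B.h C.h

variable {q₁ q₂ ξ : ℝ} {f g h : ℝ → ℝ} {A B C : LagVar} {pA pB pC qA qB qC : ℝ → ℝ}

lemma glue_of_lt (hξ : ξ < q₁) : glue q₁ q₂ f g h ξ = f ξ := if_pos hξ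

lemma glue_of_mem (hξ : ξ ∈ Set.Icc q₁ q₂) : glue q₁ q₂ f g h ξ = g ξ := by
  rw [glue, if_neg hξ.1.not_gt, if_pos hξ.2]

lemma glue_of_gt (hq : q₁ ≤ q₂) (hξ : q₂ < ξ) : glue q₁ q₂ f g h ξ = h ξ := by
  rw [glue, if_neg (hq.trans hξ.le).not_gt, if_neg hξ.not_ge]

lemma glue_eventuallyEq_of_lt (hξ : ξ < q₁) : glue q₁ q₂ f g h =ᶠ[𝓝 ξ] f := by
  filter_upwards [gt_mem_nhds hξ] with x hx using glue_of_lt hx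

lemma glue_eventuallyEq_of_mem (h1 : q₁ < ξ) (h2 : ξ < q₂) : glue q₁ q₂ f g h =ᶠ[𝓝 ξ] g := by
  filter_upwards [Ioo_mem_nhds h1 h2] with x hx using glue_of_mem ⟨hx.1.le, hx.2.le⟩

lemma glue_eventuallyEq_of_gt (hq : q₁ ≤ q₂) (hξ : q₂ < ξ) : glue q₁ q₂ f g h =ᶠ[𝓝 ξ] h := by
  filter_upwards [lt_mem_nhds hξ] with x hx using glue_of_gt hq hx

lemma continuous_glue (hq : q₁ ≤ q₂) (hf : ∀ ξ ≤ q₁, ContinuousAt f ξ)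
    (hg : ∀ ξ ∈ Set.Icc q₁ q₂, ContinuousAt g ξ) (hh : ∀ ξ, q₂ ≤ ξ → ContinuousAt h ξ)
    (h1 : f q₁ = g q₁) (h2 : g q₂ = h q₂) : Continuous (glue q₁ q₂ f g h) := by
  have e1 : Set.EqOn (glue q₁ q₂ f g h) f (Set.Iic q₁) := by
    intro x hx
    rcases (Set.mem_Iic.1 hx).lt_or_eq with hx | rfl
    · exact glue_of_lt hx
    · rw [h1, glue_of_mem ⟨le_rfl, hq⟩]
  have e2 : Set.EqOn (glue q₁ q₂ f g h) g (Set.Icc q₁ q₂) := fun x hx => glue_of_mem hx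
  have e3 : Set.EqOn (glue q₁ q₂ f g h) h (Set.Ici q₂) := by
    intro x hx
    rcases (Set.mem_Ici.1 hx).lt_or_eq with hx | rfl
    · exact glue_of_gt hq hx
    · rw [← h2, glue_of_mem ⟨hq, le_rfl⟩]
  have c1 : ContinuousOn (glue q₁ q₂ f g h) (Set.Iic q₁) :=
    ContinuousOn.congr (fun x hx => (hf x hx).continuousWithinAt) e1
  have c2 : ContinuousOn (glue q₁ q₂ f g h) (Set.Icc q₁ q₂) :=
    ContinuousOn.congr (fun x hx => (hg x hx).continuousWithinAt) e2
  have c3 : ContinuousOn (glue q₁ q₂ f g h) (Set.Ici q₂) :=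
    ContinuousOn.congr (fun x hx => (hh x hx).continuousWithinAt) e3
  have c4 := (c1.union_of_isClosed c2 isClosed_Iic isClosed_Icc).union_of_isClosed c3
    (isClosed_Iic.union isClosed_Icc) isClosed_Ici
  rw [Set.Iic_union_Icc_eq_Iic hq, Set.Iic_union_Ici] at c4
  exact continuousOn_univ.1 c4

lemma SmoothAt.congr {Θ Θ' : LagVar} {p q p' q' : ℝ → ℝ} (H : SmoothAt Θ p q ξ)
    (hy : Θ'.y =ᶠ[𝓝 ξ] Θ.y) (hU : Θ'.U =ᶠ[𝓝 ξ] Θ.U) (hyξ : Θ'.yξ =ᶠ[𝓝 ξ] Θ.yξ)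
    (hUξ : Θ'.Uξ =ᶠ[𝓝 ξ] Θ.Uξ) (hhb : Θ'.hbar =ᶠ[𝓝 ξ] Θ.hbar) (hh : Θ'.h =ᶠ[𝓝 ξ] Θ.h)
    (hp : p' =ᶠ[𝓝 ξ] p) (hq : q' =ᶠ[𝓝 ξ] q) : SmoothAt Θ' p' q' ξ := by
  refine ⟨?_, ?_, ?_, ?_, H.cont_yξ.congr hyξ.symm, H.cont_Uξ.congr hUξ.symm,
    H.cont_h.congr hh.symm, H.cont_hbar.congr hhb.symm⟩
  · rw [hyξ.eq_of_nhds]; exact H.deriv_y.congr_of_eventuallyEq hy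
  · rw [hUξ.eq_of_nhds]; exact H.deriv_U.congr_of_eventuallyEq hU
  · rw [hyξ.eq_of_nhds, hq.eq_of_nhds]; exact H.deriv_p.congr_of_eventuallyEq hp
  · rw [hp.eq_of_nhds, hU.eq_of_nhds, hyξ.eq_of_nhds, hhb.eq_of_nhds]
    exact H.deriv_q.congr_of_eventuallyEq hq

/-- The two peaks, and for each of the three regions a statement about its Lagrangian variables. -/
lemma three_regions (hq : q₁ ≤ q₂) {motive : LagVar → (ℝ → ℝ) → (ℝ → ℝ) → Prop}
    (hmotive : ∀ Θ Θ' p p' q q', (Θ.y ξ = Θ'.y ξ ∧ Θ.U ξ = Θ'.U ξ ∧ Θ.yξ ξ = Θ'.yξ ξ ∧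
      Θ.Uξ ξ = Θ'.Uξ ξ ∧ Θ.hbar ξ = Θ'.hbar ξ ∧ Θ.h ξ = Θ'.h ξ ∧ p ξ = p' ξ ∧ q ξ = q' ξ) →
      motive Θ p q → motive Θ' p' q')
    (hA : ξ < q₁ → motive A pA qA) (hB : ξ ∈ Set.Icc q₁ q₂ → motive B pB qB)
    (hC : q₂ < ξ → motive C pC qC) :
    motive (LagVar.glue q₁ q₂ A B C) (glue q₁ q₂ pA pB pC) (glue q₁ q₂ qA qB qC) := by
  rcases lt_or_ge ξ q₁ with h1 | h1
  · refine hmotive _ _ _ _ _ _ ?_ (hA h1)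
    simp only [LagVar.glue, glue_of_lt h1, and_self]
  rcases le_or_gt ξ q₂ with h2 | h2
  · refine hmotive _ _ _ _ _ _ ?_ (hB ⟨h1, h2⟩)
    simp only [LagVar.glue, glue_of_mem (Set.mem_Icc.2 ⟨h1, h2⟩), and_self]
  · refine hmotive _ _ _ _ _ _ ?_ (hC h2)
    simp only [LagVar.glue, glue_of_gt hq h2, and_self]

lemma AdmissibleAt.glue (hq : q₁ ≤ q₂) (hA : ξ < q₁ → AdmissibleAt A ξ)
    (hB : ξ ∈ Set.Icc q₁ q₂ → AdmissibleAt B ξ) (hC : q₂ < ξ → AdmissibleAt C ξ) :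
    AdmissibleAt (LagVar.glue q₁ q₂ A B C) ξ := by
  refine three_regions (motive := fun Θ _ _ => AdmissibleAt Θ ξ) (pA := A.y) (pB := A.y)
    (pC := A.y) (qA := A.y) (qB := A.y) (qC := A.y) hq ?_ hA hB hC
  rintro Θ Θ' - - - - ⟨-, -, h3, h4, h5, h6, -, -⟩ ⟨k1, k2, k3, k4⟩
  rw [h3] at k1 k4
  rw [h4] at k4
  rw [h5] at k2 k3 k4
  rw [h6] at k3
  exact ⟨k1, k2, k3, k4⟩

lemma DecayAt.glue {M : ℝ} (hq : q₁ ≤ q₂) (hA : ξ < q₁ → DecayAt A pA qA M ξ)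
    (hB : ξ ∈ Set.Icc q₁ q₂ → DecayAt B pB qB M ξ) (hC : q₂ < ξ → DecayAt C pC qC M ξ) :
    DecayAt (LagVar.glue q₁ q₂ A B C) (glue q₁ q₂ pA pB pC) (glue q₁ q₂ qA qB qC) M ξ := by
  refine three_regions (motive := fun Θ p q => DecayAt Θ p q M ξ) hq ?_ hA hB hC
  rintro Θ Θ' p p' q q' ⟨h1, h2, h3, h4, h5, h6, h7, h8⟩ ⟨k1, k2, k3, k4, k5, k6, k7⟩
  exact ⟨h1 ▸ k1, h2 ▸ k2, h3 ▸ k3, h4 ▸ k4, h6 ▸ k5, h7 ▸ k6, h8 ▸ k7⟩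

lemma TimeODE.glue {A B C : ℝ → LagVar} {pA pB pC qA qB qC : ℝ → ℝ → ℝ} {I : Set ℝ}
    (hq : q₁ ≤ q₂) (hA : ξ < q₁ → TimeODE A pA qA I ξ)
    (hB : ξ ∈ Set.Icc q₁ q₂ → TimeODE B pB qB I ξ) (hC : q₂ < ξ → TimeODE C pC qC I ξ) :
    TimeODE (fun t => LagVar.glue q₁ q₂ (A t) (B t) (C t))
      (fun t => CamassaHolm.glue q₁ q₂ (pA t) (pB t) (pC t))
      (fun t => CamassaHolm.glue q₁ q₂ (qA t) (qB t) (qC t)) I ξ := by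
  rcases lt_or_ge ξ q₁ with h1 | h1
  · obtain ⟨k1, k2, k3, k4, k5, k6, k7, k8⟩ := hA h1
    constructor <;> simpa only [LagVar.glue, glue_of_lt h1]
  rcases le_or_gt ξ q₂ with h2 | h2
  · have h3 : ξ ∈ Set.Icc q₁ q₂ := ⟨h1, h2⟩
    obtain ⟨k1, k2, k3, k4, k5, k6, k7, k8⟩ := hB h3
    constructor <;> simpa only [LagVar.glue, glue_of_mem h3]
  · obtain ⟨k1, k2, k3, k4, k5, k6, k7, k8⟩ := hC h2
    constructor <;> simpa only [LagVar.glue, glue_of_gt hq h2]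

/-- Each piece is smooth up to and including its end labels, so continuity of y, U, p, q reduces to
equality of values there. The remaining variables may jump at the two labels, which form the
exceptional set. -/
lemma isProfile_glue {M δ : ℝ} (hq : q₁ ≤ q₂) (hA : ∀ ξ ≤ q₁, SmoothAt A pA qA ξ)
    (hB : ∀ ξ ∈ Set.Icc q₁ q₂, SmoothAt B pB qB ξ) (hC : ∀ ξ, q₂ ≤ ξ → SmoothAt C pC qC ξ)
    (h1 : A.y q₁ = B.y q₁ ∧ A.U q₁ = B.U q₁ ∧ pA q₁ = pB q₁ ∧ qA q₁ = qB q₁)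
    (h2 : B.y q₂ = C.y q₂ ∧ B.U q₂ = C.U q₂ ∧ pB q₂ = pC q₂ ∧ qB q₂ = qC q₂)
    (had : ∀ ξ, AdmissibleAt (LagVar.glue q₁ q₂ A B C) ξ)
    (hdec : ∀ ξ, DecayAt (LagVar.glue q₁ q₂ A B C) (glue q₁ q₂ pA pB pC) (glue q₁ q₂ qA qB qC) M ξ)
    (hlim : Tendsto (fun ξ => A.y ξ - ξ) atBot (𝓝 0)) (hδ : 0 < δ)
    (hlow : ∀ ξ, δ ≤ (LagVar.glue q₁ q₂ A B C).yξ ξ + (LagVar.glue q₁ q₂ A B C).h ξ) :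
    IsProfile (LagVar.glue q₁ q₂ A B C) (glue q₁ q₂ pA pB pC) (glue q₁ q₂ qA qB qC)
      {q₁, q₂} := by
  have hs : ∀ ξ ∉ ({q₁, q₂} : Set ℝ), SmoothAt (LagVar.glue q₁ q₂ A B C)
      (glue q₁ q₂ pA pB pC) (glue q₁ q₂ qA qB qC) ξ := by
    intro ξ hξ
    simp only [Set.mem_insert_iff, Set.mem_singleton_iff, not_or] at hξ
    rcases lt_or_gt_of_ne hξ.1 with k1 | k1
    · exact (hA ξ k1.le).congr (glue_eventuallyEq_of_lt k1) (glue_eventuallyEq_of_lt k1)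
        (glue_eventuallyEq_of_lt k1) (glue_eventuallyEq_of_lt k1) (glue_eventuallyEq_of_lt k1)
        (glue_eventuallyEq_of_lt k1) (glue_eventuallyEq_of_lt k1) (glue_eventuallyEq_of_lt k1)
    rcases lt_or_gt_of_ne hξ.2 with k2 | k2
    · exact (hB ξ ⟨k1.le, k2.le⟩).congr (glue_eventuallyEq_of_mem k1 k2)
        (glue_eventuallyEq_of_mem k1 k2) (glue_eventuallyEq_of_mem k1 k2)
        (glue_eventuallyEq_of_mem k1 k2) (glue_eventuallyEq_of_mem k1 k2)
        (glue_eventuallyEq_of_mem k1 k2) (glue_eventuallyEq_of_mem k1 k2)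
        (glue_eventuallyEq_of_mem k1 k2)
    · exact (hC ξ k2.le).congr (glue_eventuallyEq_of_gt hq k2) (glue_eventuallyEq_of_gt hq k2)
        (glue_eventuallyEq_of_gt hq k2) (glue_eventuallyEq_of_gt hq k2)
        (glue_eventuallyEq_of_gt hq k2) (glue_eventuallyEq_of_gt hq k2)
        (glue_eventuallyEq_of_gt hq k2) (glue_eventuallyEq_of_gt hq k2)
  exact
  { countable := (Set.toFinite _).countable
    cont_y := continuous_glue hq (fun ξ h => (hA ξ h).deriv_y.continuousAt)
      (fun ξ h => (hB ξ h).deriv_y.continuousAt) (fun ξ h => (hC ξ h).deriv_y.continuousAt)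
      h1.1 h2.1
    cont_U := continuous_glue hq (fun ξ h => (hA ξ h).deriv_U.continuousAt)
      (fun ξ h => (hB ξ h).deriv_U.continuousAt) (fun ξ h => (hC ξ h).deriv_U.continuousAt)
      h1.2.1 h2.2.1
    cont_p := continuous_glue hq (fun ξ h => (hA ξ h).deriv_p.continuousAt)
      (fun ξ h => (hB ξ h).deriv_p.continuousAt) (fun ξ h => (hC ξ h).deriv_p.continuousAt)
      h1.2.2.1 h2.2.2.1
    cont_q := continuous_glue hq (fun ξ h => (hA ξ h).deriv_q.continuousAt)
      (fun ξ h => (hB ξ h).deriv_q.continuousAt) (fun ξ h => (hC ξ h).deriv_q.continuousAt)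
      h1.2.2.2 h2.2.2.2
    deriv_y := fun ξ h => (hs ξ h).deriv_y
    deriv_U := fun ξ h => (hs ξ h).deriv_U
    deriv_p := fun ξ h => (hs ξ h).deriv_p
    deriv_q := fun ξ h => (hs ξ h).deriv_q
    cont_yξ := fun ξ h => (hs ξ h).cont_yξ
    cont_Uξ := fun ξ h => (hs ξ h).cont_Uξ
    cont_h := fun ξ h => (hs ξ h).cont_h
    cont_hbar := fun ξ h => (hs ξ h).cont_hbar
    bound_y := ⟨M, fun ξ => (hdec ξ).y⟩
    bound_U := ⟨M, fun ξ => (hdec ξ).U⟩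
    bound_yξ := ⟨M, fun ξ => (hdec ξ).yξ⟩
    bound_Uξ := ⟨M, fun ξ => (hdec ξ).Uξ⟩
    bound_h := ⟨M, fun ξ => (hdec ξ).h⟩
    bound_p := ⟨M, fun ξ => (hdec ξ).p⟩
    bound_q := ⟨M, fun ξ => (hdec ξ).q⟩
    yξ_nonneg := fun ξ => (had ξ).yξ_nonneg
    hbar_nonneg := fun ξ => (had ξ).hbar_nonneg
    hbar_le := fun ξ => (had ξ).hbar_le
    energy_eq := fun ξ => (had ξ).energy_eq
    lim := hlim.congr' (by
      filter_upwards [eventually_lt_atBot q₁] with ξ hξ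
      simp only [LagVar.glue, glue_of_lt hξ])
    lower := ⟨δ, hδ, hlow⟩ }

/-! ### Gluing in time -/

/-- The function f has to agree with both pieces at t₀, but the right-hand side g may jump there, as
h̄ does at wave breaking: one instant does not affect the integral. -/
lemma solvesFrom_zero_of_hasDerivAt {t₀ : ℝ} {fB fA gB gA f g : ℝ → ℝ} (ht₀ : 0 ≤ t₀)
    (hB : ∀ t ∈ Set.Icc 0 t₀, HasDerivAt fB (gB t) t) (hgB : ContinuousOn gB (Set.Icc 0 t₀))
    (hA : ∀ t ∈ Set.Ici t₀, HasDerivAt fA (gA t) t) (hgA : ContinuousOn gA (Set.Ici t₀))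
    (hfB : ∀ t, 0 ≤ t → t ≤ t₀ → f t = fB t) (hfA : ∀ t, t₀ ≤ t → f t = fA t)
    (hg : ∀ t, 0 ≤ t → t < t₀ → g t = gB t) (hg' : ∀ t, t₀ ≤ t → g t = gA t) :
    SolvesFrom 0 f g := by
  have before : ∀ t, 0 ≤ t → t ≤ t₀ → IntervalIntegrable g volume 0 t ∧
      ∫ s in (0 : ℝ)..t, g s = f t - f 0 := by
    intro t h0 ht
    have hi : IntervalIntegrable gB volume 0 t :=
      ContinuousOn.intervalIntegrable (hgB.mono (by
        rw [Set.uIcc_of_le h0]; exact Set.Icc_subset_Icc_right ht))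
    have hae : ∀ᵐ s, s ∈ Set.uIoc 0 t → gB s = g s := by
      have : ∀ᵐ s : ℝ, s ≠ t₀ := by simp [ae_iff]
      filter_upwards [this] with s hs hs'
      rw [Set.uIoc_of_le h0] at hs'
      exact (hg s hs'.1.le (lt_of_le_of_ne (hs'.2.trans ht) hs)).symm
    refine ⟨hi.congr_ae ((ae_restrict_iff' measurableSet_uIoc).2 hae), ?_⟩
    rw [← intervalIntegral.integral_congr_ae hae,
      intervalIntegral.integral_eq_sub_of_hasDerivAt (f := fB) (fun s hs => ?_) hi,
      hfB t h0 ht, hfB 0 le_rfl ht₀]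
    rw [Set.uIcc_of_le h0] at hs
    exact hB s ⟨hs.1, hs.2.trans ht⟩
  have after : ∀ t, t₀ ≤ t → IntervalIntegrable g volume t₀ t ∧
      ∫ s in t₀..t, g s = f t - f t₀ := by
    intro t ht
    have hi : IntervalIntegrable gA volume t₀ t :=
      ContinuousOn.intervalIntegrable (hgA.mono (by
        rw [Set.uIcc_of_le ht]; exact Set.Icc_subset_Ici_self))
    have hae : ∀ᵐ s, s ∈ Set.uIoc t₀ t → gA s = g s := by
      refine ae_of_all _ fun s hs => ?_
      rw [Set.uIoc_of_le ht] at hs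
      exact (hg' s hs.1.le).symm
    refine ⟨hi.congr_ae ((ae_restrict_iff' measurableSet_uIoc).2 hae), ?_⟩
    rw [← intervalIntegral.integral_congr_ae hae,
      intervalIntegral.integral_eq_sub_of_hasDerivAt (f := fA) (fun s hs => ?_) hi,
      hfA t ht, hfA t₀ le_rfl]
    rw [Set.uIcc_of_le ht] at hs
    exact hA s hs.1
  intro t h0
  rcases le_total t t₀ with ht | ht
  · obtain ⟨h1, h2⟩ := before t h0 ht
    exact ⟨h1, by rw [h2]; ring⟩
  · obtain ⟨h1, h2⟩ := before t₀ ht₀ le_rfl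
    obtain ⟨h3, h4⟩ := after t ht
    refine ⟨h1.trans h3, ?_⟩
    rw [← intervalIntegral.integral_add_adjacent_intervals h1 h3, h2, h4]
    ring

/-- The Lagrangian system in integrated form at a label. -/
structure SolvesAt (Θ : ℝ → LagVar) (ξ : ℝ) : Prop where
  y : SolvesFrom 0 (fun t => (Θ t).y ξ) (fun t => (Θ t).U ξ)
  U : SolvesFrom 0 (fun t => (Θ t).U ξ) (fun t => -(Θ t).Q ξ)
  yξ : SolvesFrom 0 (fun t => (Θ t).yξ ξ) (fun t => (Θ t).Uξ ξ)
  Uξ : SolvesFrom 0 (fun t => (Θ t).Uξ ξ)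
    (fun t => 1 / 2 * (Θ t).hbar ξ + ((Θ t).U ξ ^ 2 - (Θ t).P ξ) * (Θ t).yξ ξ)
  h : SolvesFrom 0 (fun t => (Θ t).h ξ) (fun t => 2 * ((Θ t).U ξ ^ 2 - (Θ t).P ξ) * (Θ t).Uξ ξ)

lemma solvesAt_of_timeODE {t₀ ξ : ℝ} {F G : ℝ → LagVar} {pF qF pG qG : ℝ → ℝ → ℝ} (ht₀ : 0 ≤ t₀)
    (hF : TimeODE F pF qF (Set.Icc 0 t₀) ξ) (hG : TimeODE G pG qG (Set.Ici t₀) ξ)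
    (hPF : ∀ t, 0 ≤ t → t < t₀ → (F t).P ξ = pF t ξ ∧ (F t).Q ξ = qF t ξ)
    (hPG : ∀ t, t₀ ≤ t → (G t).P ξ = pG t ξ ∧ (G t).Q ξ = qG t ξ)
    (hy : (F t₀).y ξ = (G t₀).y ξ) (hU : (F t₀).U ξ = (G t₀).U ξ)
    (hyξ : (F t₀).yξ ξ = (G t₀).yξ ξ) (hUξ : (F t₀).Uξ ξ = (G t₀).Uξ ξ)
    (hh : (F t₀).h ξ = (G t₀).h ξ) :
    SolvesAt (fun t => if t < t₀ then F t else G t) ξ := by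
  have eA : ∀ {t}, t₀ ≤ t → (if t < t₀ then F t else G t) = G t := fun ht => if_neg ht.not_gt
  have eB : ∀ {t}, t < t₀ → (if t < t₀ then F t else G t) = F t := fun ht => if_pos ht
  have e0 : (if t₀ < t₀ then F t₀ else G t₀) = G t₀ := eA le_rfl
  have cB : ∀ {k : LagVar → ℝ} {d : ℝ → ℝ},
      (∀ t ∈ Set.Icc 0 t₀, HasDerivAt (fun t => k (F t)) (d t) t) →
      ContinuousOn (fun t => k (F t)) (Set.Icc 0 t₀) := fun h t ht =>
    (h t ht).continuousAt.continuousWithinAt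
  have cA : ∀ {k : LagVar → ℝ} {d : ℝ → ℝ},
      (∀ t ∈ Set.Ici t₀, HasDerivAt (fun t => k (G t)) (d t) t) →
      ContinuousOn (fun t => k (G t)) (Set.Ici t₀) := fun h t ht =>
    (h t ht).continuousAt.continuousWithinAt
  have hf : ∀ k : LagVar → ℝ, k (F t₀) = k (G t₀) → ∀ t, 0 ≤ t → t ≤ t₀ →
      k (if t < t₀ then F t else G t) = k (F t) := by
    intro k hk t _ ht
    rcases ht.lt_or_eq with h | rfl
    · rw [eB h]
    · rw [e0, hk]
  have hf' : ∀ k : LagVar → ℝ, ∀ t, t₀ ≤ t → k (if t < t₀ then F t else G t) = k (G t) :=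
    fun k t ht => by rw [eA ht]
  have UB := cB (k := fun Θ => Θ.U ξ) hF.U
  have UA := cA (k := fun Θ => Θ.U ξ) hG.U
  have yB := cB (k := fun Θ => Θ.yξ ξ) hF.yξ
  have yA := cA (k := fun Θ => Θ.yξ ξ) hG.yξ
  have VB := cB (k := fun Θ => Θ.Uξ ξ) hF.Uξ
  have VA := cA (k := fun Θ => Θ.Uξ ξ) hG.Uξ
  refine ⟨?_, ?_, ?_, ?_, ?_⟩
  · exact solvesFrom_zero_of_hasDerivAt ht₀ hF.y UB hG.y UA
      (hf (fun Θ => Θ.y ξ) hy) (hf' fun Θ => Θ.y ξ) (fun t h0 ht => by simp only [eB ht])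
      (fun t ht => by simp only [eA ht])
  · exact solvesFrom_zero_of_hasDerivAt ht₀ hF.U hF.cont_q.neg hG.U hG.cont_q.neg
      (hf (fun Θ => Θ.U ξ) hU) (hf' fun Θ => Θ.U ξ)
      (fun t h0 ht => by simp only [eB ht, (hPF t h0 ht).2])
      (fun t ht => by simp only [eA ht, (hPG t ht).2])
  · exact solvesFrom_zero_of_hasDerivAt ht₀ hF.yξ VB hG.yξ VA
      (hf (fun Θ => Θ.yξ ξ) hyξ) (hf' fun Θ => Θ.yξ ξ) (fun t h0 ht => by simp only [eB ht])
      (fun t ht => by simp only [eA ht])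
  · exact solvesFrom_zero_of_hasDerivAt ht₀ hF.Uξ
      ((hF.cont_hbar.const_mul (1 / 2)).add (((UB.pow 2).sub hF.cont_p).mul yB)) hG.Uξ
      ((hG.cont_hbar.const_mul (1 / 2)).add (((UA.pow 2).sub hG.cont_p).mul yA))
      (hf (fun Θ => Θ.Uξ ξ) hUξ) (hf' fun Θ => Θ.Uξ ξ)
      (fun t h0 ht => by simp only [eB ht, (hPF t h0 ht).1])
      (fun t ht => by simp only [eA ht, (hPG t ht).1])
  · exact solvesFrom_zero_of_hasDerivAt ht₀ hF.h
      ((((UB.pow 2).sub hF.cont_p).const_mul 2).mul VB) hG.h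
      ((((UA.pow 2).sub hG.cont_p).const_mul 2).mul VA)
      (hf (fun Θ => Θ.h ξ) hh) (hf' fun Θ => Θ.h ξ)
      (fun t h0 ht => by simp only [eB ht, (hPF t h0 ht).1])
      (fun t ht => by simp only [eA ht, (hPG t ht).1])

end Glue

/-! ### Functions of time describing the peaks, and the labels between them -/

section Peaks

/-- `e^{q₂}` for the peakon-antipeakon solution. By reflection, `e^{-q₁}` is
`expQ (-c₂) (-c₁) t₀`. -/
noncomputable def expQ (c₁ c₂ t₀ t : ℝ) : ℝ :=
  (c₁ * Real.exp (c₁ * (t - t₀)) - c₂ * Real.exp (c₂ * (t - t₀))) / (c₁ - c₂)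

/-- The first derivative of `expQ`. -/
noncomputable def expQ₁ (c₁ c₂ t₀ t : ℝ) : ℝ :=
  (c₁ ^ 2 * Real.exp (c₁ * (t - t₀)) - c₂ ^ 2 * Real.exp (c₂ * (t - t₀))) / (c₁ - c₂)

/-- The second derivative of `expQ`. -/
noncomputable def expQ₂ (c₁ c₂ t₀ t : ℝ) : ℝ :=
  (c₁ ^ 3 * Real.exp (c₁ * (t - t₀)) - c₂ ^ 3 * Real.exp (c₂ * (t - t₀))) / (c₁ - c₂)

/-- A multiple of the inverse of the height of the peaks, which vanishes at wave breaking. -/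
noncomputable def gap (c₁ c₂ t₀ t : ℝ) : ℝ :=
  Real.exp (c₂ * (t - t₀)) - Real.exp (c₁ * (t - t₀))

/-- The height of the left peak is `peakS / gap` (`p₁_eq`). Moreover `peakS` is a primitive of c₁c₂
`gap`, which is what makes r_t = L D r² explicitly solvable. -/
noncomputable def peakS (c₁ c₂ t₀ t : ℝ) : ℝ :=
  c₁ * Real.exp (c₂ * (t - t₀)) - c₂ * Real.exp (c₁ * (t - t₀))

variable {c₁ c₂ t₀ : ℝ}

lemma hasDerivAt_exp_mul_sub (a t₀ t : ℝ) :
    HasDerivAt (fun t => Real.exp (a * (t - t₀))) (a * Real.exp (a * (t - t₀))) t := by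
  refine (((hasDerivAt_id t).sub_const t₀).const_mul a).exp.congr_deriv ?_
  simp [mul_comm]

lemma hasDerivAt_expQ (t : ℝ) : HasDerivAt (expQ c₁ c₂ t₀) (expQ₁ c₁ c₂ t₀ t) t := by
  refine ((((hasDerivAt_exp_mul_sub c₁ t₀ t).const_mul c₁).sub
    ((hasDerivAt_exp_mul_sub c₂ t₀ t).const_mul c₂)).div_const (c₁ - c₂)).congr_deriv ?_
  unfold expQ₁; ring

lemma hasDerivAt_expQ₁ (t : ℝ) : HasDerivAt (expQ₁ c₁ c₂ t₀) (expQ₂ c₁ c₂ t₀ t) t := by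
  refine ((((hasDerivAt_exp_mul_sub c₁ t₀ t).const_mul (c₁ ^ 2)).sub
    ((hasDerivAt_exp_mul_sub c₂ t₀ t).const_mul (c₂ ^ 2))).div_const (c₁ - c₂)).congr_deriv ?_
  unfold expQ₂; ring

lemma continuous_expQ : Continuous (expQ c₁ c₂ t₀) := by unfold expQ; fun_prop

lemma continuous_expQ₁ : Continuous (expQ₁ c₁ c₂ t₀) := by unfold expQ₁; fun_prop

lemma continuous_expQ₂ : Continuous (expQ₂ c₁ c₂ t₀) := by unfold expQ₂; fun_prop

lemma continuous_gap : Continuous (gap c₁ c₂ t₀) := by unfold gap; fun_prop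

lemma continuous_peakS : Continuous (peakS c₁ c₂ t₀) := by unfold peakS; fun_prop

lemma expQ_pos (hc₁ : 0 < c₁) (hc₂ : c₂ < 0) (t : ℝ) : 0 < expQ c₁ c₂ t₀ t := by
  have h1 : 0 < c₁ * Real.exp (c₁ * (t - t₀)) := mul_pos hc₁ (Real.exp_pos _)
  have h2 : c₂ * Real.exp (c₂ * (t - t₀)) < 0 := mul_neg_of_neg_of_pos hc₂ (Real.exp_pos _)
  exact div_pos (by linarith) (by linarith)

lemma peakS_pos (hc₁ : 0 < c₁) (hc₂ : c₂ < 0) (t : ℝ) : 0 < peakS c₁ c₂ t₀ t := by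
  have h1 : 0 < c₁ * Real.exp (c₂ * (t - t₀)) := mul_pos hc₁ (Real.exp_pos _)
  have h2 : c₂ * Real.exp (c₁ * (t - t₀)) < 0 := mul_neg_of_neg_of_pos hc₂ (Real.exp_pos _)
  unfold peakS
  linarith

lemma expQ_self (h : c₁ - c₂ ≠ 0) : expQ c₁ c₂ t₀ t₀ = 1 := by
  simp [expQ, h]

lemma expQ₁_self (h : c₁ - c₂ ≠ 0) : expQ₁ c₁ c₂ t₀ t₀ = c₁ + c₂ := by
  simp only [expQ₁, sub_self, mul_zero, Real.exp_zero, mul_one]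
  field_simp
  ring

lemma gap_self : gap c₁ c₂ t₀ t₀ = 0 := by simp [gap]

lemma gap_pos (h : c₂ < c₁) {t : ℝ} (ht : t < t₀) : 0 < gap c₁ c₂ t₀ t := by
  unfold gap
  rw [sub_pos, Real.exp_lt_exp]
  nlinarith

lemma hasDerivAt_gap (h : c₁ - c₂ ≠ 0) (t : ℝ) :
    HasDerivAt (gap c₁ c₂ t₀) (-(c₁ - c₂) * expQ c₁ c₂ t₀ t) t := by
  refine ((hasDerivAt_exp_mul_sub c₂ t₀ t).sub (hasDerivAt_exp_mul_sub c₁ t₀ t)).congr_deriv ?_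
  unfold expQ
  field_simp
  ring

lemma expQ₁_eq (h : c₁ - c₂ ≠ 0) (t : ℝ) : expQ₁ c₁ c₂ t₀ t =
    (c₁ + c₂) * expQ c₁ c₂ t₀ t - -(c₁ * c₂) * gap c₁ c₂ t₀ t / (c₁ - c₂) := by
  unfold expQ expQ₁ gap
  field_simp
  ring

lemma expQ₂_eq (h : c₁ - c₂ ≠ 0) (t : ℝ) : expQ₂ c₁ c₂ t₀ t =
    (c₁ + c₂) * expQ₁ c₁ c₂ t₀ t + -(c₁ * c₂) * expQ c₁ c₂ t₀ t := by
  unfold expQ expQ₁ expQ₂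
  field_simp
  ring

lemma peakS_eq (h : c₁ - c₂ ≠ 0) (t : ℝ) : peakS c₁ c₂ t₀ t =
    (c₁ - c₂) * expQ c₁ c₂ t₀ t + (c₁ + c₂) * gap c₁ c₂ t₀ t := by
  unfold expQ gap peakS
  field_simp
  ring

lemma midE_eq (h : c₁ - c₂ ≠ 0) (t : ℝ) :
    midE (c₁ - c₂) (c₁ + c₂) (-(c₁ * c₂)) (expQ c₁ c₂ t₀ t) (gap c₁ c₂ t₀ t) =
      Real.exp (c₁ * (t - t₀)) * Real.exp (c₂ * (t - t₀)) := by
  unfold midE expQ gap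
  field_simp
  ring

lemma midE_pos (h : c₁ - c₂ ≠ 0) (t : ℝ) :
    0 < midE (c₁ - c₂) (c₁ + c₂) (-(c₁ * c₂)) (expQ c₁ c₂ t₀ t) (gap c₁ c₂ t₀ t) := by
  rw [midE_eq h]; positivity

lemma exp_neg_eq_inv (a x : ℝ) : Real.exp (-a * x) = (Real.exp (a * x))⁻¹ := by
  rw [neg_mul, Real.exp_neg]

/-- The reflection x ↦ -x, u ↦ -u exchanges (c₁, c₂) with (-c₂, -c₁). This formula and the next two
express the left peak through the functions used between the peaks, so that matching there becomes
algebra. -/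
lemma expQ_neg_eq (h : c₁ - c₂ ≠ 0) (t : ℝ) : expQ (-c₂) (-c₁) t₀ t = peakS c₁ c₂ t₀ t /
    ((c₁ - c₂) * midE (c₁ - c₂) (c₁ + c₂) (-(c₁ * c₂)) (expQ c₁ c₂ t₀ t) (gap c₁ c₂ t₀ t)) := by
  rw [midE_eq h, expQ, exp_neg_eq_inv, exp_neg_eq_inv, peakS, show -c₂ - -c₁ = c₁ - c₂ by ring]
  field_simp
  ring

lemma expQ₁_neg_eq (h : c₁ - c₂ ≠ 0) (t : ℝ) : expQ₁ (-c₂) (-c₁) t₀ t =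
    -(-(c₁ * c₂) * gap c₁ c₂ t₀ t + (c₁ + c₂) * peakS c₁ c₂ t₀ t) /
    ((c₁ - c₂) * midE (c₁ - c₂) (c₁ + c₂) (-(c₁ * c₂)) (expQ c₁ c₂ t₀ t) (gap c₁ c₂ t₀ t)) := by
  rw [midE_eq h, expQ₁, exp_neg_eq_inv, exp_neg_eq_inv, peakS, gap,
    show -c₂ - -c₁ = c₁ - c₂ by ring]
  field_simp
  ring

lemma expQ₂_neg_eq (h : c₁ - c₂ ≠ 0) (t : ℝ) : expQ₂ (-c₂) (-c₁) t₀ t =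
    (-(c₁ * c₂) * ((c₁ - c₂) * expQ c₁ c₂ t₀ t) + 2 * (c₁ + c₂) * -(c₁ * c₂) * gap c₁ c₂ t₀ t +
      (c₁ + c₂) ^ 2 * peakS c₁ c₂ t₀ t) /
    ((c₁ - c₂) * midE (c₁ - c₂) (c₁ + c₂) (-(c₁ * c₂)) (expQ c₁ c₂ t₀ t) (gap c₁ c₂ t₀ t)) := by
  rw [midE_eq h, expQ₂, exp_neg_eq_inv, exp_neg_eq_inv, peakS, gap, expQ,
    show -c₂ - -c₁ = c₁ - c₂ by ring]
  field_simp
  ring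

lemma exp_q₂ (hc₁ : 0 < c₁) (hc₂ : c₂ < 0) (t : ℝ) :
    Real.exp (q₂ c₁ c₂ t₀ t) = expQ c₁ c₂ t₀ t := by
  have h1 : 0 < c₁ * Real.exp ((c₁ - c₂) * (t - t₀)) - c₂ := by
    have := mul_pos hc₁ (Real.exp_pos ((c₁ - c₂) * (t - t₀)))
    linarith
  have h2 : 0 < c₁ - c₂ := by linarith
  rw [q₂, Real.exp_add, Real.exp_add, Real.exp_neg, Real.exp_log h1, Real.exp_log h2, expQ,
    show c₁ * (t - t₀) = c₂ * (t - t₀) + (c₁ - c₂) * (t - t₀) by ring, Real.exp_add]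
  field_simp

lemma exp_neg_q₁ (hc₁ : 0 < c₁) (hc₂ : c₂ < 0) (t : ℝ) :
    Real.exp (-q₁ c₁ c₂ t₀ t) = expQ (-c₂) (-c₁) t₀ t := by
  have h1 : 0 < c₁ - c₂ * Real.exp ((c₁ - c₂) * (t - t₀)) := by
    have := mul_neg_of_neg_of_pos hc₂ (Real.exp_pos ((c₁ - c₂) * (t - t₀)))
    linarith
  have h2 : 0 < c₁ - c₂ := by linarith
  rw [q₁, neg_sub, sub_eq_add_neg, neg_add, Real.exp_add, Real.exp_add, Real.exp_neg (Real.log _),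
    Real.exp_log h1, Real.exp_log h2, expQ, Real.exp_neg, exp_neg_eq_inv, exp_neg_eq_inv,
    show -c₂ - -c₁ = c₁ - c₂ by ring,
    show c₁ * (t - t₀) = c₂ * (t - t₀) + (c₁ - c₂) * (t - t₀) by ring, Real.exp_add]
  field_simp
  ring

/-- In terms of the positions: e^{q₂ - q₁} = 1 + K D²/(L²E) with K = -c₁c₂ > 0 when c₁ > 0 > c₂.
Thus the peaks are ordered and meet exactly when `gap` vanishes. -/
lemma expQ_mul_expQ_neg (h : c₁ - c₂ ≠ 0) (t : ℝ) :
    (c₁ - c₂) * expQ c₁ c₂ t₀ t * peakS c₁ c₂ t₀ t = (c₁ - c₂) ^ 2 *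
      midE (c₁ - c₂) (c₁ + c₂) (-(c₁ * c₂)) (expQ c₁ c₂ t₀ t) (gap c₁ c₂ t₀ t) +
      -(c₁ * c₂) * gap c₁ c₂ t₀ t ^ 2 := by
  rw [peakS_eq h, midE]
  field_simp
  ring

lemma q₁_le_q₂ (hc₁ : 0 < c₁) (hc₂ : c₂ < 0) (t : ℝ) : q₁ c₁ c₂ t₀ t ≤ q₂ c₁ c₂ t₀ t := by
  have hL : 0 < c₁ - c₂ := by linarith
  have hK : 0 < -(c₁ * c₂) := by nlinarith
  have h1 : 1 ≤ expQ (-c₂) (-c₁) t₀ t * expQ c₁ c₂ t₀ t := by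
    have := midE_pos (t₀ := t₀) hL.ne' t
    rw [expQ_neg_eq hL.ne', div_mul_eq_mul_div, le_div_iff₀ (by positivity), one_mul]
    have h2 := expQ_mul_expQ_neg (t₀ := t₀) hL.ne' t
    have h3 : 0 ≤ -(c₁ * c₂) * gap c₁ c₂ t₀ t ^ 2 := by positivity
    refine le_of_mul_le_mul_left ?_ hL
    nlinarith
  rw [← exp_q₂ hc₁ hc₂, ← exp_neg_q₁ hc₁ hc₂, ← Real.exp_add, Real.one_le_exp_iff] at h1
  linarith

/-! ### Labels between the peaks -/

noncomputable def midDen (c₁ c₂ t₀ t ξ : ℝ) : ℝ :=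
  -(c₁ * c₂) * gap c₁ c₂ t₀ 0 ^ 2 +
    (c₁ - c₂) * (peakS c₁ c₂ t₀ t - peakS c₁ c₂ t₀ 0) * (expQ c₁ c₂ t₀ 0 - Real.exp ξ)

/-- For r_t = L D r² the reciprocal 1/r is integrated by means of `peakS`, starting from r =
(e^{q₂(0)} - e^ξ)/D(0)², which encodes y = ξ at time 0. Clearing denominators through `midDen` keeps
the right peak's label, where r = 0. -/
noncomputable def midRho (c₁ c₂ t₀ t ξ : ℝ) : ℝ :=
  -(c₁ * c₂) * (expQ c₁ c₂ t₀ 0 - Real.exp ξ) / midDen c₁ c₂ t₀ t ξ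

/-- Minus the label derivative of `midRho`. -/
noncomputable def midSigma (c₁ c₂ t₀ t ξ : ℝ) : ℝ :=
  (-(c₁ * c₂)) ^ 2 * gap c₁ c₂ t₀ 0 ^ 2 * Real.exp ξ / midDen c₁ c₂ t₀ t ξ ^ 2

lemma continuous_midDen : Continuous fun x : ℝ × ℝ => midDen c₁ c₂ t₀ x.1 x.2 := by
  have := continuous_peakS (c₁ := c₁) (c₂ := c₂) (t₀ := t₀)
  unfold midDen
  fun_prop

lemma hasDerivAt_midRho_label {t ξ : ℝ} (hM : midDen c₁ c₂ t₀ t ξ ≠ 0) :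
    HasDerivAt (midRho c₁ c₂ t₀ t) (-midSigma c₁ c₂ t₀ t ξ) ξ := by
  have hg : HasDerivAt (fun ξ => expQ c₁ c₂ t₀ 0 - Real.exp ξ) (-Real.exp ξ) ξ :=
    (Real.hasDerivAt_exp ξ).const_sub _
  have hd : HasDerivAt (midDen c₁ c₂ t₀ t)
      ((c₁ - c₂) * (peakS c₁ c₂ t₀ t - peakS c₁ c₂ t₀ 0) * -Real.exp ξ) ξ :=
    (hg.const_mul _).const_add _
  refine ((hg.const_mul _).div hd hM).congr_deriv ?_
  unfold midSigma
  rw [← neg_div]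
  congr 1
  unfold midDen
  ring

lemma hasDerivAt_midDen (t ξ : ℝ) :
    HasDerivAt (fun t => midDen c₁ c₂ t₀ t ξ)
      ((c₁ - c₂) * (-(-(c₁ * c₂) * gap c₁ c₂ t₀ t)) * (expQ c₁ c₂ t₀ 0 - Real.exp ξ)) t := by
  have hS : HasDerivAt (peakS c₁ c₂ t₀) (-(-(c₁ * c₂) * gap c₁ c₂ t₀ t)) t := by
    refine (((hasDerivAt_exp_mul_sub c₂ t₀ t).const_mul c₁).sub
      ((hasDerivAt_exp_mul_sub c₁ t₀ t).const_mul c₂)).congr_deriv ?_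
    unfold gap; ring
  exact (((hS.sub_const _).const_mul _).mul_const _).const_add _

lemma hasDerivAt_midRho_time {t ξ : ℝ} (hM : midDen c₁ c₂ t₀ t ξ ≠ 0) :
    HasDerivAt (fun t => midRho c₁ c₂ t₀ t ξ)
      ((c₁ - c₂) * gap c₁ c₂ t₀ t * midRho c₁ c₂ t₀ t ξ ^ 2) t := by
  refine ((hasDerivAt_const t _).div (hasDerivAt_midDen t ξ) hM).congr_deriv ?_
  unfold midRho
  field_simp
  ring

lemma hasDerivAt_midSigma_time {t ξ : ℝ} (hM : midDen c₁ c₂ t₀ t ξ ≠ 0) :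
    HasDerivAt (fun t => midSigma c₁ c₂ t₀ t ξ)
      (2 * (c₁ - c₂) * gap c₁ c₂ t₀ t * midRho c₁ c₂ t₀ t ξ * midSigma c₁ c₂ t₀ t ξ) t := by
  refine ((hasDerivAt_const t _).div ((hasDerivAt_midDen t ξ).pow 2)
    (pow_ne_zero 2 hM)).congr_deriv ?_
  simp only [midRho, midSigma, Pi.pow_apply, Nat.reduceSub, pow_one]
  field_simp
  ring

lemma gap_sq_eq (hc₁ : 0 < c₁) (hc₂ : c₂ < 0) (t : ℝ) :
    -(c₁ * c₂) * gap c₁ c₂ t₀ t ^ 2 = (c₁ - c₂) * peakS c₁ c₂ t₀ t *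
      (expQ c₁ c₂ t₀ t - Real.exp (q₁ c₁ c₂ t₀ t)) := by
  have hL : c₁ - c₂ ≠ 0 := by linarith
  have h1 := exp_neg_q₁ (t₀ := t₀) hc₁ hc₂ t
  have hE := (midE_pos (t₀ := t₀) hL t).ne'
  have hS := (peakS_pos (t₀ := t₀) hc₁ hc₂ t).ne'
  rw [Real.exp_neg, inv_eq_iff_eq_inv, expQ_neg_eq hL, inv_div] at h1
  rw [h1, mul_sub, mul_assoc (c₁ - c₂) (peakS _ _ _ _) (_ / _), mul_div_cancel₀ _ hS]
  linarith [expQ_mul_expQ_neg (t₀ := t₀) hL t]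

end Peaks

/-! ### Positivity between the peaks, matching, and the explicit solution -/

section Region

variable {c₁ c₂ t₀ t ξ : ℝ}

lemma label_bounds (hc₁ : 0 < c₁) (hc₂ : c₂ < 0)
    (hξ : ξ ∈ Set.Icc (q₁ c₁ c₂ t₀ 0) (q₂ c₁ c₂ t₀ 0)) :
    Real.exp (q₁ c₁ c₂ t₀ 0) ≤ Real.exp ξ ∧ Real.exp ξ ≤ expQ c₁ c₂ t₀ 0 := by
  rw [← exp_q₂ hc₁ hc₂]
  exact ⟨Real.exp_le_exp.2 hξ.1, Real.exp_le_exp.2 hξ.2⟩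

/-- By `gap_sq_eq` the term K D(0)² equals L S(0)(e^{q₂(0)} - e^{q₁(0)}). The contributions of S(0)
= `peakS` at time 0 then add up to a multiple of e^ξ - e^{q₁(0)} ≥ 0. -/
lemma midDen_ge (hc₁ : 0 < c₁) (hc₂ : c₂ < 0)
    (hξ : ξ ∈ Set.Icc (q₁ c₁ c₂ t₀ 0) (q₂ c₁ c₂ t₀ 0)) :
    (c₁ - c₂) * peakS c₁ c₂ t₀ t * (expQ c₁ c₂ t₀ 0 - Real.exp ξ) ≤ midDen c₁ c₂ t₀ t ξ := by
  have hL : 0 < c₁ - c₂ := by linarith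
  have h1 := (label_bounds hc₁ hc₂ hξ).1
  have h2 : 0 ≤ (c₁ - c₂) * peakS c₁ c₂ t₀ 0 * (Real.exp ξ - Real.exp (q₁ c₁ c₂ t₀ 0)) :=
    mul_nonneg (mul_pos hL (peakS_pos hc₁ hc₂ 0)).le (sub_nonneg.2 h1)
  rw [midDen, gap_sq_eq hc₁ hc₂]
  linarith

lemma midDen_pos (hc₁ : 0 < c₁) (hc₂ : c₂ < 0) (ht₀ : 0 < t₀)
    (hξ : ξ ∈ Set.Icc (q₁ c₁ c₂ t₀ 0) (q₂ c₁ c₂ t₀ 0)) : 0 < midDen c₁ c₂ t₀ t ξ := by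
  have hL : 0 < c₁ - c₂ := by linarith
  have hK : 0 < -(c₁ * c₂) := by nlinarith
  have h2 := (label_bounds hc₁ hc₂ hξ).2
  have hS := peakS_pos (t₀ := t₀) hc₁ hc₂ t
  rcases h2.lt_or_eq with h | h
  · exact (mul_pos (mul_pos hL hS) (sub_pos.2 h)).trans_le (midDen_ge hc₁ hc₂ hξ)
  · rw [midDen, h, sub_self, mul_zero, add_zero]
    have := gap_pos (c₂ := c₂) (c₁ := c₁) (by linarith) ht₀
    positivity

lemma midRho_le (hc₁ : 0 < c₁) (hc₂ : c₂ < 0) (ht₀ : 0 < t₀)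
    (hξ : ξ ∈ Set.Icc (q₁ c₁ c₂ t₀ 0) (q₂ c₁ c₂ t₀ 0)) :
    midRho c₁ c₂ t₀ t ξ ≤ -(c₁ * c₂) / ((c₁ - c₂) * peakS c₁ c₂ t₀ t) := by
  have hL : 0 < c₁ - c₂ := by linarith
  have hK : 0 < -(c₁ * c₂) := by nlinarith
  have hS := peakS_pos (t₀ := t₀) hc₁ hc₂ t
  rw [midRho, div_le_div_iff₀ (midDen_pos hc₁ hc₂ ht₀ hξ) (by positivity), mul_assoc]
  refine mul_le_mul_of_nonneg_left ?_ hK.le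
  linarith [midDen_ge (t := t) hc₁ hc₂ hξ]

lemma midRho_q₁ (hc₁ : 0 < c₁) (hc₂ : c₂ < 0) (ht₀ : 0 < t₀) :
    midRho c₁ c₂ t₀ t (q₁ c₁ c₂ t₀ 0) = -(c₁ * c₂) / ((c₁ - c₂) * peakS c₁ c₂ t₀ t) := by
  have hL : 0 < c₁ - c₂ := by linarith
  have hK : 0 < -(c₁ * c₂) := by nlinarith
  have hS := (peakS_pos (t₀ := t₀) hc₁ hc₂ t).ne'
  have hM := (midDen_pos (t := t) hc₁ hc₂ ht₀ (Set.left_mem_Icc.2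
    (q₁_le_q₂ (t₀ := t₀) hc₁ hc₂ 0))).ne'
  rw [midRho, div_eq_div_iff hM (by positivity), mul_assoc]
  congr 1
  rw [midDen, gap_sq_eq hc₁ hc₂]
  ring

lemma midRho_q₂ (hc₁ : 0 < c₁) (hc₂ : c₂ < 0) :
    midRho c₁ c₂ t₀ t (q₂ c₁ c₂ t₀ 0) = 0 := by
  rw [midRho, exp_q₂ hc₁ hc₂, sub_self, mul_zero, zero_div]

lemma midSigma_pos (hc₁ : 0 < c₁) (hc₂ : c₂ < 0) (ht₀ : 0 < t₀)
    (hξ : ξ ∈ Set.Icc (q₁ c₁ c₂ t₀ 0) (q₂ c₁ c₂ t₀ 0)) : 0 < midSigma c₁ c₂ t₀ t ξ := by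
  have hK : 0 < -(c₁ * c₂) := by nlinarith
  have := gap_pos (c₂ := c₂) (c₁ := c₁) (by linarith) ht₀
  have := midDen_pos (t := t) hc₁ hc₂ ht₀ hξ
  unfold midSigma
  positivity

/-- `midRho` is at most its value at the left peak's label, for which e^y = e^{q₁(t)}:
characteristics never cross the left peak, so e^y ≥ e^{q₁(t)} > 0. -/
lemma midW_pos (hc₁ : 0 < c₁) (hc₂ : c₂ < 0) (ht₀ : 0 < t₀)
    (hξ : ξ ∈ Set.Icc (q₁ c₁ c₂ t₀ 0) (q₂ c₁ c₂ t₀ 0)) :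
    0 < midW (expQ c₁ c₂ t₀ t) (gap c₁ c₂ t₀ t) (midRho c₁ c₂ t₀ t ξ) := by
  have hL : 0 < c₁ - c₂ := by linarith
  have hS := peakS_pos (t₀ := t₀) hc₁ hc₂ t
  have h1 : gap c₁ c₂ t₀ t ^ 2 * midRho c₁ c₂ t₀ t ξ ≤
      gap c₁ c₂ t₀ t ^ 2 * (-(c₁ * c₂) / ((c₁ - c₂) * peakS c₁ c₂ t₀ t)) :=
    mul_le_mul_of_nonneg_left (midRho_le hc₁ hc₂ ht₀ hξ) (sq_nonneg _)
  have h2 : gap c₁ c₂ t₀ t ^ 2 * (-(c₁ * c₂) / ((c₁ - c₂) * peakS c₁ c₂ t₀ t)) =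
      expQ c₁ c₂ t₀ t - Real.exp (q₁ c₁ c₂ t₀ t) := by
    rw [mul_div_assoc', div_eq_iff (by positivity), mul_comm (gap c₁ c₂ t₀ t ^ 2),
      gap_sq_eq hc₁ hc₂]
    ring
  unfold midW
  linarith [Real.exp_pos (q₁ c₁ c₂ t₀ t)]

/-! ### Matching at the peaks -/

section Matching

variable {L c K b D S E : ℝ}

/-- K/(LS) is the value of `midRho` at the left peak's label. The right-hand sides are the `outer`
formulas with φ = e^{-q₁} and its derivatives in the form of `expQ_neg_eq`, `expQ₁_neg_eq` and
`expQ₂_neg_eq`. -/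
lemma mid_match_left (hL : L ≠ 0) (hS : S ≠ 0) (hE : E ≠ 0) (hS' : S = L * b + c * D)
    (hE' : midE L c K b D = E) :
    midW b D (K / (L * S)) = (S / (L * E))⁻¹ ∧
    midN L c K b D (K / (L * S)) / midW b D (K / (L * S)) =
      -1 * (-(K * D + c * S) / (L * E)) / (S / (L * E)) ∧
    midP L c K b D (K / (L * S)) =
      (K * (L * b) + 2 * c * K * D + c ^ 2 * S) / (L * E) / (S / (L * E)) -
        (-(K * D + c * S) / (L * E)) ^ 2 / (S / (L * E)) ^ 2 / 2 ∧
    midQ L c K b D (K / (L * S)) =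
      -1 * ((-(K * D + c * S) / (L * E)) ^ 2 / (S / (L * E)) ^ 2 -
        (K * (L * b) + 2 * c * K * D + c ^ 2 * S) / (L * E) / (S / (L * E))) := by
  have hE2 : E = b ^ 2 + c * b * D / L - K * D ^ 2 / L ^ 2 := by rw [← hE', midE]
  have hw : midW b D (K / (L * S)) = (S / (L * E))⁻¹ := by
    rw [midW]
    field_simp
    rw [hE2, hS']
    field_simp
  have hw0 : (S / (L * E))⁻¹ ≠ 0 := by positivity
  have hN : midN L c K b D (K / (L * S)) / midW b D (K / (L * S)) =
      -1 * (-(K * D + c * S) / (L * E)) / (S / (L * E)) := by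
    rw [hw, midN]
    field_simp
    rw [hE2, hS']
    field_simp
    ring
  refine ⟨hw, hN, ?_, ?_⟩
  · rw [midP, hN, hw, midA, hw, hE']
    field_simp
    rw [hE2, hS']
    field_simp
    ring
  · rw [midQ, hN, hw, midA, hw, hE']
    field_simp
    rw [hE2, hS']
    field_simp
    ring

/-- At the right peak's label `midRho` is 0, and φ = e^{q₂} = b. -/
lemma mid_match_right {b₁ b₂ : ℝ} (hL : L ≠ 0) (hb : b ≠ 0) (h1 : b₁ = c * b - K * D / L)
    (h2 : b₂ = c * b₁ + K * b) :
    midW b D 0 = b ∧ midN L c K b D 0 / midW b D 0 = 1 * b₁ / b ∧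
    midP L c K b D 0 = b₂ / b - b₁ ^ 2 / b ^ 2 / 2 ∧
    midQ L c K b D 0 = 1 * (b₁ ^ 2 / b ^ 2 - b₂ / b) := by
  have hw : midW b D 0 = b := by simp [midW]
  have hN : midN L c K b D 0 = b₁ := by rw [h1, midN]; ring
  refine ⟨hw, by rw [hN, hw, one_mul], ?_, ?_⟩
  · rw [midP, hN, hw, midA, hw, midE, h2, h1]
    field_simp
    ring
  · rw [midQ, hN, hw, midA, hw, midE, h2, h1]
    field_simp
    ring

end Matching

lemma outerV_left_q₁ (hc₁ : 0 < c₁) (hc₂ : c₂ < 0) (φ : ℝ) :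
    outerV (-1) (expQ (-c₂) (-c₁) t₀ 0) φ (q₁ c₁ c₂ t₀ 0) = φ := by
  rw [outerV, neg_one_mul, exp_neg_q₁ hc₁ hc₂]; ring

lemma outerV_right_q₂ (hc₁ : 0 < c₁) (hc₂ : c₂ < 0) (φ : ℝ) :
    outerV 1 (expQ c₁ c₂ t₀ 0) φ (q₂ c₁ c₂ t₀ 0) = φ := by
  rw [outerV, one_mul, exp_q₂ hc₁ hc₂]; ring

lemma outerV_left_pos (hc₁ : 0 < c₁) (hc₂ : c₂ < 0) {φ : ℝ} (hφ : 0 < φ)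
    (hξ : ξ ≤ q₁ c₁ c₂ t₀ 0) : 0 < outerV (-1) (expQ (-c₂) (-c₁) t₀ 0) φ ξ := by
  rw [outerV, neg_one_mul, ← exp_neg_q₁ hc₁ hc₂]
  have := Real.exp_le_exp.2 (neg_le_neg hξ)
  linarith

lemma outerV_right_pos (hc₁ : 0 < c₁) (hc₂ : c₂ < 0) {φ : ℝ} (hφ : 0 < φ)
    (hξ : q₂ c₁ c₂ t₀ 0 ≤ ξ) : 0 < outerV 1 (expQ c₁ c₂ t₀ 0) φ ξ := by
  rw [outerV, one_mul, ← exp_q₂ hc₁ hc₂]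
  have := Real.exp_le_exp.2 hξ
  linarith

/-! ### The solution before wave breaking -/

noncomputable def leftBefore (c₁ c₂ t₀ t : ℝ) : LagVar :=
  outer (-1) (expQ (-c₂) (-c₁) t₀ 0) (expQ (-c₂) (-c₁) t₀ t) (expQ₁ (-c₂) (-c₁) t₀ t)

noncomputable def leftBeforeP (c₁ c₂ t₀ t : ℝ) : ℝ → ℝ :=
  outerP (-1) (expQ (-c₂) (-c₁) t₀ 0) (expQ (-c₂) (-c₁) t₀ t) (expQ₁ (-c₂) (-c₁) t₀ t)
    (expQ₂ (-c₂) (-c₁) t₀ t)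

noncomputable def leftBeforeQ (c₁ c₂ t₀ t : ℝ) : ℝ → ℝ :=
  outerQ (-1) (expQ (-c₂) (-c₁) t₀ 0) (expQ (-c₂) (-c₁) t₀ t) (expQ₁ (-c₂) (-c₁) t₀ t)
    (expQ₂ (-c₂) (-c₁) t₀ t)

noncomputable def rightBefore (c₁ c₂ t₀ t : ℝ) : LagVar :=
  outer 1 (expQ c₁ c₂ t₀ 0) (expQ c₁ c₂ t₀ t) (expQ₁ c₁ c₂ t₀ t)

noncomputable def rightBeforeP (c₁ c₂ t₀ t : ℝ) : ℝ → ℝ :=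
  outerP 1 (expQ c₁ c₂ t₀ 0) (expQ c₁ c₂ t₀ t) (expQ₁ c₁ c₂ t₀ t) (expQ₂ c₁ c₂ t₀ t)

noncomputable def rightBeforeQ (c₁ c₂ t₀ t : ℝ) : ℝ → ℝ :=
  outerQ 1 (expQ c₁ c₂ t₀ 0) (expQ c₁ c₂ t₀ t) (expQ₁ c₁ c₂ t₀ t) (expQ₂ c₁ c₂ t₀ t)

noncomputable def midBefore (c₁ c₂ t₀ t : ℝ) : LagVar :=
  mid (c₁ - c₂) (c₁ + c₂) (-(c₁ * c₂)) (expQ c₁ c₂ t₀ t) (gap c₁ c₂ t₀ t) (midRho c₁ c₂ t₀ t)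
    (midSigma c₁ c₂ t₀ t)

noncomputable def midBeforeP (c₁ c₂ t₀ t ξ : ℝ) : ℝ :=
  midP (c₁ - c₂) (c₁ + c₂) (-(c₁ * c₂)) (expQ c₁ c₂ t₀ t) (gap c₁ c₂ t₀ t) (midRho c₁ c₂ t₀ t ξ)

noncomputable def midBeforeQ (c₁ c₂ t₀ t ξ : ℝ) : ℝ :=
  midQ (c₁ - c₂) (c₁ + c₂) (-(c₁ * c₂)) (expQ c₁ c₂ t₀ t) (gap c₁ c₂ t₀ t) (midRho c₁ c₂ t₀ t ξ)

noncomputable def before (c₁ c₂ t₀ t : ℝ) : LagVar :=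
  LagVar.glue (q₁ c₁ c₂ t₀ 0) (q₂ c₁ c₂ t₀ 0) (leftBefore c₁ c₂ t₀ t) (midBefore c₁ c₂ t₀ t)
    (rightBefore c₁ c₂ t₀ t)

noncomputable def beforeP (c₁ c₂ t₀ t : ℝ) : ℝ → ℝ :=
  glue (q₁ c₁ c₂ t₀ 0) (q₂ c₁ c₂ t₀ 0) (leftBeforeP c₁ c₂ t₀ t) (midBeforeP c₁ c₂ t₀ t)
    (rightBeforeP c₁ c₂ t₀ t)

noncomputable def beforeQ (c₁ c₂ t₀ t : ℝ) : ℝ → ℝ :=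
  glue (q₁ c₁ c₂ t₀ 0) (q₂ c₁ c₂ t₀ 0) (leftBeforeQ c₁ c₂ t₀ t) (midBeforeQ c₁ c₂ t₀ t)
    (rightBeforeQ c₁ c₂ t₀ t)

/-! ### The solution after wave breaking -/

/-- At t₀ the function e^{-q₁} has value 1 and derivative -(c₁ + c₂), exactly as e^{-(c₁+c₂)(t-t₀)}.
The outer variables involve only φ and φ₁, hence are continuous across t₀; only φ₂, that is P and Q,
jumps. -/
noncomputable def leftAfter (c₁ c₂ t₀ t : ℝ) : LagVar :=
  outer (-1) (expQ (-c₂) (-c₁) t₀ 0) (Real.exp (-(c₁ + c₂) * (t - t₀)))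
    (-(c₁ + c₂) * Real.exp (-(c₁ + c₂) * (t - t₀)))

noncomputable def leftAfterP (c₁ c₂ t₀ t : ℝ) : ℝ → ℝ :=
  outerP (-1) (expQ (-c₂) (-c₁) t₀ 0) (Real.exp (-(c₁ + c₂) * (t - t₀)))
    (-(c₁ + c₂) * Real.exp (-(c₁ + c₂) * (t - t₀)))
    (-(c₁ + c₂) * (-(c₁ + c₂) * Real.exp (-(c₁ + c₂) * (t - t₀))))

noncomputable def leftAfterQ (c₁ c₂ t₀ t : ℝ) : ℝ → ℝ :=
  outerQ (-1) (expQ (-c₂) (-c₁) t₀ 0) (Real.exp (-(c₁ + c₂) * (t - t₀)))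
    (-(c₁ + c₂) * Real.exp (-(c₁ + c₂) * (t - t₀)))
    (-(c₁ + c₂) * (-(c₁ + c₂) * Real.exp (-(c₁ + c₂) * (t - t₀))))

noncomputable def rightAfter (c₁ c₂ t₀ t : ℝ) : LagVar :=
  outer 1 (expQ c₁ c₂ t₀ 0) (Real.exp ((c₁ + c₂) * (t - t₀)))
    ((c₁ + c₂) * Real.exp ((c₁ + c₂) * (t - t₀)))

noncomputable def rightAfterP (c₁ c₂ t₀ t : ℝ) : ℝ → ℝ :=
  outerP 1 (expQ c₁ c₂ t₀ 0) (Real.exp ((c₁ + c₂) * (t - t₀)))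
    ((c₁ + c₂) * Real.exp ((c₁ + c₂) * (t - t₀)))
    ((c₁ + c₂) * ((c₁ + c₂) * Real.exp ((c₁ + c₂) * (t - t₀))))

noncomputable def rightAfterQ (c₁ c₂ t₀ t : ℝ) : ℝ → ℝ :=
  outerQ 1 (expQ c₁ c₂ t₀ 0) (Real.exp ((c₁ + c₂) * (t - t₀)))
    ((c₁ + c₂) * Real.exp ((c₁ + c₂) * (t - t₀)))
    ((c₁ + c₂) * ((c₁ + c₂) * Real.exp ((c₁ + c₂) * (t - t₀))))

noncomputable def after (c₁ c₂ t₀ t : ℝ) : LagVar :=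
  LagVar.glue (q₁ c₁ c₂ t₀ 0) (q₂ c₁ c₂ t₀ 0) (leftAfter c₁ c₂ t₀ t)
    (midAfter (c₁ + c₂) ((c₁ + c₂) * (t - t₀)) (midBefore c₁ c₂ t₀ t₀).h) (rightAfter c₁ c₂ t₀ t)

noncomputable def afterP (c₁ c₂ t₀ t : ℝ) : ℝ → ℝ :=
  glue (q₁ c₁ c₂ t₀ 0) (q₂ c₁ c₂ t₀ 0) (leftAfterP c₁ c₂ t₀ t) (fun _ => (c₁ + c₂) ^ 2 / 2)
    (rightAfterP c₁ c₂ t₀ t)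

noncomputable def afterQ (c₁ c₂ t₀ t : ℝ) : ℝ → ℝ :=
  glue (q₁ c₁ c₂ t₀ 0) (q₂ c₁ c₂ t₀ 0) (leftAfterQ c₁ c₂ t₀ t) (fun _ => 0)
    (rightAfterQ c₁ c₂ t₀ t)

/-- The fully dissipative solution with peakon-antipeakon initial data. -/
noncomputable def solution (c₁ c₂ t₀ t : ℝ) : LagVar :=
  if t < t₀ then before c₁ c₂ t₀ t else after c₁ c₂ t₀ t

end Region

/-! ### Bounds, matching and equations for the explicit formulas -/

section Existence

lemma exists_pos_le_of_continuousOn {X : Type*} [TopologicalSpace X] {s : Set X} {f : X → ℝ}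
    (hs : IsCompact s) (hf : ContinuousOn f s) (hpos : ∀ x ∈ s, 0 < f x) :
    ∃ ε, 0 < ε ∧ ∀ x ∈ s, ε ≤ f x := by
  rcases s.eq_empty_or_nonempty with rfl | hne
  · exact ⟨1, one_pos, fun x hx => absurd hx (Set.notMem_empty x)⟩
  · obtain ⟨x, hx, hmin⟩ := hs.exists_isMinOn hne hf
    exact ⟨f x, hpos x hx, fun y hy => hmin hy⟩

/-- On a compact set of labels the weight e^{-|ξ|} is bounded below, so boundedness is already
decay. Bounding the sum of all absolute values yields one constant for all of them. -/
lemma exists_decayAt_of_continuousOn {Θ : ℝ → LagVar} {p q : ℝ → ℝ → ℝ} {a b r₁ r₂ : ℝ}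
    (hy : ContinuousOn (fun x : ℝ × ℝ => (Θ x.1).y x.2) (Set.Icc a b ×ˢ Set.Icc r₁ r₂))
    (hU : ContinuousOn (fun x : ℝ × ℝ => (Θ x.1).U x.2) (Set.Icc a b ×ˢ Set.Icc r₁ r₂))
    (hyξ : ContinuousOn (fun x : ℝ × ℝ => (Θ x.1).yξ x.2) (Set.Icc a b ×ˢ Set.Icc r₁ r₂))
    (hUξ : ContinuousOn (fun x : ℝ × ℝ => (Θ x.1).Uξ x.2) (Set.Icc a b ×ˢ Set.Icc r₁ r₂))
    (hh : ContinuousOn (fun x : ℝ × ℝ => (Θ x.1).h x.2) (Set.Icc a b ×ˢ Set.Icc r₁ r₂))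
    (hp : ContinuousOn (fun x : ℝ × ℝ => p x.1 x.2) (Set.Icc a b ×ˢ Set.Icc r₁ r₂))
    (hq : ContinuousOn (fun x : ℝ × ℝ => q x.1 x.2) (Set.Icc a b ×ˢ Set.Icc r₁ r₂)) :
    ∃ C, ∀ t ∈ Set.Icc a b, ∀ ξ ∈ Set.Icc r₁ r₂, DecayAt (Θ t) (p t) (q t) C ξ := by
  have hk : IsCompact (Set.Icc a b ×ˢ Set.Icc r₁ r₂) := isCompact_Icc.prod isCompact_Icc
  have hc : ContinuousOn (fun x : ℝ × ℝ => x.2) (Set.Icc a b ×ˢ Set.Icc r₁ r₂) :=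
    continuous_snd.continuousOn
  have hsum : ContinuousOn (fun x : ℝ × ℝ => |(Θ x.1).y x.2 - x.2| + |(Θ x.1).U x.2| +
      |(Θ x.1).yξ x.2 - 1| + |(Θ x.1).Uξ x.2| + |(Θ x.1).h x.2| + |p x.1 x.2| + |q x.1 x.2|)
      (Set.Icc a b ×ˢ Set.Icc r₁ r₂) :=
    ((((((hy.sub hc).abs.add hU.abs).add (hyξ.sub continuousOn_const).abs).add hUξ.abs).add
      hh.abs).add hp.abs).add hq.abs
  obtain ⟨C, hC⟩ := hk.exists_bound_of_continuousOn hsum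
  set R := max |r₁| |r₂| with hR
  refine ⟨C * Real.exp R, fun t ht ξ hξ => ?_⟩
  have h1 := (le_abs_self _).trans (hC (t, ξ) ⟨ht, hξ⟩)
  dsimp only at h1
  have hξR : |ξ| ≤ R := abs_le_max_abs_abs hξ.1 hξ.2
  have n1 := abs_nonneg ((Θ t).y ξ - ξ)
  have n2 := abs_nonneg ((Θ t).U ξ)
  have n3 := abs_nonneg ((Θ t).yξ ξ - 1)
  have n4 := abs_nonneg ((Θ t).Uξ ξ)
  have n5 := abs_nonneg ((Θ t).h ξ)
  have n6 := abs_nonneg (p t ξ)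
  have n7 := abs_nonneg (q t ξ)
  have C0 : 0 ≤ C := by linarith
  have e1 : C ≤ C * Real.exp R * Real.exp (-|ξ|) := by
    rw [mul_assoc, ← Real.exp_add]
    exact le_mul_of_one_le_right C0 (Real.one_le_exp (by linarith))
  have e2 : C ≤ C * Real.exp R :=
    le_mul_of_one_le_right C0 (Real.one_le_exp ((abs_nonneg _).trans hξR))
  exact ⟨by linarith, by linarith, by linarith, by linarith, by linarith, by linarith, by linarith⟩

variable {c₁ c₂ t₀ : ℝ}

lemma exists_outer_bounds {a b : ℝ} {φ φ₁ φ₂ : ℝ → ℝ} (h0 : Continuous φ) (h1 : Continuous φ₁)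
    (h2 : Continuous φ₂) (hpos : ∀ t, 0 < φ t) :
    ∃ m M B, 0 < m ∧ ∀ t ∈ Set.Icc a b, m ≤ φ t ∧ φ t ≤ M ∧ |φ₁ t| ≤ B ∧ |φ₂ t| ≤ B := by
  obtain ⟨m, hm, hm'⟩ := exists_pos_le_of_continuousOn (isCompact_Icc (a := a) (b := b))
    h0.continuousOn fun t _ => hpos t
  obtain ⟨M, hM⟩ := (isCompact_Icc (a := a) (b := b)).exists_bound_of_continuousOn h0.continuousOn
  obtain ⟨B, hB⟩ := (isCompact_Icc (a := a) (b := b)).exists_bound_of_continuousOn h1.continuousOn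
  obtain ⟨B', hB'⟩ := (isCompact_Icc (a := a) (b := b)).exists_bound_of_continuousOn
    h2.continuousOn
  exact ⟨m, M, max B B', hm, fun t ht => ⟨hm' t ht, (le_abs_self _).trans (hM t ht),
    (hB t ht).trans (le_max_left _ _), (hB' t ht).trans (le_max_right _ _)⟩⟩

lemma exists_outer_decayAt {ε k a b : ℝ} {φ φ₁ φ₂ : ℝ → ℝ} (hε : |ε| = 1) (hk : 0 < k)
    (h0 : Continuous φ) (h1 : Continuous φ₁) (h2 : Continuous φ₂) (hpos : ∀ t, 0 < φ t) :
    ∃ C, ∀ t ∈ Set.Icc a b, ∀ ξ, k ≤ Real.exp (ε * ξ) →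
      DecayAt (outer ε k (φ t) (φ₁ t)) (outerP ε k (φ t) (φ₁ t) (φ₂ t))
        (outerQ ε k (φ t) (φ₁ t) (φ₂ t)) C ξ := by
  obtain ⟨m, M, B, hm, h⟩ := exists_outer_bounds (a := a) (b := b) h0 h1 h2 hpos
  obtain ⟨C, hC⟩ := outer_decayAt (M := M) (B := B) hε hk hm
  exact ⟨C, fun t ht ξ hξ => hC _ _ _ ξ (h t ht).1 (h t ht).2.1 (h t ht).2.2.1 (h t ht).2.2.2 hξ⟩

lemma exists_outer_yξ_lower {ε k a b : ℝ} {φ φ₁ : ℝ → ℝ} (hk : 0 < k)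
    (h0 : Continuous φ) (hpos : ∀ t, 0 < φ t) :
    ∃ δ, 0 < δ ∧ ∀ t ∈ Set.Icc a b, ∀ ξ, k ≤ Real.exp (ε * ξ) →
      δ ≤ (outer ε k (φ t) (φ₁ t)).yξ ξ := by
  obtain ⟨m, M, B, hm, h⟩ := exists_outer_bounds (a := a) (b := b) h0 h0 h0 hpos
  refine ⟨1 / (1 + |M| / k), by positivity, fun t ht ξ hξ => ?_⟩
  exact outer_yξ_lower hk hm (h t ht).1 ((h t ht).2.1.trans (le_abs_self M)) hξ

lemma left_label (hc₁ : 0 < c₁) (hc₂ : c₂ < 0) {ξ : ℝ} (hξ : ξ ≤ q₁ c₁ c₂ t₀ 0) :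
    expQ (-c₂) (-c₁) t₀ 0 ≤ Real.exp (-1 * ξ) := by
  rw [← exp_neg_q₁ hc₁ hc₂, neg_one_mul]
  exact Real.exp_le_exp.2 (neg_le_neg hξ)

lemma right_label (hc₁ : 0 < c₁) (hc₂ : c₂ < 0) {ξ : ℝ} (hξ : q₂ c₁ c₂ t₀ 0 ≤ ξ) :
    expQ c₁ c₂ t₀ 0 ≤ Real.exp (1 * ξ) := by
  rw [← exp_q₂ hc₁ hc₂, one_mul]
  exact Real.exp_le_exp.2 hξ

lemma expQ_neg_pos (hc₁ : 0 < c₁) (hc₂ : c₂ < 0) (t : ℝ) : 0 < expQ (-c₂) (-c₁) t₀ t :=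
  expQ_pos (neg_pos.2 hc₂) (neg_neg_of_pos hc₁) t

section MidContinuity

lemma continuousOn_midRho (hc₁ : 0 < c₁) (hc₂ : c₂ < 0) (ht₀ : 0 < t₀) (I : Set ℝ) :
    ContinuousOn (fun x : ℝ × ℝ => midRho c₁ c₂ t₀ x.1 x.2)
      (I ×ˢ Set.Icc (q₁ c₁ c₂ t₀ 0) (q₂ c₁ c₂ t₀ 0)) := by
  refine ContinuousOn.div ?_ continuous_midDen.continuousOn
    fun x hx => (midDen_pos hc₁ hc₂ ht₀ hx.2).ne'
  exact Continuous.continuousOn (by fun_prop)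

lemma continuousOn_midSigma (hc₁ : 0 < c₁) (hc₂ : c₂ < 0) (ht₀ : 0 < t₀) (I : Set ℝ) :
    ContinuousOn (fun x : ℝ × ℝ => midSigma c₁ c₂ t₀ x.1 x.2)
      (I ×ˢ Set.Icc (q₁ c₁ c₂ t₀ 0) (q₂ c₁ c₂ t₀ 0)) := by
  refine ContinuousOn.div ?_ (continuous_midDen.pow 2).continuousOn
    fun x hx => pow_ne_zero 2 (midDen_pos hc₁ hc₂ ht₀ hx.2).ne'
  exact Continuous.continuousOn (by fun_prop)

end MidContinuity

structure MidContinuousOn (c₁ c₂ t₀ : ℝ) (s : Set (ℝ × ℝ)) : Prop where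
  y : ContinuousOn (fun x : ℝ × ℝ => (midBefore c₁ c₂ t₀ x.1).y x.2) s
  U : ContinuousOn (fun x : ℝ × ℝ => (midBefore c₁ c₂ t₀ x.1).U x.2) s
  yξ : ContinuousOn (fun x : ℝ × ℝ => (midBefore c₁ c₂ t₀ x.1).yξ x.2) s
  Uξ : ContinuousOn (fun x : ℝ × ℝ => (midBefore c₁ c₂ t₀ x.1).Uξ x.2) s
  h : ContinuousOn (fun x : ℝ × ℝ => (midBefore c₁ c₂ t₀ x.1).h x.2) s
  p : ContinuousOn (fun x : ℝ × ℝ => midBeforeP c₁ c₂ t₀ x.1 x.2) s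
  q : ContinuousOn (fun x : ℝ × ℝ => midBeforeQ c₁ c₂ t₀ x.1 x.2) s

lemma midContinuousOn (hc₁ : 0 < c₁) (hc₂ : c₂ < 0) (ht₀ : 0 < t₀) (I : Set ℝ) :
    MidContinuousOn c₁ c₂ t₀ (I ×ˢ Set.Icc (q₁ c₁ c₂ t₀ 0) (q₂ c₁ c₂ t₀ 0)) := by
  have cr := continuousOn_midRho hc₁ hc₂ ht₀ I
  have cs := continuousOn_midSigma hc₁ hc₂ ht₀ I
  set s := I ×ˢ Set.Icc (q₁ c₁ c₂ t₀ 0) (q₂ c₁ c₂ t₀ 0)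
  have cb : ContinuousOn (fun x : ℝ × ℝ => expQ c₁ c₂ t₀ x.1) s :=
    (continuous_expQ.comp continuous_fst).continuousOn
  have cD : ContinuousOn (fun x : ℝ × ℝ => gap c₁ c₂ t₀ x.1) s :=
    (continuous_gap.comp continuous_fst).continuousOn
  have cW : ContinuousOn (fun x : ℝ × ℝ => midW (expQ c₁ c₂ t₀ x.1) (gap c₁ c₂ t₀ x.1)
      (midRho c₁ c₂ t₀ x.1 x.2)) s := by
    unfold midW; fun_prop
  have w0 : ∀ x ∈ s, midW (expQ c₁ c₂ t₀ x.1) (gap c₁ c₂ t₀ x.1)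
      (midRho c₁ c₂ t₀ x.1 x.2) ≠ 0 := fun x hx => (midW_pos hc₁ hc₂ ht₀ hx.2).ne'
  have cE : ContinuousOn (fun x : ℝ × ℝ => midE (c₁ - c₂) (c₁ + c₂) (-(c₁ * c₂))
      (expQ c₁ c₂ t₀ x.1) (gap c₁ c₂ t₀ x.1)) s := by
    unfold midE; fun_prop
  have cN : ContinuousOn (fun x : ℝ × ℝ => midN (c₁ - c₂) (c₁ + c₂) (-(c₁ * c₂))
      (expQ c₁ c₂ t₀ x.1) (gap c₁ c₂ t₀ x.1) (midRho c₁ c₂ t₀ x.1 x.2)) s := by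
    unfold midN; fun_prop
  have cA : ContinuousOn (fun x : ℝ × ℝ => midA (c₁ - c₂) (c₁ + c₂) (-(c₁ * c₂))
      (expQ c₁ c₂ t₀ x.1) (gap c₁ c₂ t₀ x.1) (midRho c₁ c₂ t₀ x.1 x.2)) s := by
    unfold midA; fun_prop
  have cU := cN.div cW w0
  have cZ := (cE.div cW w0).add cW
  have cAE := (cE.mul cA).div (cW.pow 2) fun x hx => pow_ne_zero 2 (w0 x hx)
  exact
  { y := cW.log w0
    U := cU
    yξ := ((cD.pow 2).mul cs).div cW w0
    Uξ := (continuousOn_const.mul ((cD.mul cs).mul cZ)).div cW w0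
    h := (continuousOn_const.mul (cs.mul (cZ.pow 2))).div cW w0
    p := (((cr.const_mul _).mul (cW.add (cE.div cW w0))).add ((cU.pow 2).div_const 2)).add cAE
    q := cAE.neg.sub (((cD.const_mul (c₁ - c₂)).mul cr).mul cU) }

/-! ### Before wave breaking -/

lemma before_match (hc₁ : 0 < c₁) (hc₂ : c₂ < 0) (ht₀ : 0 < t₀) (t : ℝ) :
    let r₁ := q₁ c₁ c₂ t₀ 0
    (leftBefore c₁ c₂ t₀ t).y r₁ = (midBefore c₁ c₂ t₀ t).y r₁ ∧
    (leftBefore c₁ c₂ t₀ t).U r₁ = (midBefore c₁ c₂ t₀ t).U r₁ ∧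
    leftBeforeP c₁ c₂ t₀ t r₁ = midBeforeP c₁ c₂ t₀ t r₁ ∧
    leftBeforeQ c₁ c₂ t₀ t r₁ = midBeforeQ c₁ c₂ t₀ t r₁ := by
  have hL : c₁ - c₂ ≠ 0 := by linarith
  obtain ⟨m1, m2, m3, m4⟩ := mid_match_left hL (peakS_pos (t₀ := t₀) hc₁ hc₂ t).ne'
    (midE_pos (t₀ := t₀) hL t).ne' (peakS_eq hL t) rfl
  rw [← midRho_q₁ hc₁ hc₂ ht₀, ← expQ_neg_eq hL] at m1 m2 m3 m4
  rw [← expQ₁_neg_eq hL] at m2 m3 m4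
  rw [← expQ₂_neg_eq hL] at m3 m4
  refine ⟨?_, ?_, ?_, ?_⟩
  · simp only [leftBefore, outer, midBefore, mid, outerV_left_q₁ hc₁ hc₂, m1, Real.log_inv,
      neg_one_mul]
  · simp only [leftBefore, outer, midBefore, mid, outerV_left_q₁ hc₁ hc₂, m2]
  · simp only [leftBeforeP, outerP, midBeforeP, outerV_left_q₁ hc₁ hc₂, m3]
  · simp only [leftBeforeQ, outerQ, midBeforeQ, outerV_left_q₁ hc₁ hc₂, m4]

lemma before_match' (hc₁ : 0 < c₁) (hc₂ : c₂ < 0) (t : ℝ) :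
    let r₂ := q₂ c₁ c₂ t₀ 0
    (midBefore c₁ c₂ t₀ t).y r₂ = (rightBefore c₁ c₂ t₀ t).y r₂ ∧
    (midBefore c₁ c₂ t₀ t).U r₂ = (rightBefore c₁ c₂ t₀ t).U r₂ ∧
    midBeforeP c₁ c₂ t₀ t r₂ = rightBeforeP c₁ c₂ t₀ t r₂ ∧
    midBeforeQ c₁ c₂ t₀ t r₂ = rightBeforeQ c₁ c₂ t₀ t r₂ := by
  have hL : c₁ - c₂ ≠ 0 := by linarith
  obtain ⟨m1, m2, m3, m4⟩ := mid_match_right hL (expQ_pos (t₀ := t₀) hc₁ hc₂ t).ne'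
    (expQ₁_eq hL t) (expQ₂_eq hL t)
  rw [← midRho_q₂ (t₀ := t₀) (t := t) hc₁ hc₂] at m1 m2 m3 m4
  refine ⟨?_, ?_, ?_, ?_⟩
  · simp only [rightBefore, outer, midBefore, mid, outerV_right_q₂ hc₁ hc₂, m1, one_mul]
  · simp only [rightBefore, outer, midBefore, mid, outerV_right_q₂ hc₁ hc₂, m2]
  · simp only [rightBeforeP, outerP, midBeforeP, outerV_right_q₂ hc₁ hc₂, m3]
  · simp only [rightBeforeQ, outerQ, midBeforeQ, outerV_right_q₂ hc₁ hc₂, m4]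

lemma midBefore_smoothAt (hc₁ : 0 < c₁) (hc₂ : c₂ < 0) (ht₀ : 0 < t₀) (t : ℝ) {ξ : ℝ}
    (hξ : ξ ∈ Set.Icc (q₁ c₁ c₂ t₀ 0) (q₂ c₁ c₂ t₀ 0)) :
    SmoothAt (midBefore c₁ c₂ t₀ t) (midBeforeP c₁ c₂ t₀ t) (midBeforeQ c₁ c₂ t₀ t) ξ := by
  have hM := (midDen_pos (t := t) hc₁ hc₂ ht₀ hξ).ne'
  refine mid_smoothAt (by linarith) (midW_pos hc₁ hc₂ ht₀ hξ) (hasDerivAt_midRho_label hM) ?_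
  refine ContinuousAt.div (by fun_prop) ?_ (pow_ne_zero 2 hM)
  exact ((continuous_midDen.comp (Continuous.prodMk_right t)).pow 2).continuousAt

lemma before_admissibleAt (hc₁ : 0 < c₁) (hc₂ : c₂ < 0) (ht₀ : 0 < t₀) (t ξ : ℝ) :
    AdmissibleAt (before c₁ c₂ t₀ t) ξ :=
  AdmissibleAt.glue (q₁_le_q₂ hc₁ hc₂ 0)
    (fun h => outer_admissibleAt (outerV_left_pos hc₁ hc₂ (expQ_neg_pos hc₁ hc₂ t) h.le))
    (fun h => mid_admissibleAt (midW_pos hc₁ hc₂ ht₀ h) (midSigma_pos hc₁ hc₂ ht₀ h).le)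
    (fun h => outer_admissibleAt (outerV_right_pos hc₁ hc₂ (expQ_pos hc₁ hc₂ t) h.le))

lemma exists_before_decayAt (hc₁ : 0 < c₁) (hc₂ : c₂ < 0) (ht₀ : 0 < t₀) (a b : ℝ) :
    ∃ C, ∀ t ∈ Set.Icc a b, ∀ ξ,
      DecayAt (before c₁ c₂ t₀ t) (beforeP c₁ c₂ t₀ t) (beforeQ c₁ c₂ t₀ t) C ξ := by
  obtain ⟨C₁, h1⟩ := exists_outer_decayAt (ε := -1) (a := a) (b := b) (by simp)
    (expQ_neg_pos (t₀ := t₀) hc₁ hc₂ 0) (continuous_expQ (t₀ := t₀)) continuous_expQ₁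
    continuous_expQ₂ (expQ_neg_pos hc₁ hc₂)
  obtain ⟨C₂, h2⟩ := exists_outer_decayAt (ε := 1) (a := a) (b := b) (by simp)
    (expQ_pos (t₀ := t₀) hc₁ hc₂ 0) (continuous_expQ (t₀ := t₀)) continuous_expQ₁
    continuous_expQ₂ (expQ_pos hc₁ hc₂)
  have cm := midContinuousOn hc₁ hc₂ ht₀ (Set.Icc a b)
  obtain ⟨C₃, h3⟩ := exists_decayAt_of_continuousOn cm.y cm.U cm.yξ cm.Uξ cm.h cm.p cm.q
  refine ⟨max (max C₁ C₂) C₃, fun t ht ξ => DecayAt.glue (q₁_le_q₂ hc₁ hc₂ 0) (fun h => ?_)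
    (fun h => ?_) (fun h => ?_)⟩
  · exact (h1 t ht ξ (left_label hc₁ hc₂ h.le)).mono
      ((le_max_left _ _).trans (le_max_left _ _))
  · exact (h3 t ht ξ h).mono (le_max_right _ _)
  · exact (h2 t ht ξ (right_label hc₁ hc₂ h.le)).mono
      ((le_max_right _ _).trans (le_max_left _ _))

/-- Strictness b < t₀ is essential: between the peaks y_ξ carries the factor `gap`², which vanishes
at t₀. -/
lemma exists_before_yξ_lower (hc₁ : 0 < c₁) (hc₂ : c₂ < 0) (ht₀ : 0 < t₀) {a b : ℝ}
    (hb : b < t₀) : ∃ δ, 0 < δ ∧ ∀ t ∈ Set.Icc a b, ∀ ξ, δ ≤ (before c₁ c₂ t₀ t).yξ ξ := by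
  have hq := q₁_le_q₂ (t₀ := t₀) hc₁ hc₂ 0
  obtain ⟨δ₁, p1, h1⟩ := exists_outer_yξ_lower (ε := -1) (φ₁ := expQ₁ (-c₂) (-c₁) t₀) (a := a)
    (b := b) (expQ_neg_pos (t₀ := t₀) hc₁ hc₂ 0) (continuous_expQ (t₀ := t₀))
    (expQ_neg_pos hc₁ hc₂)
  obtain ⟨δ₂, p2, h2⟩ := exists_outer_yξ_lower (ε := 1) (φ₁ := expQ₁ c₁ c₂ t₀) (a := a) (b := b)
    (expQ_pos (t₀ := t₀) hc₁ hc₂ 0) (continuous_expQ (t₀ := t₀)) (expQ_pos hc₁ hc₂)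
  obtain ⟨δ₃, p3, h3⟩ := exists_pos_le_of_continuousOn
    ((isCompact_Icc (a := a) (b := b)).prod (isCompact_Icc (a := q₁ c₁ c₂ t₀ 0)
      (b := q₂ c₁ c₂ t₀ 0))) (midContinuousOn hc₁ hc₂ ht₀ (Set.Icc a b)).yξ (fun x hx => by
      have g0 := gap_pos (c₂ := c₂) (c₁ := c₁) (by linarith) (hx.1.2.trans_lt hb)
      have s0 := midSigma_pos (t := x.1) hc₁ hc₂ ht₀ hx.2
      have w0 := midW_pos (t := x.1) hc₁ hc₂ ht₀ hx.2
      simp only [midBefore, mid]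
      positivity)
  refine ⟨min (min δ₁ δ₂) δ₃, lt_min (lt_min p1 p2) p3, fun t ht ξ => ?_⟩
  rcases lt_or_ge ξ (q₁ c₁ c₂ t₀ 0) with k1 | k1
  · simp only [before, LagVar.glue, glue_of_lt k1]
    exact ((min_le_left _ _).trans (min_le_left _ _)).trans
      (h1 t ht ξ (left_label hc₁ hc₂ k1.le))
  rcases le_or_gt ξ (q₂ c₁ c₂ t₀ 0) with k2 | k2
  · simp only [before, LagVar.glue, glue_of_mem (Set.mem_Icc.2 ⟨k1, k2⟩)]
    exact (min_le_right _ _).trans (h3 (t, ξ) ⟨ht, k1, k2⟩)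
  · simp only [before, LagVar.glue, glue_of_gt hq k2]
    exact ((min_le_left _ _).trans (min_le_right _ _)).trans
      (h2 t ht ξ (right_label hc₁ hc₂ k2.le))

lemma before_isProfile (hc₁ : 0 < c₁) (hc₂ : c₂ < 0) (ht₀ : 0 < t₀) {t : ℝ} (ht : t < t₀) :
    IsProfile (before c₁ c₂ t₀ t) (beforeP c₁ c₂ t₀ t) (beforeQ c₁ c₂ t₀ t)
      {q₁ c₁ c₂ t₀ 0, q₂ c₁ c₂ t₀ 0} := by
  obtain ⟨C, hC⟩ := exists_before_decayAt hc₁ hc₂ ht₀ t t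
  obtain ⟨δ, hδ, hδ'⟩ := exists_before_yξ_lower hc₁ hc₂ ht₀ (a := t) ht
  refine isProfile_glue (q₁_le_q₂ hc₁ hc₂ 0)
    (fun ξ h => outer_smoothAt (by norm_num)
      (outerV_left_pos hc₁ hc₂ (expQ_neg_pos hc₁ hc₂ t) h))
    (fun ξ h => midBefore_smoothAt hc₁ hc₂ ht₀ t h)
    (fun ξ h => outer_smoothAt (by norm_num)
      (outerV_right_pos hc₁ hc₂ (expQ_pos hc₁ hc₂ t) h))
    (before_match hc₁ hc₂ ht₀ t) (before_match' hc₁ hc₂ t)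
    (before_admissibleAt hc₁ hc₂ ht₀ t) (hC t ⟨le_rfl, le_rfl⟩) outer_left_tendsto hδ
    fun ξ => ?_
  have h1 := hδ' t ⟨le_rfl, le_rfl⟩ ξ
  have h2 := before_admissibleAt hc₁ hc₂ ht₀ t ξ
  have h3 := h2.hbar_nonneg.trans h2.hbar_le
  exact h1.trans (le_add_of_nonneg_right h3)

lemma before_timeODE (hc₁ : 0 < c₁) (hc₂ : c₂ < 0) (ht₀ : 0 < t₀) (I : Set ℝ) (ξ : ℝ) :
    TimeODE (before c₁ c₂ t₀) (beforeP c₁ c₂ t₀) (beforeQ c₁ c₂ t₀) I ξ := by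
  have hL : c₁ - c₂ ≠ 0 := by linarith
  refine TimeODE.glue (q₁_le_q₂ hc₁ hc₂ 0) (fun h => ?_) (fun h => ?_) (fun h => ?_)
  · exact outer_timeODE (by norm_num) hasDerivAt_expQ hasDerivAt_expQ₁ continuous_expQ₂
      fun t _ => outerV_left_pos hc₁ hc₂ (expQ_neg_pos hc₁ hc₂ t) h.le
  · refine mid_timeODE hL (fun t => ?_) (hasDerivAt_gap hL)
      (fun t _ => hasDerivAt_midRho_time (midDen_pos hc₁ hc₂ ht₀ h).ne')
      (fun t _ => hasDerivAt_midSigma_time (midDen_pos hc₁ hc₂ ht₀ h).ne')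
      fun t _ => midW_pos hc₁ hc₂ ht₀ h
    rw [← expQ₁_eq hL]
    exact hasDerivAt_expQ t
  · exact outer_timeODE (by norm_num) hasDerivAt_expQ hasDerivAt_expQ₁ continuous_expQ₂
      fun t _ => outerV_right_pos hc₁ hc₂ (expQ_pos hc₁ hc₂ t) h.le

/-! ### After wave breaking -/

lemma after_match (hc₁ : 0 < c₁) (hc₂ : c₂ < 0) (t : ℝ) (m : ℝ → ℝ) :
    let r₁ := q₁ c₁ c₂ t₀ 0
    let mid := midAfter (c₁ + c₂) ((c₁ + c₂) * (t - t₀)) m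
    (leftAfter c₁ c₂ t₀ t).y r₁ = mid.y r₁ ∧ (leftAfter c₁ c₂ t₀ t).U r₁ = mid.U r₁ ∧
    leftAfterP c₁ c₂ t₀ t r₁ = (c₁ + c₂) ^ 2 / 2 ∧ leftAfterQ c₁ c₂ t₀ t r₁ = 0 := by
  have h := (Real.exp_pos (-(c₁ + c₂) * (t - t₀))).ne'
  refine ⟨?_, ?_, ?_, ?_⟩
  · simp only [leftAfter, outer, midAfter, outerV_left_q₁ hc₁ hc₂, Real.log_exp]
    ring
  · simp only [leftAfter, outer, midAfter, outerV_left_q₁ hc₁ hc₂]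
    field_simp
  · simp only [leftAfterP, outerP, outerV_left_q₁ hc₁ hc₂]
    field_simp
    ring
  · simp only [leftAfterQ, outerQ, outerV_left_q₁ hc₁ hc₂]
    field_simp
    ring

lemma after_match' (hc₁ : 0 < c₁) (hc₂ : c₂ < 0) (t : ℝ) (m : ℝ → ℝ) :
    let r₂ := q₂ c₁ c₂ t₀ 0
    let mid := midAfter (c₁ + c₂) ((c₁ + c₂) * (t - t₀)) m
    mid.y r₂ = (rightAfter c₁ c₂ t₀ t).y r₂ ∧ mid.U r₂ = (rightAfter c₁ c₂ t₀ t).U r₂ ∧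
    (c₁ + c₂) ^ 2 / 2 = rightAfterP c₁ c₂ t₀ t r₂ ∧ 0 = rightAfterQ c₁ c₂ t₀ t r₂ := by
  have h := (Real.exp_pos ((c₁ + c₂) * (t - t₀))).ne'
  refine ⟨?_, ?_, ?_, ?_⟩
  · simp only [rightAfter, outer, midAfter, outerV_right_q₂ hc₁ hc₂, Real.log_exp]
    ring
  · simp only [rightAfter, outer, midAfter, outerV_right_q₂ hc₁ hc₂]
    field_simp
  · simp only [rightAfterP, outerP, outerV_right_q₂ hc₁ hc₂]
    field_simp
    ring
  · simp only [rightAfterQ, outerQ, outerV_right_q₂ hc₁ hc₂]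
    field_simp
    ring

lemma midBefore_h_pos (hc₁ : 0 < c₁) (hc₂ : c₂ < 0) (ht₀ : 0 < t₀) (t : ℝ) {ξ : ℝ}
    (hξ : ξ ∈ Set.Icc (q₁ c₁ c₂ t₀ 0) (q₂ c₁ c₂ t₀ 0)) : 0 < (midBefore c₁ c₂ t₀ t).h ξ := by
  have hL : 0 < c₁ - c₂ := by linarith
  have := midSigma_pos (t := t) hc₁ hc₂ ht₀ hξ
  have := midW_pos (t := t) hc₁ hc₂ ht₀ hξ
  have := midE_pos (t₀ := t₀) hL.ne' t
  simp only [midBefore, mid]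
  positivity

lemma after_admissibleAt (hc₁ : 0 < c₁) (hc₂ : c₂ < 0) (ht₀ : 0 < t₀) (t ξ : ℝ) :
    AdmissibleAt (after c₁ c₂ t₀ t) ξ :=
  AdmissibleAt.glue (q₁_le_q₂ hc₁ hc₂ 0)
    (fun h => outer_admissibleAt (outerV_left_pos hc₁ hc₂ (Real.exp_pos _) h.le))
    (fun h => midAfter_admissibleAt (midBefore_h_pos hc₁ hc₂ ht₀ t₀ h).le)
    (fun h => outer_admissibleAt (outerV_right_pos hc₁ hc₂ (Real.exp_pos _) h.le))

lemma exists_after_decayAt (hc₁ : 0 < c₁) (hc₂ : c₂ < 0) (ht₀ : 0 < t₀) (a b : ℝ) :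
    ∃ C, ∀ t ∈ Set.Icc a b, ∀ ξ,
      DecayAt (after c₁ c₂ t₀ t) (afterP c₁ c₂ t₀ t) (afterQ c₁ c₂ t₀ t) C ξ := by
  obtain ⟨C₁, h1⟩ := exists_outer_decayAt (ε := -1) (a := a) (b := b)
    (φ := fun t => Real.exp (-(c₁ + c₂) * (t - t₀)))
    (φ₁ := fun t => -(c₁ + c₂) * Real.exp (-(c₁ + c₂) * (t - t₀)))
    (φ₂ := fun t => -(c₁ + c₂) * (-(c₁ + c₂) * Real.exp (-(c₁ + c₂) * (t - t₀)))) (by simp)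
    (expQ_neg_pos (t₀ := t₀) hc₁ hc₂ 0) (by fun_prop) (by fun_prop) (by fun_prop)
    (fun t => Real.exp_pos _)
  obtain ⟨C₂, h2⟩ := exists_outer_decayAt (ε := 1) (a := a) (b := b)
    (φ := fun t => Real.exp ((c₁ + c₂) * (t - t₀)))
    (φ₁ := fun t => (c₁ + c₂) * Real.exp ((c₁ + c₂) * (t - t₀)))
    (φ₂ := fun t => (c₁ + c₂) * ((c₁ + c₂) * Real.exp ((c₁ + c₂) * (t - t₀)))) (by simp)
    (expQ_pos (t₀ := t₀) hc₁ hc₂ 0) (by fun_prop) (by fun_prop) (by fun_prop)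
    (fun t => Real.exp_pos _)
  have cm := (midContinuousOn hc₁ hc₂ ht₀ Set.univ).h
  obtain ⟨C₃, h3⟩ := exists_decayAt_of_continuousOn (a := a) (b := b)
    (r₁ := q₁ c₁ c₂ t₀ 0) (r₂ := q₂ c₁ c₂ t₀ 0)
    (Θ := fun t => midAfter (c₁ + c₂) ((c₁ + c₂) * (t - t₀)) (midBefore c₁ c₂ t₀ t₀).h)
    (p := fun _ _ => (c₁ + c₂) ^ 2 / 2) (q := fun _ _ => 0)
    (Continuous.continuousOn (by simp only [midAfter]; fun_prop)) continuousOn_const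
    continuousOn_const continuousOn_const
    (cm.comp (f := fun x : ℝ × ℝ => (t₀, x.2)) (by fun_prop) fun x hx => ⟨Set.mem_univ _, hx.2⟩)
    continuousOn_const continuousOn_const
  refine ⟨max (max C₁ C₂) C₃, fun t ht ξ => DecayAt.glue (q₁_le_q₂ hc₁ hc₂ 0) (fun h => ?_)
    (fun h => ?_) (fun h => ?_)⟩
  · exact (h1 t ht ξ (left_label hc₁ hc₂ h.le)).mono
      ((le_max_left _ _).trans (le_max_left _ _))
  · exact (h3 t ht ξ h).mono (le_max_right _ _)
  · exact (h2 t ht ξ (right_label hc₁ hc₂ h.le)).mono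
      ((le_max_right _ _).trans (le_max_left _ _))

lemma exists_after_yξ_lower (hc₁ : 0 < c₁) (hc₂ : c₂ < 0) (a b : ℝ) :
    ∃ δ, 0 < δ ∧ ∀ t ∈ Set.Icc a b, ∀ ξ ∉ Set.Icc (q₁ c₁ c₂ t₀ 0) (q₂ c₁ c₂ t₀ 0),
      δ ≤ (after c₁ c₂ t₀ t).yξ ξ := by
  have hq := q₁_le_q₂ (t₀ := t₀) hc₁ hc₂ 0
  obtain ⟨δ₁, p1, h1⟩ := exists_outer_yξ_lower (ε := -1) (a := a) (b := b)
    (φ := fun t => Real.exp (-(c₁ + c₂) * (t - t₀)))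
    (φ₁ := fun t => -(c₁ + c₂) * Real.exp (-(c₁ + c₂) * (t - t₀)))
    (expQ_neg_pos (t₀ := t₀) hc₁ hc₂ 0) (by fun_prop) (fun t => Real.exp_pos _)
  obtain ⟨δ₂, p2, h2⟩ := exists_outer_yξ_lower (ε := 1) (a := a) (b := b)
    (φ := fun t => Real.exp ((c₁ + c₂) * (t - t₀)))
    (φ₁ := fun t => (c₁ + c₂) * Real.exp ((c₁ + c₂) * (t - t₀)))
    (expQ_pos (t₀ := t₀) hc₁ hc₂ 0) (by fun_prop) (fun t => Real.exp_pos _)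
  refine ⟨min δ₁ δ₂, lt_min p1 p2, fun t ht ξ hξ => ?_⟩
  rcases lt_or_ge ξ (q₁ c₁ c₂ t₀ 0) with k1 | k1
  · simp only [after, LagVar.glue, glue_of_lt k1]
    exact (min_le_left _ _).trans (h1 t ht ξ (left_label hc₁ hc₂ k1.le))
  rcases le_or_gt ξ (q₂ c₁ c₂ t₀ 0) with k2 | k2
  · exact absurd ⟨k1, k2⟩ hξ
  · simp only [after, LagVar.glue, glue_of_gt hq k2]
    exact (min_le_right _ _).trans (h2 t ht ξ (right_label hc₁ hc₂ k2.le))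

lemma after_isProfile (hc₁ : 0 < c₁) (hc₂ : c₂ < 0) (ht₀ : 0 < t₀) (t : ℝ) :
    IsProfile (after c₁ c₂ t₀ t) (afterP c₁ c₂ t₀ t) (afterQ c₁ c₂ t₀ t)
      {q₁ c₁ c₂ t₀ 0, q₂ c₁ c₂ t₀ 0} := by
  obtain ⟨C, hC⟩ := exists_after_decayAt hc₁ hc₂ ht₀ t t
  obtain ⟨δ, hδ, hδ'⟩ := exists_after_yξ_lower (t₀ := t₀) hc₁ hc₂ t t
  have cm := (midContinuousOn hc₁ hc₂ ht₀ Set.univ).h.comp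
    (s := Set.Icc (q₁ c₁ c₂ t₀ 0) (q₂ c₁ c₂ t₀ 0)) (f := fun ξ : ℝ => (t₀, ξ)) (by fun_prop)
    fun x hx => ⟨Set.mem_univ _, hx⟩
  -- Between the peaks y_ξ = 0, so the lower bound on y_ξ + h has to come from the frozen energy h.
  obtain ⟨η, hη, hη'⟩ := exists_pos_le_of_continuousOn isCompact_Icc cm fun ξ hξ =>
    midBefore_h_pos hc₁ hc₂ ht₀ t₀ hξ
  refine isProfile_glue (δ := min δ η) (q₁_le_q₂ hc₁ hc₂ 0)
    (fun ξ h => outer_smoothAt (by norm_num) (outerV_left_pos hc₁ hc₂ (Real.exp_pos _) h))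
    (fun ξ h => midAfter_smoothAt (midBefore_smoothAt hc₁ hc₂ ht₀ t₀ h).cont_h)
    (fun ξ h => outer_smoothAt (by norm_num) (outerV_right_pos hc₁ hc₂ (Real.exp_pos _) h))
    (after_match hc₁ hc₂ t _) (after_match' hc₁ hc₂ t _)
    (after_admissibleAt hc₁ hc₂ ht₀ t) (hC t ⟨le_rfl, le_rfl⟩) outer_left_tendsto
    (lt_min hδ hη) fun ξ => ?_
  have h2 := after_admissibleAt hc₁ hc₂ ht₀ t ξ
  by_cases hξ : ξ ∈ Set.Icc (q₁ c₁ c₂ t₀ 0) (q₂ c₁ c₂ t₀ 0)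
  · have h3 : η ≤ (after c₁ c₂ t₀ t).h ξ := by
      simp only [after, LagVar.glue, glue_of_mem hξ]
      exact hη' ξ hξ
    exact (min_le_right _ _).trans (h3.trans (le_add_of_nonneg_left h2.yξ_nonneg))
  · exact (min_le_left _ _).trans ((hδ' t ⟨le_rfl, le_rfl⟩ ξ hξ).trans
      (le_add_of_nonneg_right (h2.hbar_nonneg.trans h2.hbar_le)))

lemma after_timeODE (hc₁ : 0 < c₁) (hc₂ : c₂ < 0) (I : Set ℝ) (ξ : ℝ) :
    TimeODE (after c₁ c₂ t₀) (afterP c₁ c₂ t₀) (afterQ c₁ c₂ t₀) I ξ := by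
  refine TimeODE.glue (q₁_le_q₂ hc₁ hc₂ 0) (fun h => ?_) (fun h => midAfter_timeODE) (fun h => ?_)
  · exact outer_timeODE (by norm_num) (hasDerivAt_exp_mul_sub _ t₀)
      (fun t => (hasDerivAt_exp_mul_sub _ t₀ t).const_mul _) (by fun_prop)
      fun t _ => outerV_left_pos hc₁ hc₂ (Real.exp_pos _) h.le
  · exact outer_timeODE (by norm_num) (hasDerivAt_exp_mul_sub _ t₀)
      (fun t => (hasDerivAt_exp_mul_sub _ t₀ t).const_mul _) (by fun_prop)
      fun t _ => outerV_right_pos hc₁ hc₂ (Real.exp_pos _) h.le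

end Existence

/-! ### The explicit family is a dissipative solution with the required data -/

section Solution

variable {c₁ c₂ t₀ : ℝ}

lemma before_hbar (ξ t : ℝ) : (before c₁ c₂ t₀ t).hbar ξ = (before c₁ c₂ t₀ t).h ξ := rfl

lemma leftBefore_self (h : c₁ - c₂ ≠ 0) : leftBefore c₁ c₂ t₀ t₀ = leftAfter c₁ c₂ t₀ t₀ := by
  have h' : -c₂ - -c₁ ≠ 0 := by intro k; apply h; linarith
  rw [leftBefore, leftAfter, expQ_self h', expQ₁_self h', sub_self, mul_zero, Real.exp_zero,
    mul_one, show -c₂ + -c₁ = -(c₁ + c₂) by ring]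

lemma rightBefore_self (h : c₁ - c₂ ≠ 0) : rightBefore c₁ c₂ t₀ t₀ = rightAfter c₁ c₂ t₀ t₀ := by
  rw [rightBefore, rightAfter, expQ_self h, expQ₁_self h, sub_self, mul_zero, Real.exp_zero,
    mul_one]

/-- h̄ is absent on purpose: between the peaks it drops from h to 0 at t₀. -/
lemma before_self (hc₁ : 0 < c₁) (hc₂ : c₂ < 0) (ξ : ℝ) :
    (before c₁ c₂ t₀ t₀).y ξ = (after c₁ c₂ t₀ t₀).y ξ ∧
    (before c₁ c₂ t₀ t₀).U ξ = (after c₁ c₂ t₀ t₀).U ξ ∧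
    (before c₁ c₂ t₀ t₀).yξ ξ = (after c₁ c₂ t₀ t₀).yξ ξ ∧
    (before c₁ c₂ t₀ t₀).Uξ ξ = (after c₁ c₂ t₀ t₀).Uξ ξ ∧
    (before c₁ c₂ t₀ t₀).h ξ = (after c₁ c₂ t₀ t₀).h ξ := by
  have hL : c₁ - c₂ ≠ 0 := by linarith
  have hq := q₁_le_q₂ (t₀ := t₀) hc₁ hc₂ 0
  rcases lt_or_ge ξ (q₁ c₁ c₂ t₀ 0) with k1 | k1
  · simp only [before, after, LagVar.glue, glue_of_lt k1, leftBefore_self hL, and_self]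
  rcases le_or_gt ξ (q₂ c₁ c₂ t₀ 0) with k2 | k2
  · simp only [before, after, LagVar.glue, glue_of_mem (Set.mem_Icc.2 ⟨k1, k2⟩)]
    simp [midBefore, mid, midAfter, midW, midN, gap_self, expQ_self hL]
  · simp only [before, after, LagVar.glue, glue_of_gt hq k2, rightBefore_self hL, and_self]

lemma solution_of_lt {t : ℝ} (ht : t < t₀) : solution c₁ c₂ t₀ t = before c₁ c₂ t₀ t := if_pos ht

lemma solution_of_ge {t : ℝ} (ht : t₀ ≤ t) : solution c₁ c₂ t₀ t = after c₁ c₂ t₀ t :=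
  if_neg ht.not_gt

lemma solution_memF (hc₁ : 0 < c₁) (hc₂ : c₂ < 0) (ht₀ : 0 < t₀) (t : ℝ) :
    MemF (solution c₁ c₂ t₀ t) := by
  rcases lt_or_ge t t₀ with h | h
  · rw [solution_of_lt h]; exact (before_isProfile hc₁ hc₂ ht₀ h).memF
  · rw [solution_of_ge h]; exact (after_isProfile hc₁ hc₂ ht₀ t).memF

lemma DecayAt.bounds {Θ : LagVar} {p q : ℝ → ℝ} {C ξ : ℝ} (h : DecayAt Θ p q C ξ) :
    |Θ.y ξ - ξ| ≤ C + 1 ∧ |Θ.U ξ| ≤ C + 1 ∧ |Θ.yξ ξ| ≤ C + 1 ∧ |Θ.Uξ ξ| ≤ C + 1 ∧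
      |Θ.h ξ| ≤ C + 1 := by
  have hC : 0 ≤ C := (abs_nonneg _).trans h.y
  have he : C * Real.exp (-|ξ|) ≤ C :=
    mul_le_of_le_one_right hC (Real.exp_le_one_iff.2 (neg_nonpos.2 (abs_nonneg ξ)))
  refine ⟨by linarith [h.y], by linarith [h.U], ?_, by linarith [h.Uξ], by linarith [h.h]⟩
  have h1 := abs_add_le (Θ.yξ ξ - 1) 1
  rw [sub_add_cancel, abs_one] at h1
  linarith [h.yξ]

lemma solution_bounded (hc₁ : 0 < c₁) (hc₂ : c₂ < 0) (ht₀ : 0 < t₀) (T : ℝ) :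
    ∃ C : ℝ, ∀ ξ, ∀ t ∈ Set.Icc 0 T, |(solution c₁ c₂ t₀ t).y ξ - ξ| ≤ C ∧
      |(solution c₁ c₂ t₀ t).U ξ| ≤ C ∧ |(solution c₁ c₂ t₀ t).yξ ξ| ≤ C ∧
      |(solution c₁ c₂ t₀ t).Uξ ξ| ≤ C ∧ |(solution c₁ c₂ t₀ t).h ξ| ≤ C := by
  obtain ⟨C₁, h1⟩ := exists_before_decayAt hc₁ hc₂ ht₀ 0 t₀
  obtain ⟨C₂, h2⟩ := exists_after_decayAt hc₁ hc₂ ht₀ t₀ T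
  refine ⟨max C₁ C₂ + 1, fun ξ t ht => ?_⟩
  rcases lt_or_ge t t₀ with h | h
  · rw [solution_of_lt h]
    exact ((h1 t ⟨ht.1, h.le⟩ ξ).mono (le_max_left _ _)).bounds
  · rw [solution_of_ge h]
    exact ((h2 t ⟨h, ht.2⟩ ξ).mono (le_max_right _ _)).bounds

lemma solution_solvesAt (hc₁ : 0 < c₁) (hc₂ : c₂ < 0) (ht₀ : 0 < t₀) (ξ : ℝ) :
    SolvesAt (solution c₁ c₂ t₀) ξ := by
  obtain ⟨h1, h2, h3, h4, h5⟩ := before_self (t₀ := t₀) hc₁ hc₂ ξ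
  exact solvesAt_of_timeODE ht₀.le (before_timeODE hc₁ hc₂ ht₀ _ ξ) (after_timeODE hc₁ hc₂ _ ξ)
    (fun t _ ht => (before_isProfile hc₁ hc₂ ht₀ ht).P_eq_and_Q_eq ξ)
    (fun t _ => (after_isProfile hc₁ hc₂ ht₀ t).P_eq_and_Q_eq ξ) h1 h2 h3 h4 h5

lemma before_yξ_pos (hc₁ : 0 < c₁) (hc₂ : c₂ < 0) (ht₀ : 0 < t₀) {t : ℝ} (ht : t < t₀) (ξ : ℝ) :
    0 < (before c₁ c₂ t₀ t).yξ ξ := by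
  obtain ⟨δ, hδ, h⟩ := exists_before_yξ_lower hc₁ hc₂ ht₀ (a := t) ht
  exact hδ.trans_le (h t ⟨le_rfl, le_rfl⟩ ξ)

lemma after_yξ_pos (hc₁ : 0 < c₁) (hc₂ : c₂ < 0) (t : ℝ) {ξ : ℝ}
    (hξ : ξ ∉ Set.Icc (q₁ c₁ c₂ t₀ 0) (q₂ c₁ c₂ t₀ 0)) : 0 < (after c₁ c₂ t₀ t).yξ ξ := by
  obtain ⟨δ, hδ, h⟩ := exists_after_yξ_lower (t₀ := t₀) hc₁ hc₂ t t
  exact hδ.trans_le (h t ⟨le_rfl, le_rfl⟩ ξ hξ)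

lemma after_of_mem (t : ℝ) {ξ : ℝ} (hξ : ξ ∈ Set.Icc (q₁ c₁ c₂ t₀ 0) (q₂ c₁ c₂ t₀ 0)) :
    (after c₁ c₂ t₀ t).y ξ = (c₁ + c₂) * (t - t₀) ∧ (after c₁ c₂ t₀ t).U ξ = c₁ + c₂ ∧
    (after c₁ c₂ t₀ t).yξ ξ = 0 ∧ (after c₁ c₂ t₀ t).hbar ξ = 0 ∧
    (after c₁ c₂ t₀ t).h ξ = (midBefore c₁ c₂ t₀ t₀).h ξ := by
  simp only [after, LagVar.glue, glue_of_mem hξ, midAfter, and_self]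

lemma after_hbar_of_notMem (hc₁ : 0 < c₁) (hc₂ : c₂ < 0) (t : ℝ) {ξ : ℝ}
    (hξ : ξ ∉ Set.Icc (q₁ c₁ c₂ t₀ 0) (q₂ c₁ c₂ t₀ 0)) :
    (after c₁ c₂ t₀ t).hbar ξ = (after c₁ c₂ t₀ t).h ξ := by
  have hq := q₁_le_q₂ (t₀ := t₀) hc₁ hc₂ 0
  rcases lt_or_ge ξ (q₁ c₁ c₂ t₀ 0) with k1 | k1
  · simp only [after, LagVar.glue, glue_of_lt k1]
    rfl
  rcases le_or_gt ξ (q₂ c₁ c₂ t₀ 0) with k2 | k2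
  · exact absurd ⟨k1, k2⟩ hξ
  · simp only [after, LagVar.glue, glue_of_gt hq k2]
    rfl

lemma solution_yξ_eq_zero_iff (hc₁ : 0 < c₁) (hc₂ : c₂ < 0) (ht₀ : 0 < t₀) (t ξ : ℝ) :
    (solution c₁ c₂ t₀ t).yξ ξ = 0 ↔
      t₀ ≤ t ∧ ξ ∈ Set.Icc (q₁ c₁ c₂ t₀ 0) (q₂ c₁ c₂ t₀ 0) := by
  rcases lt_or_ge t t₀ with h | h
  · rw [solution_of_lt h]
    exact ⟨fun h' => absurd h' (before_yξ_pos hc₁ hc₂ ht₀ h ξ).ne', fun h' => absurd h'.1 h.not_ge⟩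
  · rw [solution_of_ge h]
    by_cases hξ : ξ ∈ Set.Icc (q₁ c₁ c₂ t₀ 0) (q₂ c₁ c₂ t₀ 0)
    · exact ⟨fun _ => ⟨h, hξ⟩, fun _ => (after_of_mem t hξ).2.2.1⟩
    · exact ⟨fun h' => absurd h' (after_yξ_pos hc₁ hc₂ t hξ).ne', fun h' => absurd h'.2 hξ⟩

lemma solution_isDissipative (hc₁ : 0 < c₁) (hc₂ : c₂ < 0) (ht₀ : 0 < t₀) :
    IsDissipativeSolution (solution c₁ c₂ t₀) where
  memF t _ := solution_memF hc₁ hc₂ ht₀ t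
  bounded T := (solution_bounded hc₁ hc₂ ht₀ T).imp fun _ h => ae_of_all _ h
  eq_y ξ := (solution_solvesAt hc₁ hc₂ ht₀ ξ).y
  eq_U ξ := (solution_solvesAt hc₁ hc₂ ht₀ ξ).U
  eq_yξ := ae_of_all _ fun ξ => (solution_solvesAt hc₁ hc₂ ht₀ ξ).yξ
  eq_Uξ := ae_of_all _ fun ξ => (solution_solvesAt hc₁ hc₂ ht₀ ξ).Uξ
  eq_h := ae_of_all _ fun ξ => (solution_solvesAt hc₁ hc₂ ht₀ ξ).h
  hbar_eq := by
    refine ae_of_all _ fun ξ t h0 => ?_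
    simp only [ne_eq, solution_yξ_eq_zero_iff hc₁ hc₂ ht₀]
    rcases lt_or_ge t t₀ with h | h
    · rw [solution_of_lt h]
      exact ⟨fun _ => rfl, fun ⟨s, hs, hs'⟩ => absurd (hs'.1.trans hs.2) h.not_ge⟩
    · rw [solution_of_ge h]
      exact ⟨fun h' => after_hbar_of_notMem hc₁ hc₂ t fun hξ => h' t ⟨h0, le_rfl⟩ ⟨h, hξ⟩,
        fun ⟨s, hs, hs'⟩ => (after_of_mem t hs'.2).2.2.2.1⟩

/-! ### The initial data -/

lemma p₁_eq (t : ℝ) : p₁ c₁ c₂ t₀ t = peakS c₁ c₂ t₀ t / gap c₁ c₂ t₀ t := by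
  have h : Real.exp ((c₁ - c₂) * (t - t₀)) =
      Real.exp (c₁ * (t - t₀)) / Real.exp (c₂ * (t - t₀)) := by
    rw [← Real.exp_sub]; ring_nf
  have h2 := (Real.exp_pos (c₂ * (t - t₀))).ne'
  rw [p₁, h, peakS, gap, ← mul_div_mul_right _ _ h2]
  congr 1 <;> field_simp

lemma p₂_eq (h : c₁ - c₂ ≠ 0) (t : ℝ) :
    p₂ c₁ c₂ t₀ t = -((c₁ - c₂) * expQ c₁ c₂ t₀ t) / gap c₁ c₂ t₀ t := by
  have h' : Real.exp ((c₁ - c₂) * (t - t₀)) =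
      Real.exp (c₁ * (t - t₀)) / Real.exp (c₂ * (t - t₀)) := by
    rw [← Real.exp_sub]; ring_nf
  have h2 := (Real.exp_pos (c₂ * (t - t₀))).ne'
  rw [p₂, h', expQ, gap, ← mul_div_mul_right _ _ h2]
  congr 1 <;> field_simp
  ring

lemma before_zero_y (hc₁ : 0 < c₁) (hc₂ : c₂ < 0) (ht₀ : 0 < t₀) (ξ : ℝ) :
    (before c₁ c₂ t₀ 0).y ξ = ξ ∧ (before c₁ c₂ t₀ 0).yξ ξ = 1 ∧
      (before c₁ c₂ t₀ 0).U ξ = twoPeakon c₁ c₂ t₀ 0 ξ := by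
  have hL : c₁ - c₂ ≠ 0 := by linarith
  have hK : c₁ ≠ 0 ∧ c₂ ≠ 0 := ⟨hc₁.ne', hc₂.ne⟩
  have hq := q₁_le_q₂ (t₀ := t₀) hc₁ hc₂ 0
  have hD := (gap_pos (t₀ := t₀) (show c₂ < c₁ by linarith) ht₀).ne'
  have hS := (peakS_pos (t₀ := t₀) hc₁ hc₂ 0).ne'
  have hb := (expQ_pos (t₀ := t₀) hc₁ hc₂ 0).ne'
  have hE := (midE_pos (t₀ := t₀) hL 0).ne'
  have e0 := (Real.exp_pos ξ).ne'
  have hSb := peakS_eq (t₀ := t₀) hL 0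
  have hbS := expQ_mul_expQ_neg (t₀ := t₀) hL 0
  have n0 := exp_neg_q₁ (t₀ := t₀) hc₁ hc₂ 0
  have n1 := expQ_neg_eq (t₀ := t₀) hL 0
  have n2 := expQ₁_neg_eq (t₀ := t₀) hL 0
  have n3 := expQ₁_eq (t₀ := t₀) hL 0
  have n4 := exp_q₂ (t₀ := t₀) hc₁ hc₂ 0
  have n5 : Real.exp (q₁ c₁ c₂ t₀ 0) = (expQ (-c₂) (-c₁) t₀ 0)⁻¹ := by
    rw [← n0, Real.exp_neg, inv_inv]
  have n6 : Real.exp (-q₂ c₁ c₂ t₀ 0) = (expQ c₁ c₂ t₀ 0)⁻¹ := by rw [Real.exp_neg, n4]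
  rcases lt_or_ge ξ (q₁ c₁ c₂ t₀ 0) with k1 | k1
  · simp only [before, LagVar.glue, glue_of_lt k1, leftBefore, outer, outerV, sub_self, add_zero,
      Real.log_exp, twoPeakon, p₁_eq, p₂_eq hL]
    refine ⟨by ring, div_self (Real.exp_pos _).ne', ?_⟩
    rw [abs_of_neg (by linarith), abs_of_neg (by linarith),
      show -(-(ξ - q₁ c₁ c₂ t₀ 0)) = ξ + -q₁ c₁ c₂ t₀ 0 by ring,
      show -(-(ξ - q₂ c₁ c₂ t₀ 0)) = ξ + -q₂ c₁ c₂ t₀ 0 by ring, Real.exp_add, Real.exp_add, n0,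
      n6, n1, n2, neg_one_mul ξ, Real.exp_neg]
    generalize midE (c₁ - c₂) (c₁ + c₂) (-(c₁ * c₂)) (expQ c₁ c₂ t₀ 0) (gap c₁ c₂ t₀ 0) = E at *
    field_simp
    -- One factor of S² is expanded by S = Lb + cD, and the product LbS is then given by
    -- `expQ_mul_expQ_neg`.
    have key : peakS c₁ c₂ t₀ 0 ^ 2 = (c₁ - c₂) ^ 2 * E + -(c₁ * c₂) * gap c₁ c₂ t₀ 0 ^ 2 +
        (c₁ + c₂) * gap c₁ c₂ t₀ 0 * peakS c₁ c₂ t₀ 0 := by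
      rw [← hbS]; nth_rewrite 1 [sq, hSb]; ring
    linear_combination (-1) * key
  rcases le_or_gt ξ (q₂ c₁ c₂ t₀ 0) with k2 | k2
  · simp only [before, LagVar.glue, glue_of_mem (Set.mem_Icc.2 ⟨k1, k2⟩), midBefore, mid]
    have hden : midDen c₁ c₂ t₀ 0 ξ = -(c₁ * c₂) * gap c₁ c₂ t₀ 0 ^ 2 := by
      rw [midDen, sub_self]; ring
    have hrho : midRho c₁ c₂ t₀ 0 ξ = (expQ c₁ c₂ t₀ 0 - Real.exp ξ) / gap c₁ c₂ t₀ 0 ^ 2 := by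
      rw [midRho, hden]; field_simp [hK.1, hK.2]
    have hsig : midSigma c₁ c₂ t₀ 0 ξ = Real.exp ξ / gap c₁ c₂ t₀ 0 ^ 2 := by
      rw [midSigma, hden]; field_simp [hK.1, hK.2]
    have hw : midW (expQ c₁ c₂ t₀ 0) (gap c₁ c₂ t₀ 0) (midRho c₁ c₂ t₀ 0 ξ) = Real.exp ξ := by
      rw [midW, hrho]; field_simp; ring
    rw [hw, hsig, Real.log_exp]
    refine ⟨rfl, by field_simp, ?_⟩
    rw [twoPeakon, p₁_eq, p₂_eq hL, abs_of_nonneg (by linarith), abs_of_nonpos (by linarith),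
      show -(ξ - q₁ c₁ c₂ t₀ 0) = -ξ + q₁ c₁ c₂ t₀ 0 by ring,
      show -(-(ξ - q₂ c₁ c₂ t₀ 0)) = ξ + -q₂ c₁ c₂ t₀ 0 by ring, Real.exp_add, Real.exp_add, n5,
      n6, n1, Real.exp_neg, midN, hrho, midE]
    field_simp
    ring
  · simp only [before, LagVar.glue, glue_of_gt hq k2, rightBefore, outer, outerV, sub_self,
      add_zero, Real.log_exp, twoPeakon, p₁_eq, p₂_eq hL]
    refine ⟨by ring, div_self (Real.exp_pos _).ne', ?_⟩
    rw [abs_of_pos (by linarith), abs_of_pos (by linarith),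
      show -(ξ - q₁ c₁ c₂ t₀ 0) = -ξ + q₁ c₁ c₂ t₀ 0 by ring,
      show -(ξ - q₂ c₁ c₂ t₀ 0) = -ξ + q₂ c₁ c₂ t₀ 0 by ring, Real.exp_add, Real.exp_add, n5,
      n4, n1, n3, one_mul ξ, Real.exp_neg, midE]
    field_simp
    ring

lemma deriv_twoPeakon_zero (hc₁ : 0 < c₁) (hc₂ : c₂ < 0) (ht₀ : 0 < t₀) :
    ∀ᵐ ξ, (before c₁ c₂ t₀ 0).Uξ ξ = deriv (twoPeakon c₁ c₂ t₀ 0) ξ := by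
  have hp := before_isProfile hc₁ hc₂ ht₀ ht₀
  have he : (before c₁ c₂ t₀ 0).U = twoPeakon c₁ c₂ t₀ 0 :=
    funext fun ξ => (before_zero_y hc₁ hc₂ ht₀ ξ).2.2
  filter_upwards [hp.countable.ae_notMem volume] with ξ hξ
  rw [← he]
  exact (hp.deriv_U ξ hξ).deriv.symm

lemma solution_hasInitialVelocity (hc₁ : 0 < c₁) (hc₂ : c₂ < 0) (ht₀ : 0 < t₀) :
    HasInitialVelocity (solution c₁ c₂ t₀ 0) (twoPeakon c₁ c₂ t₀ 0) := by
  rw [solution_of_lt ht₀]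
  have hh : ∀ᵐ ξ, (before c₁ c₂ t₀ 0).hbar ξ = deriv (twoPeakon c₁ c₂ t₀ 0) ξ ^ 2 := by
    filter_upwards [deriv_twoPeakon_zero hc₁ hc₂ ht₀] with ξ hξ
    rw [← hξ, ← (before_admissibleAt hc₁ hc₂ ht₀ 0 ξ).energy_eq,
      (before_zero_y hc₁ hc₂ ht₀ ξ).2.1, one_mul]
  exact ⟨fun ξ => (before_zero_y hc₁ hc₂ ht₀ ξ).1, fun ξ => (before_zero_y hc₁ hc₂ ht₀ ξ).2.2,
    hh, hh⟩

end Solution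

/-! ### Uniqueness of the dissipative solution -/

section Uniqueness

lemma SolvesFrom.continuousOn {a : ℝ} {f g : ℝ → ℝ} (h : SolvesFrom a f g) :
    ContinuousOn f (Set.Ici a) := by
  have key : ∀ b, a ≤ b → ContinuousOn f (Set.Icc a b) := fun b hb => by
    have h1 := intervalIntegral.continuousOn_primitive_interval' (h b hb).1
      (Set.left_mem_uIcc (a := a) (b := b))
    rw [Set.uIcc_of_le hb] at h1
    exact (h1.const_add (f a)).congr fun t ht => (h t ht.1).2
  intro t ht
  refine (key (t + 1) (le_add_of_le_of_nonneg ht zero_le_one) t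
    ⟨ht, by linarith⟩).mono_of_mem_nhdsWithin ?_
  rw [← Set.Ici_inter_Iic]
  exact inter_mem self_mem_nhdsWithin (mem_nhdsWithin_of_mem_nhds (Iic_mem_nhds (by linarith)))

lemma SolvesFrom.abs_sub_self_le {f g : ℝ → ℝ} {a b M : ℝ} (h : SolvesFrom 0 f g) (ha : 0 ≤ a)
    (hab : a ≤ b) (hM : ∀ s ∈ Set.Icc a b, |g s| ≤ M) : |f b - f a| ≤ M * (b - a) := by
  have h0 : SolvesFrom 0 (fun _ => f a) (fun _ => 0) := fun t _ => ⟨by simp, by simp⟩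
  exact h.abs_sub_le h0 ha hab rfl fun s hs => by simpa using hM s hs

/-- With speed at most M, a value of at least ε cannot reach 0 within time δ. Applied to f = y_ξ, g
= U_ξ, it excludes wave breaking for a time independent of the label. -/
lemma SolvesFrom.ne_zero_of_le {f g : ℝ → ℝ} {T t δ ε M : ℝ} (h : SolvesFrom 0 f g) (hT : 0 ≤ T)
    (hM : ∀ s ∈ Set.Icc T t, |g s| ≤ M) (hMδ : M * δ < ε) (hδ : t ≤ T + δ)
    (hTt : T ≤ t) (hε : ε ≤ f T) : ∀ s ∈ Set.Icc T t, f s ≠ 0 := by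
  intro s hs h0
  have h1 := h.abs_sub_self_le hT hs.1 fun r hr => hM r ⟨hr.1, hr.2.trans hs.2⟩
  have hM0 : 0 ≤ M := (abs_nonneg _).trans (hM T ⟨le_rfl, hTt⟩)
  have h2 : M * (s - T) ≤ M * δ := mul_le_mul_of_nonneg_left (by linarith [hs.2]) hM0
  rw [h0, zero_sub, abs_neg] at h1
  linarith [le_abs_self (f T)]

lemma LagVar.CloseAt.eq {Θ Θ' : LagVar} {ξ : ℝ} (h : Θ.CloseAt Θ' 0 ξ) :
    Θ.y ξ = Θ'.y ξ ∧ Θ.U ξ = Θ'.U ξ ∧ Θ.yξ ξ = Θ'.yξ ξ ∧ Θ.Uξ ξ = Θ'.Uξ ξ ∧ Θ.h ξ = Θ'.h ξ := by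
  have e : ∀ {x y : ℝ}, |x - y| ≤ 0 → x = y := fun h => sub_eq_zero.1 (abs_nonpos_iff.1 h)
  exact ⟨e h.y, e h.U, e h.yξ, e h.Uξ, e h.h⟩

lemma LagVar.closeAt_zero_of_eq {Θ Θ' : LagVar} {ξ : ℝ} (h : Θ.y ξ = Θ'.y ξ ∧ Θ.U ξ = Θ'.U ξ ∧
    Θ.yξ ξ = Θ'.yξ ξ ∧ Θ.Uξ ξ = Θ'.Uξ ξ ∧ Θ.h ξ = Θ'.h ξ) : Θ.CloseAt Θ' 0 ξ := by
  obtain ⟨h1, h2, h3, h4, h5⟩ := h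
  constructor <;> simp [h1, h2, h3, h4, h5]

/-- The initial data do not mention y_ξ and U_ξ; as derivatives of y and U they are determined
almost everywhere. -/
lemma HasInitialVelocity.closeAt_zero {Θ Θ' : LagVar} {u₀ : ℝ → ℝ} (h : HasInitialVelocity Θ u₀)
    (h' : HasInitialVelocity Θ' u₀) (hΘ : MemF Θ) (hΘ' : MemF Θ') :
    ∀ᵐ ξ, Θ.CloseAt Θ' 0 ξ := by
  have hy : Θ.y = Θ'.y := funext fun ξ => (h.y_eq ξ).trans (h'.y_eq ξ).symm
  have hU : Θ.U = Θ'.U := funext fun ξ => (h.U_eq ξ).trans (h'.U_eq ξ).symm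
  have h1 := hΘ.y_ac.ae_eq (hy ▸ hΘ'.y_ac)
  have h2 := hΘ.U_ac.ae_eq (hU ▸ hΘ'.U_ac)
  filter_upwards [h1, h2, h.h_eq, h'.h_eq] with ξ e1 e2 e3 e4
  exact LagVar.closeAt_zero_of_eq ⟨by rw [hy], by rw [hU], e1, e2, e3.trans e4.symm⟩

variable {Θ Θ' : ℝ → LagVar}

/-- Agreement passes to the closed interval by continuity in time. The sequence b - b/(n+1) keeps
the number of exceptional null sets countable. -/
lemma IsDissipativeSolution.closeAt_zero_Icc_of_Ico (hΘ : IsDissipativeSolution Θ)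
    (hΘ' : IsDissipativeSolution Θ') {b : ℝ} (hb : 0 < b)
    (h : ∀ T ∈ Set.Ico 0 b, ∀ᵐ ξ, ∀ t ∈ Set.Icc 0 T, (Θ t).CloseAt (Θ' t) 0 ξ) :
    ∀ᵐ ξ, ∀ t ∈ Set.Icc 0 b, (Θ t).CloseAt (Θ' t) 0 ξ := by
  have hseq : ∀ᵐ ξ, ∀ n : ℕ, ∀ t ∈ Set.Icc 0 (b - b / (n + 1)), (Θ t).CloseAt (Θ' t) 0 ξ := by
    refine ae_all_iff.2 fun n => h _ ⟨sub_nonneg.2 (div_le_self hb.le ?_), sub_lt_self b ?_⟩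
    · exact le_add_of_nonneg_left n.cast_nonneg
    · positivity
  filter_upwards [hseq, hΘ.eq_yξ, hΘ'.eq_yξ, hΘ.eq_Uξ, hΘ'.eq_Uξ, hΘ.eq_h, hΘ'.eq_h]
    with ξ hξ a1 b1 a2 b2 a3 b3
  have hIco : ∀ t ∈ Set.Ico 0 b, (Θ t).CloseAt (Θ' t) 0 ξ := by
    intro t ht
    obtain ⟨n, hn⟩ := exists_nat_gt (b / (b - t))
    have hbt : 0 < b - t := sub_pos.2 ht.2
    have : b / (n + 1) ≤ b - t := by
      rw [div_le_iff₀ (by positivity)]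
      have := (div_lt_iff₀ hbt).1 hn
      nlinarith
    exact hξ n t ⟨ht.1, by linarith⟩
  have ext : ∀ {f g f' g' : ℝ → ℝ}, SolvesFrom 0 f g → SolvesFrom 0 f' g' →
      (∀ t ∈ Set.Ico 0 b, f t = f' t) → ∀ t ∈ Set.Icc 0 b, f t = f' t :=
    fun hf hf' he => Set.EqOn.of_subset_closure he
      (hf.continuousOn.mono Set.Icc_subset_Ici_self) (hf'.continuousOn.mono Set.Icc_subset_Ici_self)
      Set.Ico_subset_Icc_self (closure_Ico hb.ne).ge
  exact fun t ht => LagVar.closeAt_zero_of_eq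
    ⟨ext (hΘ.eq_y ξ) (hΘ'.eq_y ξ) (fun t ht => (hIco t ht).eq.1) t ht,
    ext (hΘ.eq_U ξ) (hΘ'.eq_U ξ) (fun t ht => (hIco t ht).eq.2.1) t ht,
    ext a1 b1 (fun t ht => (hIco t ht).eq.2.2.1) t ht,
    ext a2 b2 (fun t ht => (hIco t ht).eq.2.2.2.1) t ht,
    ext a3 b3 (fun t ht => (hIco t ht).eq.2.2.2.2) t ht⟩

variable {c₁ c₂ t₀ : ℝ}

/-- Agreement up to T transfers the lower bound ε on y_ξ to Θ. Since U_ξ is bounded, Θ cannot break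
during the next ε/(2(|C| + 1)), so h̄ = h for both solutions in that time. -/
lemma IsDissipativeSolution.closeAt_solution_of_lt (hc₁ : 0 < c₁) (hc₂ : c₂ < 0) (ht₀ : 0 < t₀)
    (hΘ : IsDissipativeSolution Θ)
    (h0 : HasInitialVelocity (Θ 0) (twoPeakon c₁ c₂ t₀ 0)) {b : ℝ} (hb : b < t₀) :
    ∀ᵐ ξ, ∀ t ∈ Set.Icc 0 b, (solution c₁ c₂ t₀ t).CloseAt (Θ t) 0 ξ := by
  have hsol := solution_isDissipative (t₀ := t₀) hc₁ hc₂ ht₀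
  obtain ⟨ε, hε, hlow⟩ := exists_before_yξ_lower hc₁ hc₂ ht₀ (a := 0) hb
  obtain ⟨C, hC⟩ := hΘ.exists_bddAt b
  have hδ : 0 < ε / (2 * (|C| + 1)) := by positivity
  refine hsol.closeAt_zero_of_extend hΘ (δ := ε / (2 * (|C| + 1))) le_rfl hδ ?_ ?_
  · filter_upwards [(solution_hasInitialVelocity hc₁ hc₂ ht₀).closeAt_zero h0
      (hsol.memF 0 le_rfl) (hΘ.memF 0 le_rfl)] with ξ hξ t ht
    rw [le_antisymm ht.2 ht.1]
    exact hξ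
  · intro T hT hcl
    filter_upwards [hcl, hC, hΘ.eq_yξ, hΘ.hbar_eq] with ξ hξ hCξ hyξ hbar t ht
    have htb : t ≤ b := ht.2.trans (min_le_right _ _)
    have ht0 : 0 ≤ t := hT.1.trans ht.1
    have hyT : ∀ s ∈ Set.Icc 0 T, ε ≤ (Θ s).yξ ξ := fun s hs => by
      have := (hξ s hs).eq.2.2.1
      rw [solution_of_lt ((hs.2.trans hT.2).trans_lt hb)] at this
      rw [← this]
      exact hlow s ⟨hs.1, hs.2.trans hT.2⟩ ξ
    have hne := hyξ.ne_zero_of_le (M := |C| + 1) (δ := ε / (2 * (|C| + 1))) (ε := ε) hT.1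
      (fun s hs => (hCξ s ⟨hT.1.trans hs.1, hs.2.trans htb⟩).Uξ.trans
        ((le_abs_self C).trans (lt_add_one _).le))
      (by field_simp; norm_num) (ht.2.trans (min_le_left _ _)) ht.1 (hyT T ⟨hT.1, le_rfl⟩)
    have h1 : (Θ t).hbar ξ = (Θ t).h ξ := (hbar t ht0).1 fun s hs => by
      rcases le_total s T with h | h
      · exact (hε.trans_le (hyT s ⟨hs.1, h⟩)).ne'
      · exact hne s ⟨h, hs.2⟩
    rw [h1, solution_of_lt (htb.trans_lt hb), before_hbar]

/-- The continuation restarts at t₀, because the earlier step length degenerates there. From t₀ on,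
labels between the peaks have y_ξ(t₀) = 0 in both solutions, so both h̄ vanish; at the other labels
y_ξ is again bounded below. -/
lemma IsDissipativeSolution.closeAt_solution (hc₁ : 0 < c₁) (hc₂ : c₂ < 0) (ht₀ : 0 < t₀)
    (hΘ : IsDissipativeSolution Θ)
    (h0 : HasInitialVelocity (Θ 0) (twoPeakon c₁ c₂ t₀ 0)) (b : ℝ) :
    ∀ᵐ ξ, ∀ t ∈ Set.Icc 0 b, (solution c₁ c₂ t₀ t).CloseAt (Θ t) 0 ξ := by
  have hsol := solution_isDissipative (t₀ := t₀) hc₁ hc₂ ht₀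
  obtain ⟨ε, hε, hlow⟩ := exists_after_yξ_lower (t₀ := t₀) hc₁ hc₂ t₀ b
  obtain ⟨C, hC⟩ := hΘ.exists_bddAt b
  have hδ : 0 < ε / (2 * (|C| + 1)) := by positivity
  refine hsol.closeAt_zero_of_extend hΘ (δ := ε / (2 * (|C| + 1))) ht₀.le hδ
    (hsol.closeAt_zero_Icc_of_Ico hΘ ht₀ fun T hT =>
      hΘ.closeAt_solution_of_lt hc₁ hc₂ ht₀ h0 hT.2) ?_
  intro T hT hcl
  filter_upwards [hcl, hC, hΘ.eq_yξ, hΘ.hbar_eq, hsol.hbar_eq] with ξ hξ hCξ hyξ hbar hbar' t ht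
  have hT0 : 0 ≤ T := ht₀.le.trans hT.1
  have htb : t ≤ b := ht.2.trans (min_le_right _ _)
  have ht0 : 0 ≤ t := hT0.trans ht.1
  by_cases hm : ξ ∈ Set.Icc (q₁ c₁ c₂ t₀ 0) (q₂ c₁ c₂ t₀ 0)
  · have e1 := (solution_yξ_eq_zero_iff hc₁ hc₂ ht₀ t₀ ξ).2 ⟨le_rfl, hm⟩
    have e2 := (hξ t₀ ⟨ht₀.le, hT.1⟩).eq.2.2.1
    have hmem : t₀ ∈ Set.Icc 0 t := ⟨ht₀.le, hT.1.trans ht.1⟩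
    rw [(hbar t ht0).2 ⟨t₀, hmem, e2 ▸ e1⟩, (hbar' t ht0).2 ⟨t₀, hmem, e1⟩, sub_self, abs_zero]
    exact abs_nonneg _
  · have hpos : ∀ s, (solution c₁ c₂ t₀ s).yξ ξ ≠ 0 := fun s h =>
      hm ((solution_yξ_eq_zero_iff hc₁ hc₂ ht₀ s ξ).1 h).2
    have hyT : ε ≤ (Θ T).yξ ξ := by
      have := (hξ T ⟨hT0, le_rfl⟩).eq.2.2.1
      rw [solution_of_ge hT.1] at this
      rw [← this]
      exact hlow T hT ξ hm
    have hne := hyξ.ne_zero_of_le (M := |C| + 1) (δ := ε / (2 * (|C| + 1))) (ε := ε) hT0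
      (fun s hs => (hCξ s ⟨hT0.trans hs.1, hs.2.trans htb⟩).Uξ.trans
        ((le_abs_self C).trans (lt_add_one _).le))
      (by field_simp; norm_num) (ht.2.trans (min_le_left _ _)) ht.1 hyT
    have h1 : (Θ t).hbar ξ = (Θ t).h ξ := (hbar t ht0).1 fun s hs => by
      rcases le_total s T with h | h
      · rw [← (hξ s ⟨hs.1, h⟩).eq.2.2.1]
        exact hpos s
      · exact hne s ⟨h, hs.2⟩
    rw [h1, (hbar' t ht0).1 fun s _ => hpos s]

/-- Uniqueness of the fully dissipative solution with peakon-antipeakon initial data. -/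
lemma IsDissipativeSolution.eq_solution (hc₁ : 0 < c₁) (hc₂ : c₂ < 0) (ht₀ : 0 < t₀)
    (hΘ : IsDissipativeSolution Θ)
    (h0 : HasInitialVelocity (Θ 0) (twoPeakon c₁ c₂ t₀ 0)) :
    (∀ t, 0 ≤ t → (Θ t).y = (solution c₁ c₂ t₀ t).y ∧ (Θ t).U = (solution c₁ c₂ t₀ t).U) ∧
    ∀ᵐ ξ, ∀ t, 0 ≤ t → (Θ t).yξ ξ = (solution c₁ c₂ t₀ t).yξ ξ ∧
      (Θ t).h ξ = (solution c₁ c₂ t₀ t).h ξ ∧ (Θ t).hbar ξ = (solution c₁ c₂ t₀ t).hbar ξ := by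
  have hsol := solution_isDissipative (t₀ := t₀) hc₁ hc₂ ht₀
  have hcl : ∀ᵐ ξ, ∀ t, 0 ≤ t → (solution c₁ c₂ t₀ t).CloseAt (Θ t) 0 ξ := by
    have := ae_all_iff.2 fun n : ℕ => hΘ.closeAt_solution hc₁ hc₂ ht₀ h0 n
    filter_upwards [this] with ξ hξ t ht
    obtain ⟨n, hn⟩ := exists_nat_ge t
    exact hξ n t ⟨ht, hn⟩
  refine ⟨fun t ht => ⟨?_, ?_⟩, ?_⟩
  · refine (Continuous.ae_eq_iff_eq volume (hΘ.memF t ht).y_ac.continuous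
      (hsol.memF t ht).y_ac.continuous).1 ?_
    filter_upwards [hcl] with ξ hξ
    exact (hξ t ht).eq.1.symm
  · refine (Continuous.ae_eq_iff_eq volume (hΘ.memF t ht).U_ac.continuous
      (hsol.memF t ht).U_ac.continuous).1 ?_
    filter_upwards [hcl] with ξ hξ
    exact (hξ t ht).eq.2.1.symm
  · filter_upwards [hcl, hΘ.hbar_eq, hsol.hbar_eq] with ξ hξ b1 b2 t ht
    have hy : ∀ s, 0 ≤ s → (Θ s).yξ ξ = (solution c₁ c₂ t₀ s).yξ ξ := fun s hs =>
      (hξ s hs).eq.2.2.1.symm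
    refine ⟨hy t ht, (hξ t ht).eq.2.2.2.2.symm, ?_⟩
    by_cases h : ∃ s ∈ Set.Icc 0 t, (Θ s).yξ ξ = 0
    · obtain ⟨s, hs, hs'⟩ := h
      rw [(b1 t ht).2 ⟨s, hs, hs'⟩, (b2 t ht).2 ⟨s, hs, hy s hs.1 ▸ hs'⟩]
    · push Not at h
      rw [(b1 t ht).1 h, (b2 t ht).1 fun s hs => hy s hs.1 ▸ h s hs, (hξ t ht).eq.2.2.2.2]

end Uniqueness

/-! ### Agreement with the stated formulas after breaking -/

section AfterBreaking

variable {c₁ c₂ t₀ : ℝ}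

lemma denL_eq (h : c₁ - c₂ ≠ 0) (t ξ : ℝ) : denL c₁ c₂ t₀ t ξ = (c₁ - c₂) * Real.exp ξ *
    outerV (-1) (expQ (-c₂) (-c₁) t₀ 0) (Real.exp (-(c₁ + c₂) * (t - t₀))) ξ := by
  have e0 := (Real.exp_pos ξ).ne'
  rw [denL, outerV, expQ, neg_one_mul, Real.exp_neg ξ, zero_sub, neg_mul_neg, neg_mul_neg, neg_mul,
    show -c₂ - -c₁ = c₁ - c₂ by ring]
  field_simp
  ring

lemma denR_eq (h : c₁ - c₂ ≠ 0) (t ξ : ℝ) : denR c₁ c₂ t₀ t ξ = (c₁ - c₂) * Real.exp (-ξ) *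
    outerV 1 (expQ c₁ c₂ t₀ 0) (Real.exp ((c₁ + c₂) * (t - t₀))) ξ := by
  have e0 := (Real.exp_pos ξ).ne'
  rw [denR, outerV, expQ, one_mul, Real.exp_neg ξ, zero_sub, mul_neg, mul_neg]
  field_simp
  ring

/-- At t₀ both e^y and `midE` equal 1, so h = 4L² `midSigma`; the rest rewrites `midDen` through
e^{-c₁t₀} and e^{-c₂t₀}. -/
lemma midBefore_h_self (hc₁ : 0 < c₁) (hc₂ : c₂ < 0) (ξ : ℝ) :
    (midBefore c₁ c₂ t₀ t₀).h ξ = hMid c₁ c₂ t₀ ξ := by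
  have hL : c₁ - c₂ ≠ 0 := by linarith
  have hz := (Real.exp_pos (-(c₂ * t₀))).ne'
  have e1 : Real.exp (-((c₁ - c₂) * t₀)) = Real.exp (-(c₁ * t₀)) / Real.exp (-(c₂ * t₀)) := by
    rw [← Real.exp_sub]; ring_nf
  have e2 : Real.exp (c₂ * t₀) = (Real.exp (-(c₂ * t₀)))⁻¹ := by rw [Real.exp_neg, inv_inv]
  have hE : midE (c₁ - c₂) (c₁ + c₂) (-(c₁ * c₂)) 1 0 = 1 := by simp [midE]
  have hW : midW 1 0 (midRho c₁ c₂ t₀ t₀ ξ) = 1 := by simp [midW]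
  have hS : peakS c₁ c₂ t₀ t₀ = c₁ - c₂ := by simp [peakS]
  have hg : gap c₁ c₂ t₀ 0 = Real.exp (-(c₂ * t₀)) - Real.exp (-(c₁ * t₀)) := by simp [gap]
  have hden : midDen c₁ c₂ t₀ t₀ ξ = -((c₁ - c₂) * Real.exp (-(c₂ * t₀))) *
      ((c₁ - c₂) * Real.exp (-(c₁ * t₀)) + c₂ - c₁ * Real.exp (-((c₁ - c₂) * t₀))
      + (-c₁ + c₂ * Real.exp (-((c₁ - c₂) * t₀)) + (c₁ - c₂) * Real.exp (c₂ * t₀))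
        * Real.exp ξ) := by
    rw [midDen, hS, hg, e1, e2]
    simp only [peakS, expQ, zero_sub, mul_neg]
    field_simp
    ring
  simp only [midBefore, mid, gap_self, expQ_self hL, hE, hW]
  rw [midSigma, hden, hMid, hg, e1, mul_pow, neg_sq, mul_pow]
  field_simp
  ring

lemma after_eq (hc₁ : 0 < c₁) (hc₂ : c₂ < 0) (t ξ : ℝ) :
    (after c₁ c₂ t₀ t).y ξ = yAfter c₁ c₂ t₀ t ξ ∧ (after c₁ c₂ t₀ t).U ξ = UAfter c₁ c₂ t₀ t ξ ∧
    (after c₁ c₂ t₀ t).h ξ = hAfter c₁ c₂ t₀ t ξ ∧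
    (after c₁ c₂ t₀ t).hbar ξ = hbarAfter c₁ c₂ t₀ t ξ := by
  have hL : 0 < c₁ - c₂ := by linarith
  have hq := q₁_le_q₂ (t₀ := t₀) hc₁ hc₂ 0
  have e0 := (Real.exp_pos ξ).ne'
  rcases lt_or_ge ξ (q₁ c₁ c₂ t₀ 0) with k1 | k1
  · have hv := outerV_left_pos (t₀ := t₀) hc₁ hc₂ (Real.exp_pos (-(c₁ + c₂) * (t - t₀))) k1.le
    have eh : Real.exp (-(2 * (c₁ + c₂) * (t - t₀))) = Real.exp (-(c₁ + c₂) * (t - t₀)) ^ 2 := by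
      rw [← Real.exp_nat_mul]; push_cast; ring_nf
    have ex : Real.exp (2 * ξ) = Real.exp ξ ^ 2 := by rw [← Real.exp_nat_mul]; push_cast; rfl
    have H : (leftAfter c₁ c₂ t₀ t).h ξ = hAfterWith 0 c₁ c₂ t₀ t ξ := by
      rw [hAfterWith, if_pos k1, denL_eq hL.ne', eh, ex]
      simp only [leftAfter, outer, neg_one_mul, Real.exp_neg ξ]
      field_simp
    simp only [after, LagVar.glue, glue_of_lt k1]
    refine ⟨?_, ?_, H.trans ?_, H⟩
    · rw [yAfter, if_pos k1, denL_eq hL.ne', Real.log_mul (by positivity) hv.ne',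
        Real.log_mul hL.ne' e0, Real.log_exp]
      simp only [leftAfter, outer]
      ring
    · rw [UAfter, if_pos k1, denL_eq hL.ne', ← neg_mul]
      simp only [leftAfter, outer]
      field_simp
    · rw [hAfter, hAfterWith, hAfterWith, if_pos k1, if_pos k1]
  rcases le_or_gt ξ (q₂ c₁ c₂ t₀ 0) with k2 | k2
  · obtain ⟨h1, h2, -, h3, h4⟩ := after_of_mem (c₁ := c₁) (c₂ := c₂) (t₀ := t₀) t
      (Set.mem_Icc.2 ⟨k1, k2⟩)
    rw [h1, h2, h3, h4, yAfter, UAfter, hAfter, hbarAfter, hAfterWith, hAfterWith,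
      midBefore_h_self hc₁ hc₂]
    simp only [if_neg k1.not_gt, if_pos k2, and_self]
  · have hv := outerV_right_pos (t₀ := t₀) hc₁ hc₂ (Real.exp_pos ((c₁ + c₂) * (t - t₀))) k2.le
    have eh : Real.exp (2 * (c₁ + c₂) * (t - t₀)) = Real.exp ((c₁ + c₂) * (t - t₀)) ^ 2 := by
      rw [← Real.exp_nat_mul]; push_cast; ring_nf
    have ex : Real.exp (-(2 * ξ)) = Real.exp (-ξ) ^ 2 := by
      rw [← Real.exp_nat_mul]; push_cast; ring_nf
    have H : (rightAfter c₁ c₂ t₀ t).h ξ = hAfterWith 0 c₁ c₂ t₀ t ξ := by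
      rw [hAfterWith, if_neg k1.not_gt, if_neg k2.not_ge, denR_eq hL.ne', eh, ex]
      simp only [rightAfter, outer, one_mul, Real.exp_neg ξ]
      field_simp
    simp only [after, LagVar.glue, glue_of_gt hq k2]
    refine ⟨?_, ?_, H.trans ?_, H⟩
    · rw [yAfter, if_neg k1.not_gt, if_neg k2.not_ge, denR_eq hL.ne',
        Real.log_mul (by positivity) hv.ne', Real.log_mul hL.ne' (Real.exp_pos _).ne',
        Real.log_exp]
      simp only [rightAfter, outer]
      ring
    · rw [UAfter, if_neg k1.not_gt, if_neg k2.not_ge, denR_eq hL.ne']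
      simp only [rightAfter, outer, Real.exp_neg ξ]
      field_simp
    · rw [hAfter, hAfterWith, hAfterWith, if_neg k1.not_gt, if_neg k1.not_gt, if_neg k2.not_ge,
        if_neg k2.not_ge]

end AfterBreaking

/-! ### The peakon and the Eulerian variables -/

section Eulerian

/-! ### The peakon -/

lemma hasDerivAt_onePeakon (c t₀ t : ℝ) {x : ℝ} (hx : x ≠ c * (t - t₀)) :
    HasDerivAt (onePeakon c t₀ t) (-Real.sign (x - c * (t - t₀)) * onePeakon c t₀ t x) x := by
  have hs : x - c * (t - t₀) ≠ 0 := sub_ne_zero.2 hx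
  have habs : HasDerivAt (fun x => |x - c * (t - t₀)|) (Real.sign (x - c * (t - t₀))) x := by
    rcases hs.lt_or_gt with h | h
    · rw [Real.sign_of_neg h]
      simpa [Function.comp_def] using (hasDerivAt_abs_neg h).comp x ((hasDerivAt_id x).sub_const (c * (t - t₀)))
    · rw [Real.sign_of_pos h]
      simpa [Function.comp_def] using (hasDerivAt_abs_pos h).comp x ((hasDerivAt_id x).sub_const (c * (t - t₀)))
  refine (habs.neg.exp.const_mul c).congr_deriv ?_
  simp only [onePeakon, Pi.neg_apply]
  ring

lemma onePeakon_sq (c t₀ t x : ℝ) :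
    onePeakon c t₀ t x ^ 2 = c ^ 2 * Real.exp (-2 * |x - c * (t - t₀)|) := by
  rw [onePeakon, mul_pow, ← Real.exp_nat_mul]
  push_cast
  ring_nf

lemma deriv_onePeakon_sq (c t₀ t : ℝ) {x : ℝ} (hx : x ≠ c * (t - t₀)) :
    deriv (onePeakon c t₀ t) x ^ 2 = onePeakon c t₀ t x ^ 2 := by
  rw [(hasDerivAt_onePeakon c t₀ t hx).deriv, mul_pow]
  rcases (sub_ne_zero.2 hx).lt_or_gt with h | h
  · rw [Real.sign_of_neg h]; ring
  · rw [Real.sign_of_pos h]; ring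

lemma integral_exp_neg_two_mul_abs_sub (a : ℝ) :
    Integrable (fun x : ℝ => Real.exp (-2 * |x - a|)) ∧
      ∫ x : ℝ, Real.exp (-2 * |x - a|) = 1 := by
  have he : (fun x : ℝ => Real.exp (-2 * |x - a|)) = fun x => Real.exp (-|2 * a - 2 * x|) := by
    funext x
    rw [← mul_sub, abs_mul, abs_two, abs_sub_comm]
    ring_nf
  rw [he]
  refine ⟨(integrable_exp_neg_abs_sub (2 * a)).comp_mul_left' two_ne_zero, ?_⟩
  rw [Measure.integral_comp_mul_left (fun y => Real.exp (-|2 * a - y|)) 2,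
    integral_exp_neg_abs_sub]
  norm_num

lemma onePeakon_energy (c t₀ t : ℝ) :
    Integrable (fun x => onePeakon c t₀ t x ^ 2 + deriv (onePeakon c t₀ t) x ^ 2) ∧
    ∫ x, (onePeakon c t₀ t x ^ 2 + deriv (onePeakon c t₀ t) x ^ 2) = 2 * c ^ 2 := by
  have he : (fun x => 2 * c ^ 2 * Real.exp (-2 * |x - c * (t - t₀)|)) =ᵐ[volume]
      fun x => onePeakon c t₀ t x ^ 2 + deriv (onePeakon c t₀ t) x ^ 2 := by
    filter_upwards [(Set.countable_singleton (c * (t - t₀))).ae_notMem volume] with x hx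
    rw [deriv_onePeakon_sq c t₀ t hx, onePeakon_sq]
    ring
  obtain ⟨h1, h2⟩ := integral_exp_neg_two_mul_abs_sub (c * (t - t₀))
  refine ⟨(h1.const_mul _).congr he, ?_⟩
  rw [← integral_congr_ae he, integral_const_mul, h2, mul_one]

/-! ### Eulerian variables -/

lemma IsEulerianOf.congr {Θ Θ' : LagVar} (hy : Θ.y = Θ'.y) (hU : Θ.U = Θ'.U)
    (hb : Θ.hbar =ᵐ[volume] Θ'.hbar) (hh : Θ.h =ᵐ[volume] Θ'.h) (u : ℝ → ℝ) (μ ν : Measure ℝ) :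
    IsEulerianOf Θ u μ ν ↔ IsEulerianOf Θ' u μ ν := by
  have h1 : (volume.withDensity fun ξ => ENNReal.ofReal (Θ.hbar ξ)) =
      volume.withDensity fun ξ => ENNReal.ofReal (Θ'.hbar ξ) :=
    withDensity_congr_ae (hb.mono fun ξ h => by simp only [h])
  have h2 : (volume.withDensity fun ξ => ENNReal.ofReal (Θ.h ξ)) =
      volume.withDensity fun ξ => ENNReal.ofReal (Θ'.h ξ) :=
    withDensity_congr_ae (hh.mono fun ξ h => by simp only [h])
  rw [IsEulerianOf, IsEulerianOf, hy, hU, h1, h2]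

/-- If a monotone function takes the same value at two points, it is constant between them, which
forces a zero one-sided derivative. -/
lemma Monotone.eq_of_hasDerivAt_pos {y : ℝ → ℝ} {d ξ η : ℝ} (hy : Monotone y)
    (h : HasDerivAt y d ξ) (hd : 0 < d) (he : y ξ = y η) : ξ = η := by
  rcases lt_trichotomy ξ η with hlt | heq | hlt
  · have h0 : HasDerivWithinAt y 0 (Set.Icc ξ η) ξ :=
      (hasDerivWithinAt_const ξ _ (y ξ)).congr
        (fun x hx => le_antisymm (he ▸ hy hx.2) (hy hx.1)) rfl
    exact absurd ((uniqueDiffOn_Icc hlt ξ ⟨le_rfl, hlt.le⟩).eq_deriv _ h.hasDerivWithinAt h0) hd.ne'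
  · exact heq
  · have h0 : HasDerivWithinAt y 0 (Set.Icc η ξ) ξ :=
      (hasDerivWithinAt_const ξ _ (y ξ)).congr
        (fun x hx => le_antisymm (hy hx.2) (he ▸ hy hx.1)) rfl
    exact absurd ((uniqueDiffOn_Icc hlt ξ ⟨hlt.le, le_rfl⟩).eq_deriv _ h.hasDerivWithinAt h0) hd.ne'

variable {c₁ c₂ t₀ : ℝ}

lemma onePeakon_after (hc₁ : 0 < c₁) (hc₂ : c₂ < 0) (t ξ : ℝ) :
    onePeakon (c₁ + c₂) t₀ t ((after c₁ c₂ t₀ t).y ξ) = (after c₁ c₂ t₀ t).U ξ := by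
  have hq := q₁_le_q₂ (t₀ := t₀) hc₁ hc₂ 0
  rcases lt_or_ge ξ (q₁ c₁ c₂ t₀ 0) with k1 | k1
  · have hv := outerV_left_pos (t₀ := t₀) hc₁ hc₂ (Real.exp_pos (-(c₁ + c₂) * (t - t₀))) k1.le
    have hle : Real.exp (-(c₁ + c₂) * (t - t₀)) ≤
        outerV (-1) (expQ (-c₂) (-c₁) t₀ 0) (Real.exp (-(c₁ + c₂) * (t - t₀))) ξ := by
      rw [outerV]; linarith [left_label (t₀ := t₀) hc₁ hc₂ k1.le]
    have hlog := (Real.le_log_iff_exp_le hv).2 hle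
    simp only [after, LagVar.glue, glue_of_lt k1, leftAfter, outer, onePeakon]
    rw [abs_of_nonpos (by linarith), show ∀ l : ℝ, -(-(-1 * l - (c₁ + c₂) * (t - t₀))) =
      -(c₁ + c₂) * (t - t₀) + -l from fun l => by ring, Real.exp_add, Real.exp_neg (Real.log _),
      Real.exp_log hv]
    field_simp
  rcases le_or_gt ξ (q₂ c₁ c₂ t₀ 0) with k2 | k2
  · obtain ⟨h1, h2, -⟩ := after_of_mem (c₁ := c₁) (c₂ := c₂) (t₀ := t₀) t
      (Set.mem_Icc.2 ⟨k1, k2⟩)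
    rw [h1, h2, onePeakon, sub_self, abs_zero, neg_zero, Real.exp_zero, mul_one]
  · have hv := outerV_right_pos (t₀ := t₀) hc₁ hc₂ (Real.exp_pos ((c₁ + c₂) * (t - t₀))) k2.le
    have hle : Real.exp ((c₁ + c₂) * (t - t₀)) ≤
        outerV 1 (expQ c₁ c₂ t₀ 0) (Real.exp ((c₁ + c₂) * (t - t₀))) ξ := by
      rw [outerV]; linarith [right_label (t₀ := t₀) hc₁ hc₂ k2.le]
    have hlog := (Real.le_log_iff_exp_le hv).2 hle
    simp only [after, LagVar.glue, glue_of_gt hq k2, rightAfter, outer, onePeakon]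
    rw [abs_of_nonneg (by linarith), show ∀ l : ℝ, -(1 * l - (c₁ + c₂) * (t - t₀)) =
      (c₁ + c₂) * (t - t₀) + -l from fun l => by ring, Real.exp_add, Real.exp_neg (Real.log _),
      Real.exp_log hv]
    field_simp

lemma after_y_surjective (hc₁ : 0 < c₁) (hc₂ : c₂ < 0) (ht₀ : 0 < t₀) (t : ℝ) :
    Function.Surjective (after c₁ c₂ t₀ t).y := by
  have h := (after_isProfile hc₁ hc₂ ht₀ t).memF
  exact h.y_ac.continuous.surjective h.tendsto_y_atTop h.tendsto_y_atBot

lemma after_y_eq_iff (hc₁ : 0 < c₁) (hc₂ : c₂ < 0) (ht₀ : 0 < t₀) (t ξ : ℝ) :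
    (after c₁ c₂ t₀ t).y ξ = (c₁ + c₂) * (t - t₀) ↔
      ξ ∈ Set.Icc (q₁ c₁ c₂ t₀ 0) (q₂ c₁ c₂ t₀ 0) := by
  have hq := q₁_le_q₂ (t₀ := t₀) hc₁ hc₂ 0
  have hp := after_isProfile hc₁ hc₂ ht₀ t
  refine ⟨fun h => by_contra fun hξ => ?_, fun h => (after_of_mem t h).1⟩
  have hS : ξ ∉ ({q₁ c₁ c₂ t₀ 0, q₂ c₁ c₂ t₀ 0} : Set ℝ) := by
    rintro (rfl | rfl)
    exacts [hξ ⟨le_rfl, hq⟩, hξ ⟨hq, le_rfl⟩]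
  have h1 := (after_of_mem (c₁ := c₁) (c₂ := c₂) (t₀ := t₀) t (Set.left_mem_Icc.2 hq)).1
  exact hS (Or.inl (Monotone.eq_of_hasDerivAt_pos hp.memF.monotone_y (hp.deriv_y ξ hS)
    (after_yξ_pos hc₁ hc₂ t hξ) (h.trans h1.symm)))

/-- The Lagrangian form of u_x² = u², valid because u is a single exponential on either side of the
peak. -/
lemma after_hbar_outer (hc₁ : 0 < c₁) (hc₂ : c₂ < 0) (t : ℝ) {ξ : ℝ}
    (hξ : ξ ∉ Set.Icc (q₁ c₁ c₂ t₀ 0) (q₂ c₁ c₂ t₀ 0)) :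
    (after c₁ c₂ t₀ t).hbar ξ = (after c₁ c₂ t₀ t).yξ ξ * (after c₁ c₂ t₀ t).U ξ ^ 2 := by
  have hq := q₁_le_q₂ (t₀ := t₀) hc₁ hc₂ 0
  rcases lt_or_ge ξ (q₁ c₁ c₂ t₀ 0) with k1 | k1
  · simp only [after, LagVar.glue, glue_of_lt k1, leftAfter, outer]
    ring
  rcases le_or_gt ξ (q₂ c₁ c₂ t₀ 0) with k2 | k2
  · exact absurd ⟨k1, k2⟩ hξ
  · simp only [after, LagVar.glue, glue_of_gt hq k2, rightAfter, outer]
    ring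

/-- At t₀, h = 4L² `midSigma` is the label derivative of -4L² `midRho`. As `midRho` runs from K/L²
to 0, the mass is 4K = -4c₁c₂. -/
lemma lintegral_midBefore_h (hc₁ : 0 < c₁) (hc₂ : c₂ < 0) (ht₀ : 0 < t₀) :
    ∫⁻ ξ in Set.Icc (q₁ c₁ c₂ t₀ 0) (q₂ c₁ c₂ t₀ 0), ENNReal.ofReal ((midBefore c₁ c₂ t₀ t₀).h ξ) =
      ENNReal.ofReal (-4 * c₁ * c₂) := by
  have hL : c₁ - c₂ ≠ 0 := by linarith
  have hq := q₁_le_q₂ (t₀ := t₀) hc₁ hc₂ 0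
  have hsm : ∀ ξ ∈ Set.Icc (q₁ c₁ c₂ t₀ 0) (q₂ c₁ c₂ t₀ 0),
      (midBefore c₁ c₂ t₀ t₀).h ξ = -(4 * (c₁ - c₂) ^ 2) * -midSigma c₁ c₂ t₀ t₀ ξ := fun ξ _ => by
    simp only [midBefore, mid, gap_self, expQ_self hL, midW, midE]
    norm_num
    ring
  have hd : ∀ ξ ∈ Set.uIcc (q₁ c₁ c₂ t₀ 0) (q₂ c₁ c₂ t₀ 0),
      HasDerivAt (fun ξ => -(4 * (c₁ - c₂) ^ 2) * midRho c₁ c₂ t₀ t₀ ξ)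
        ((midBefore c₁ c₂ t₀ t₀).h ξ) ξ := fun ξ hξ => by
    rw [Set.uIcc_of_le hq] at hξ
    rw [hsm ξ hξ]
    exact (hasDerivAt_midRho_label (midDen_pos hc₁ hc₂ ht₀ hξ).ne').const_mul _
  have hc : ContinuousOn (midBefore c₁ c₂ t₀ t₀).h (Set.Icc (q₁ c₁ c₂ t₀ 0) (q₂ c₁ c₂ t₀ 0)) :=
    fun ξ hξ => (midBefore_smoothAt hc₁ hc₂ ht₀ t₀ hξ).cont_h.continuousWithinAt
  have hi : IntervalIntegrable (midBefore c₁ c₂ t₀ t₀).h volume (q₁ c₁ c₂ t₀ 0) (q₂ c₁ c₂ t₀ 0) :=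
    ContinuousOn.intervalIntegrable (by rwa [Set.uIcc_of_le hq])
  have hS : peakS c₁ c₂ t₀ t₀ = c₁ - c₂ := by simp [peakS]
  rw [← ofReal_integral_eq_lintegral_ofReal (hc.integrableOn_Icc)
    ((ae_restrict_iff' measurableSet_Icc).2 (ae_of_all _ fun ξ hξ =>
      (midBefore_h_pos hc₁ hc₂ ht₀ t₀ hξ).le)), integral_Icc_eq_integral_Ioc,
    ← intervalIntegral.integral_of_le hq, intervalIntegral.integral_eq_sub_of_hasDerivAt hd hi,
    midRho_q₁ hc₁ hc₂ ht₀, midRho_q₂ hc₁ hc₂, hS]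
  congr 1
  field_simp
  ring

/-- Off the collapsed labels y is injective with positive derivative, and its image omits only the
position of the peak. The change of variables x = y(ξ) therefore accounts for all of A up to a null
set. -/
lemma lintegral_after_hbar_outer (hc₁ : 0 < c₁) (hc₂ : c₂ < 0) (ht₀ : 0 < t₀) (t : ℝ) {A : Set ℝ}
    (hA : MeasurableSet A) :
    ∫⁻ ξ in (after c₁ c₂ t₀ t).y ⁻¹' A \ Set.Icc (q₁ c₁ c₂ t₀ 0) (q₂ c₁ c₂ t₀ 0),
      ENNReal.ofReal ((after c₁ c₂ t₀ t).hbar ξ) =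
    ∫⁻ x in A, ENNReal.ofReal (deriv (onePeakon (c₁ + c₂) t₀ t) x ^ 2) := by
  set Θ := after c₁ c₂ t₀ t with hΘ
  set I := Set.Icc (q₁ c₁ c₂ t₀ 0) (q₂ c₁ c₂ t₀ 0) with hI
  set a := (c₁ + c₂) * (t - t₀) with ha
  have hq := q₁_le_q₂ (t₀ := t₀) hc₁ hc₂ 0
  have hp := after_isProfile hc₁ hc₂ ht₀ t
  have hiff := after_y_eq_iff hc₁ hc₂ ht₀ t
  have hm : MeasurableSet (Θ.y ⁻¹' A \ I) :=
    (hA.preimage hp.cont_y.measurable).diff measurableSet_Icc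
  have hd : ∀ ξ ∉ I, HasDerivAt Θ.y (Θ.yξ ξ) ξ := fun ξ hξ => by
    refine hp.deriv_y ξ ?_
    rintro (rfl | rfl)
    exacts [hξ ⟨le_rfl, hq⟩, hξ ⟨hq, le_rfl⟩]
  have hpos : ∀ ξ ∉ I, 0 < Θ.yξ ξ := fun ξ hξ => after_yξ_pos hc₁ hc₂ t hξ
  have himg : Θ.y '' (Θ.y ⁻¹' A \ I) = A \ {a} := by
    ext x
    constructor
    · rintro ⟨ξ, ⟨h1, h2⟩, rfl⟩
      exact ⟨h1, fun h => h2 ((hiff ξ).1 h)⟩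
    · rintro ⟨h1, h2⟩
      obtain ⟨ξ, rfl⟩ := after_y_surjective hc₁ hc₂ ht₀ t x
      exact ⟨ξ, ⟨h1, fun h => h2 ((hiff ξ).2 h)⟩, rfl⟩
  have hinj : Set.InjOn Θ.y (Θ.y ⁻¹' A \ I) := fun ξ hξ η _ h =>
    Monotone.eq_of_hasDerivAt_pos hp.memF.monotone_y (hd ξ hξ.2) (hpos ξ hξ.2) h
  have key := lintegral_image_eq_lintegral_abs_deriv_mul hm
    (fun ξ hξ => (hd ξ hξ.2).hasDerivWithinAt) hinj
    fun x => ENNReal.ofReal (onePeakon (c₁ + c₂) t₀ t x ^ 2)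
  rw [himg] at key
  have h1 : ∫⁻ x in A, ENNReal.ofReal (deriv (onePeakon (c₁ + c₂) t₀ t) x ^ 2) =
      ∫⁻ x in A \ {a}, ENNReal.ofReal (onePeakon (c₁ + c₂) t₀ t x ^ 2) := by
    rw [← setLIntegral_congr (sdiff_null_ae_eq_self (measure_singleton a))]
    exact setLIntegral_congr_fun (hA.diff (measurableSet_singleton a))
      fun x hx => by simp only [deriv_onePeakon_sq _ _ _ hx.2]
  rw [h1, key]
  refine setLIntegral_congr_fun hm fun ξ hξ => ?_
  have hy := hpos ξ hξ.2
  have hU : onePeakon (c₁ + c₂) t₀ t (Θ.y ξ) = Θ.U ξ := onePeakon_after hc₁ hc₂ t ξ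
  rw [abs_of_pos hy, hU, ← ENNReal.ofReal_mul hy.le, after_hbar_outer hc₁ hc₂ t hξ.2]

lemma lintegral_after_h_mid (hc₁ : 0 < c₁) (hc₂ : c₂ < 0) (ht₀ : 0 < t₀) (t : ℝ) {A : Set ℝ}
    (hA : MeasurableSet A) :
    ∫⁻ ξ in (after c₁ c₂ t₀ t).y ⁻¹' A ∩ Set.Icc (q₁ c₁ c₂ t₀ 0) (q₂ c₁ c₂ t₀ 0),
      ENNReal.ofReal ((after c₁ c₂ t₀ t).h ξ) =
    ENNReal.ofReal (-4 * c₁ * c₂) * Measure.dirac ((c₁ + c₂) * (t - t₀)) A := by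
  set I := Set.Icc (q₁ c₁ c₂ t₀ 0) (q₂ c₁ c₂ t₀ 0) with hI
  have hy : ∀ ξ ∈ I, (after c₁ c₂ t₀ t).y ξ = (c₁ + c₂) * (t - t₀) := fun ξ hξ =>
    (after_of_mem t hξ).1
  rw [Measure.dirac_apply' _ hA]
  by_cases ha : (c₁ + c₂) * (t - t₀) ∈ A
  · have hset : (after c₁ c₂ t₀ t).y ⁻¹' A ∩ I = I :=
      Set.inter_eq_right.2 fun ξ hξ => by rw [Set.mem_preimage, hy ξ hξ]; exact ha
    rw [hset, Set.indicator_of_mem ha, Pi.one_apply, mul_one, ← lintegral_midBefore_h hc₁ hc₂ ht₀]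
    exact setLIntegral_congr_fun measurableSet_Icc fun ξ hξ => by
      simp only [(after_of_mem t hξ).2.2.2.2]
  · have hset : (after c₁ c₂ t₀ t).y ⁻¹' A ∩ I = ∅ :=
      Set.eq_empty_of_forall_notMem fun ξ hξ => ha (hy ξ hξ.2 ▸ hξ.1)
    rw [hset, Set.indicator_of_notMem ha, mul_zero, setLIntegral_empty]

lemma map_after_hbar (hc₁ : 0 < c₁) (hc₂ : c₂ < 0) (ht₀ : 0 < t₀) (t : ℝ) :
    (volume.withDensity fun ξ => ENNReal.ofReal ((after c₁ c₂ t₀ t).hbar ξ)).map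
      (after c₁ c₂ t₀ t).y =
    volume.withDensity fun x => ENNReal.ofReal (deriv (onePeakon (c₁ + c₂) t₀ t) x ^ 2) := by
  have hm := (after_isProfile hc₁ hc₂ ht₀ t).cont_y.measurable
  ext A hA
  rw [Measure.map_apply hm hA, withDensity_apply _ (hA.preimage hm), withDensity_apply _ hA,
    ← lintegral_inter_add_sdiff _ _ (measurableSet_Icc (a := q₁ c₁ c₂ t₀ 0)
      (b := q₂ c₁ c₂ t₀ 0)), lintegral_after_hbar_outer hc₁ hc₂ ht₀ t hA]
  rw [setLIntegral_congr_fun (g := fun _ => 0) ((hA.preimage hm).inter measurableSet_Icc)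
    fun ξ hξ => by simp only [(after_of_mem t hξ.2).2.2.2.1, ENNReal.ofReal_zero], lintegral_zero,
    zero_add]

lemma map_after_h (hc₁ : 0 < c₁) (hc₂ : c₂ < 0) (ht₀ : 0 < t₀) (t : ℝ) :
    (volume.withDensity fun ξ => ENNReal.ofReal ((after c₁ c₂ t₀ t).h ξ)).map
      (after c₁ c₂ t₀ t).y =
    (volume.withDensity fun x => ENNReal.ofReal (deriv (onePeakon (c₁ + c₂) t₀ t) x ^ 2)) +
      ENNReal.ofReal (-4 * c₁ * c₂) • Measure.dirac ((c₁ + c₂) * (t - t₀)) := by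
  have hm := (after_isProfile hc₁ hc₂ ht₀ t).cont_y.measurable
  ext A hA
  rw [Measure.map_apply hm hA, withDensity_apply _ (hA.preimage hm), Measure.add_apply,
    withDensity_apply _ hA, Measure.smul_apply, smul_eq_mul,
    ← lintegral_inter_add_sdiff _ _ (measurableSet_Icc (a := q₁ c₁ c₂ t₀ 0)
      (b := q₂ c₁ c₂ t₀ 0)), ← lintegral_after_hbar_outer hc₁ hc₂ ht₀ t hA,
    lintegral_after_h_mid hc₁ hc₂ ht₀ t hA, add_comm]
  congr 1
  exact setLIntegral_congr_fun ((hA.preimage hm).diff measurableSet_Icc)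
    fun ξ hξ => by simp only [after_hbar_of_notMem hc₁ hc₂ t hξ.2]

/-- Surjectivity of y determines u at every point. -/
lemma isEulerianOf_after_iff (hc₁ : 0 < c₁) (hc₂ : c₂ < 0) (ht₀ : 0 < t₀) (t : ℝ) (u : ℝ → ℝ)
    (μ ν : Measure ℝ) : IsEulerianOf (after c₁ c₂ t₀ t) u μ ν ↔
      u = onePeakon (c₁ + c₂) t₀ t ∧
      μ = volume.withDensity (fun x => ENNReal.ofReal (deriv u x ^ 2)) ∧
      ν = volume.withDensity (fun x => ENNReal.ofReal (deriv u x ^ 2)) +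
        ENNReal.ofReal (-4 * c₁ * c₂) • Measure.dirac ((c₁ + c₂) * (t - t₀)) := by
  have hu : (∀ ξ, u ((after c₁ c₂ t₀ t).y ξ) = (after c₁ c₂ t₀ t).U ξ) ↔
      u = onePeakon (c₁ + c₂) t₀ t := by
    constructor
    · intro h
      funext x
      obtain ⟨ξ, rfl⟩ := after_y_surjective hc₁ hc₂ ht₀ t x
      rw [h, onePeakon_after hc₁ hc₂]
    · rintro rfl
      exact onePeakon_after hc₁ hc₂ t
  rw [IsEulerianOf, hu, map_after_hbar hc₁ hc₂ ht₀, map_after_h hc₁ hc₂ ht₀]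
  exact and_congr_right fun h => by rw [h]

end Eulerian

/-! ### The planar system in the frame of the peakon -/

section Planar

lemma SolvesFrom.congr {a : ℝ} {f g f' g' : ℝ → ℝ} (h : SolvesFrom a f g)
    (hf : ∀ t, a ≤ t → f t = f' t) (hg : ∀ t, a ≤ t → g t = g' t) : SolvesFrom a f' g' := by
  intro t ht
  have he : ∀ s ∈ Set.uIoc a t, g s = g' s := fun s hs => by
    rw [Set.uIoc_of_le ht] at hs
    exact hg s hs.1.le
  obtain ⟨h1, h2⟩ := h t ht
  refine ⟨h1.congr he, ?_⟩
  rw [← hf t ht, ← hf a le_rfl, h2,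
    intervalIntegral.integral_congr_ae (ae_of_all _ fun s hs => he s hs)]

lemma solvesFrom_of_hasDerivAt {a : ℝ} {f g : ℝ → ℝ} (h : ∀ t ∈ Set.Ici a, HasDerivAt f (g t) t)
    (hg : ContinuousOn g (Set.Ici a)) : SolvesFrom a f g := by
  intro t ht
  have hi : IntervalIntegrable g volume a t := ContinuousOn.intervalIntegrable
    (hg.mono (by rw [Set.uIcc_of_le ht]; exact Set.Icc_subset_Ici_self))
  refine ⟨hi, ?_⟩
  rw [intervalIntegral.integral_eq_sub_of_hasDerivAt (fun s hs => h s ?_) hi]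
  · ring
  · rw [Set.uIcc_of_le ht] at hs
    exact hs.1

lemma SolvesFrom.neg {a : ℝ} {f g : ℝ → ℝ} (h : SolvesFrom a f g) :
    SolvesFrom a (fun t => -f t) (fun t => -g t) := fun t ht => by
  obtain ⟨h1, h2⟩ := h t ht
  refine ⟨h1.neg, ?_⟩
  dsimp only
  rw [h2, intervalIntegral.integral_neg]
  ring

/-- Right derivatives on a half-open interval suffice for the applications, and they require nothing
of g at T, where the sign of z might change. -/
lemma SolvesFrom.hasDerivWithinAt {a T t : ℝ} {f g : ℝ → ℝ} (h : SolvesFrom a f g)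
    (hg : ContinuousOn g (Set.Ico a T)) (ht : t ∈ Set.Ico a T) :
    HasDerivWithinAt f (g t) (Set.Ici t) t := by
  have hg' : ContinuousOn g (Set.Ioo t T) := hg.mono fun s hs => ⟨ht.1.trans hs.1.le, hs.2⟩
  have hm := hg'.stronglyMeasurableAtFilter_nhdsWithin (μ := volume) measurableSet_Ioo t
  have hc : ContinuousWithinAt g (Set.Ioo t T) t :=
    (hg t ht).mono fun s hs => ⟨ht.1.trans hs.1.le, hs.2⟩
  rw [ContinuousWithinAt, nhdsWithin_Ioo_eq_nhdsGT ht.2] at hc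
  rw [nhdsWithin_Ioo_eq_nhdsGT ht.2] at hm
  have h1 := intervalIntegral.integral_hasDerivWithinAt_right (s := Set.Ici t) (t := Set.Ioi t)
    (h t ht.1).1 hm hc
  exact (h1.const_add (f a)).congr (fun s hs => (h s (ht.1.trans hs)).2) (h t ht.1).2

/-- On the right of the peak, a planar solution which starts on the peakon stays there. -/
lemma IsPlanarSolution.eq_of_pos {c t₀ : ℝ} {z V : ℝ → ℝ} (h : IsPlanarSolution c t₀ z V)
    (hz : 0 < z t₀) (hV : V t₀ = c * (Real.exp (-|z t₀|) - 1)) {t : ℝ} (ht : t₀ ≤ t) :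
    z t = Real.log (1 + (Real.exp (z t₀) - 1) * Real.exp (-c * (t - t₀))) ∧
      V t = c * Real.exp (-z t) - c := by
  obtain ⟨hzc, hVc, hzs, hVs⟩ := h
  have hz1 : 0 < Real.exp (z t₀) - 1 := sub_pos.2 (Real.one_lt_exp_iff.2 hz)
  have hform : ∀ T, t₀ ≤ T → (∀ s ∈ Set.Ico t₀ T, 0 < z s) →
      (V T + c) * Real.exp (z T) = c ∧
      Real.exp (z T) = 1 + (Real.exp (z t₀) - 1) * Real.exp (-c * (T - t₀)) := by
    intro T hT hpos
    have hI : Set.Ico t₀ T ⊆ Set.Ici t₀ := Set.Ico_subset_Ici_self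
    have hI' : Set.Icc t₀ T ⊆ Set.Ici t₀ := Set.Icc_subset_Ici_self
    have dz : ∀ s ∈ Set.Ico t₀ T, HasDerivWithinAt z (V s) (Set.Ici s) s :=
      fun s hs => hzs.hasDerivWithinAt (hVc.mono hI) hs
    have hsign : ∀ s ∈ Set.Ico t₀ T, -Real.sign (z s) * V s * (V s + c) = -V s * (V s + c) :=
      fun s hs => by rw [Real.sign_of_pos (hpos s hs)]; ring
    have cg : ContinuousOn (fun s => -Real.sign (z s) * V s * (V s + c)) (Set.Ico t₀ T) :=
      (((hVc.mono hI).neg).mul ((hVc.mono hI).add continuousOn_const)).congr hsign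
    have dV : ∀ s ∈ Set.Ico t₀ T, HasDerivWithinAt V (-V s * (V s + c)) (Set.Ici s) s :=
      fun s hs => (hVs.hasDerivWithinAt cg hs).congr_deriv (hsign s hs)
    -- The first integral for z > 0: the point stays on the curve V + c = ce^{-z}, the peakon seen
    -- from the right.
    have k1 : ∀ s ∈ Set.Icc t₀ T, (V s + c) * Real.exp (z s) = c := by
      intro s hs
      have h1 := constant_of_has_deriv_right_zero (f := fun s => (V s + c) * Real.exp (z s))
        (((hVc.mono hI').add continuousOn_const).mul (hzc.mono hI').rexp)
        (fun s hs => (((dV s hs).add_const c).mul (dz s hs).exp).congr_deriv (by ring)) s hs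
      have h2 : (V t₀ + c) * Real.exp (z t₀) = c := by
        rw [hV, abs_of_pos hz, Real.exp_neg]
        field_simp
        ring
      exact h1.trans h2
    -- By `k1`, (e^z)' = e^zV = -c(e^z - 1), a linear equation.
    have k2 := constant_of_has_deriv_right_zero
      (f := fun s => (Real.exp (z s) - 1) * Real.exp (c * (s - t₀)))
      (((hzc.mono hI').rexp.sub continuousOn_const).mul (by fun_prop))
      (fun s hs => (((dz s hs).exp.sub_const 1).mul
        (hasDerivAt_exp_mul_sub c t₀ s).hasDerivWithinAt).congr_deriv (by
          have := k1 s ⟨hs.1, hs.2.le⟩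
          linear_combination Real.exp (c * (s - t₀)) * this)) T ⟨hT, le_rfl⟩
    refine ⟨k1 T ⟨hT, le_rfl⟩, ?_⟩
    simp only [sub_self, mul_zero, Real.exp_zero, mul_one] at k2
    rw [neg_mul, Real.exp_neg, ← k2]
    field_simp
    ring
  have hgt : ∀ T, t₀ ≤ T → (∀ s ∈ Set.Ico t₀ T, 0 < z s) → 0 < z T := fun T hT hpos => by
    rw [← Real.one_lt_exp_iff, (hform T hT hpos).2]
    exact lt_add_of_pos_right 1 (mul_pos hz1 (Real.exp_pos _))
  have hall : ∀ T, t₀ ≤ T → 0 < z T := by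
    intro T hT
    by_contra hneg
    -- At the first time with z ≤ 0 the explicit formula still applies and gives z > 0. Hence the
    -- peak is never reached.
    set S := {s ∈ Set.Icc t₀ T | z s ≤ 0} with hS
    have hne : S.Nonempty := ⟨T, ⟨hT, le_rfl⟩, not_lt.1 hneg⟩
    have hbdd : BddBelow S := ⟨t₀, fun s hs => hs.1.1⟩
    have hcl : IsClosed S :=
      (hzc.mono Set.Icc_subset_Ici_self).preimage_isClosed_of_isClosed isClosed_Icc isClosed_Iic
    have hmem := hcl.csInf_mem hne hbdd
    refine absurd hmem.2 (not_le.2 (hgt _ hmem.1.1 fun s hs => ?_))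
    by_contra hs'
    exact absurd (csInf_le hbdd ⟨⟨hs.1, hs.2.le.trans hmem.1.2⟩, not_lt.1 hs'⟩) (not_le.2 hs.2)
  obtain ⟨h1, h2⟩ := hform t ht fun s hs => hall s hs.1
  refine ⟨by rw [← h2, Real.log_exp], ?_⟩
  rw [Real.exp_neg]
  nth_rewrite 1 [← h1]
  field_simp
  ring

/-- This reflection reduces the left of the peak to the right; no sign of c is assumed anywhere in
this part. -/
lemma IsPlanarSolution.neg {c t₀ : ℝ} {z V : ℝ → ℝ} (h : IsPlanarSolution c t₀ z V) :
    IsPlanarSolution (-c) t₀ (fun t => -z t) (fun t => -V t) := by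
  obtain ⟨hzc, hVc, hzs, hVs⟩ := h
  refine ⟨hzc.neg, hVc.neg, hzs.neg, hVs.neg.congr (fun _ _ => rfl) fun t _ => ?_⟩
  rw [Real.sign_neg]
  ring

/-- As |sgn z| ≤ 1, whatever z does one has |V| ≤ M∫|V| with M a bound for V + c. Grönwall's
inequality for the primitive gives V = 0, and then z is constant. -/
lemma IsPlanarSolution.eq_zero {c t₀ : ℝ} {z V : ℝ → ℝ} (h : IsPlanarSolution c t₀ z V)
    (hz : z t₀ = 0) (hV : V t₀ = 0) {t : ℝ} (ht : t₀ ≤ t) : z t = 0 ∧ V t = 0 := by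
  obtain ⟨hzc, hVc, hzs, hVs⟩ := h
  have hV0 : ∀ s, t₀ ≤ s → V s = 0 := by
    intro T hT
    have hVcc : ContinuousOn (fun s => V s + c) (Set.Icc t₀ T) :=
      (hVc.mono Set.Icc_subset_Ici_self).add continuousOn_const
    obtain ⟨M, hM⟩ := isCompact_Icc.exists_bound_of_continuousOn hVcc
    have habs : ContinuousOn (fun s => |V s|) (Set.Ici t₀) := hVc.abs
    have hi : ∀ s, t₀ ≤ s → IntervalIntegrable (fun s => |V s|) volume t₀ s := fun s hs =>
      ContinuousOn.intervalIntegrable (habs.mono (by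
        rw [Set.uIcc_of_le hs]; exact Set.Icc_subset_Ici_self))
    have hF : SolvesFrom t₀ (fun s => ∫ r in t₀..s, |V r|) fun s => |V s| := fun s hs =>
      ⟨hi s hs, by simp⟩
    have hVle : ∀ s ∈ Set.Icc t₀ T, |V s| ≤ M * ∫ r in t₀..s, |V r| := by
      intro s hs
      obtain ⟨h1, h2⟩ := hVs s hs.1
      rw [h2, hV, zero_add, ← intervalIntegral.integral_const_mul]
      refine (intervalIntegral.abs_integral_le_integral_abs hs.1).trans
        (intervalIntegral.integral_mono_on hs.1 h1.abs ((hi s hs.1).const_mul M) fun r hr => ?_)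
      have hb := hM r ⟨hr.1, hr.2.trans hs.2⟩
      rw [Real.norm_eq_abs] at hb
      rw [abs_mul, abs_mul, abs_neg, mul_comm M]
      have h3 : |Real.sign (z r)| * |V r| ≤ |V r| :=
        mul_le_of_le_one_left (abs_nonneg _) (abs_sign_le_one _)
      exact mul_le_mul h3 hb (abs_nonneg _) (abs_nonneg _)
    have hF0 := eq_zero_of_abs_deriv_le_mul_abs_self_of_eq_zero_right (K := M) (a := t₀) (b := T)
      (hF.continuousOn.mono Set.Icc_subset_Ici_self)
      (fun s hs => hF.hasDerivWithinAt (habs.mono Set.Ico_subset_Ici_self) hs) (by simp)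
      (fun s hs => by
        rw [Real.norm_eq_abs, Real.norm_eq_abs, abs_abs, abs_of_nonneg
          (intervalIntegral.integral_nonneg hs.1 fun r _ => abs_nonneg _)]
        exact hVle s ⟨hs.1, hs.2.le⟩) T ⟨hT, le_rfl⟩
    have := hVle T ⟨hT, le_rfl⟩
    rw [hF0, mul_zero] at this
    exact abs_nonpos_iff.1 this
  have h0 := (hzs.congr (fun _ _ => rfl) (g' := fun _ => 0) hV0 t ht).2
  exact ⟨by rw [h0, hz]; simp, hV0 t ht⟩

/-- Uniqueness for the planar system, for initial values on the peakon. -/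
lemma IsPlanarSolution.unique {c t₀ : ℝ} {z V z' V' : ℝ → ℝ} (h : IsPlanarSolution c t₀ z V)
    (h' : IsPlanarSolution c t₀ z' V') (hz : z t₀ = z' t₀) (hV : V t₀ = V' t₀)
    (hp : V t₀ = c * (Real.exp (-|z t₀|) - 1)) {t : ℝ} (ht : t₀ ≤ t) :
    z t = z' t ∧ V t = V' t := by
  rcases lt_trichotomy (z t₀) 0 with h0 | h0 | h0
  · have hp1 : -V t₀ = -c * (Real.exp (-|-z t₀|) - 1) := by rw [abs_neg, hp]; ring
    obtain ⟨a1, a2⟩ := h.neg.eq_of_pos (neg_pos.2 h0) hp1 ht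
    obtain ⟨b1, b2⟩ := h'.neg.eq_of_pos (neg_pos.2 (hz ▸ h0)) (by rw [← hz, ← hV]; exact hp1) ht
    rw [← hz, ← a1] at b1
    have e1 : z t = z' t := (neg_injective b1).symm
    exact ⟨e1, by rw [← neg_inj, a2, b2, e1]⟩
  · have hV0 : V t₀ = 0 := by rw [hp, h0]; simp
    obtain ⟨a1, a2⟩ := h.eq_zero h0 hV0 ht
    obtain ⟨b1, b2⟩ := h'.eq_zero (hz ▸ h0) (hV ▸ hV0) ht
    exact ⟨a1.trans b1.symm, a2.trans b2.symm⟩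
  · obtain ⟨a1, a2⟩ := h.eq_of_pos h0 hp ht
    obtain ⟨b1, b2⟩ := h'.eq_of_pos (hz ▸ h0) (by rw [← hz, ← hV]; exact hp) ht
    rw [← hz, ← a1] at b1
    exact ⟨b1.symm, by rw [a2, b2, b1]⟩

variable {c₁ c₂ t₀ : ℝ}

lemma after_planar (hc₁ : 0 < c₁) (hc₂ : c₂ < 0) (ht₀ : 0 < t₀) (ξ : ℝ) :
    IsPlanarSolution (c₁ + c₂) t₀ (fun t => (after c₁ c₂ t₀ t).y ξ - (c₁ + c₂) * (t - t₀))
      (fun t => (after c₁ c₂ t₀ t).U ξ - (c₁ + c₂)) := by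
  have hode := after_timeODE (t₀ := t₀) hc₁ hc₂ (Set.Ici t₀) ξ
  have hq := q₁_le_q₂ (t₀ := t₀) hc₁ hc₂ 0
  have dz : ∀ t ∈ Set.Ici t₀, HasDerivAt
      (fun t => (after c₁ c₂ t₀ t).y ξ - (c₁ + c₂) * (t - t₀))
      ((after c₁ c₂ t₀ t).U ξ - (c₁ + c₂)) t := fun t ht =>
    ((hode.y t ht).sub (((hasDerivAt_id t).sub_const t₀).const_mul (c₁ + c₂))).congr_deriv
      (by ring)
  have dV : ∀ t ∈ Set.Ici t₀, HasDerivAt (fun t => (after c₁ c₂ t₀ t).U ξ - (c₁ + c₂))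
      (-afterQ c₁ c₂ t₀ t ξ) t := fun t ht => (hode.U t ht).sub_const _
  have cV : ContinuousOn (fun t => (after c₁ c₂ t₀ t).U ξ - (c₁ + c₂)) (Set.Ici t₀) :=
    fun t ht => (dV t ht).continuousAt.continuousWithinAt
  refine ⟨fun t ht => (dz t ht).continuousAt.continuousWithinAt, cV,
    solvesFrom_of_hasDerivAt dz cV, (solvesFrom_of_hasDerivAt dV hode.cont_q.neg).congr
      (fun _ _ => rfl) fun t _ => ?_⟩
  have hmono := (after_isProfile hc₁ hc₂ ht₀ t).memF.monotone_y
  have hiff := after_y_eq_iff hc₁ hc₂ ht₀ t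
  rcases lt_or_ge ξ (q₁ c₁ c₂ t₀ 0) with k1 | k1
  · have hlt : (after c₁ c₂ t₀ t).y ξ - (c₁ + c₂) * (t - t₀) < 0 := by
      refine sub_neg.2 (lt_of_le_of_ne ?_ fun h => absurd ((hiff ξ).1 h).1 k1.not_ge)
      exact (hmono k1.le).trans ((hiff _).2 (Set.left_mem_Icc.2 hq)).le
    rw [Real.sign_of_neg hlt]
    have hv := outerV_left_pos (t₀ := t₀) hc₁ hc₂ (Real.exp_pos (-(c₁ + c₂) * (t - t₀))) k1.le
    simp only [after, afterQ, LagVar.glue, glue_of_lt k1, leftAfter, leftAfterQ, outer, outerQ]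
    generalize outerV _ _ _ _ = v at *
    generalize Real.exp _ = φ at *
    field_simp
    ring
  rcases le_or_gt ξ (q₂ c₁ c₂ t₀ 0) with k2 | k2
  · have hm := Set.mem_Icc.2 ⟨k1, k2⟩
    dsimp only
    rw [afterQ, glue_of_mem hm, (after_of_mem t hm).2.1, sub_self]
    ring
  · have hlt : 0 < (after c₁ c₂ t₀ t).y ξ - (c₁ + c₂) * (t - t₀) := by
      refine sub_pos.2 (lt_of_le_of_ne ?_ fun h => absurd ((hiff ξ).1 h.symm).2 k2.not_ge)
      exact ((hiff _).2 (Set.right_mem_Icc.2 hq)).ge.trans (hmono k2.le)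
    rw [Real.sign_of_pos hlt]
    have hv := outerV_right_pos (t₀ := t₀) hc₁ hc₂ (Real.exp_pos ((c₁ + c₂) * (t - t₀))) k2.le
    simp only [after, afterQ, LagVar.glue, glue_of_gt hq k2, rightAfter, rightAfterQ, outer,
      outerQ]
    generalize outerV _ _ _ _ = v at *
    generalize Real.exp _ = φ at *
    field_simp
    ring

lemma IsPlanarSolution.congr {c t₀ : ℝ} {z V z' V' : ℝ → ℝ} (h : IsPlanarSolution c t₀ z V)
    (hz : ∀ t, t₀ ≤ t → z' t = z t) (hV : ∀ t, t₀ ≤ t → V' t = V t) :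
    IsPlanarSolution c t₀ z' V' :=
  ⟨h.1.congr hz, h.2.1.congr hV,
    h.2.2.1.congr (fun t ht => (hz t ht).symm) fun t ht => (hV t ht).symm,
    h.2.2.2.congr (fun t ht => (hV t ht).symm) fun t ht => by rw [hz t ht, hV t ht]⟩

end Planar

end CamassaHolm

theorem mainTheorem2 (c₁ c₂ t₀ : ℝ) (hc₁ : 0 < c₁) (hc₂ : c₂ < 0) (ht₀ : 0 < t₀) :
    -- existence of the fully dissipative solution
    (∃ Θ : ℝ → CamassaHolm.LagVar, CamassaHolm.IsDissipativeSolution Θ ∧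
      CamassaHolm.HasInitialVelocity (Θ 0) (CamassaHolm.twoPeakon c₁ c₂ t₀ 0)) ∧
    ∀ Θ : ℝ → CamassaHolm.LagVar, CamassaHolm.IsDissipativeSolution Θ →
      CamassaHolm.HasInitialVelocity (Θ 0) (CamassaHolm.twoPeakon c₁ c₂ t₀ 0) →
      -- wave breaking takes place at time `t₀`, exactly for the labels between the peaks
      (∀ᵐ ξ, ∀ t, 0 ≤ t → ((Θ t).yξ ξ = 0 ↔
        t₀ ≤ t ∧ ξ ∈ Set.Icc (CamassaHolm.q₁ c₁ c₂ t₀ 0) (CamassaHolm.q₂ c₁ c₂ t₀ 0))) ∧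
      -- the Lagrangian variables after wave breaking
      (∀ t, t₀ ≤ t → ∀ ξ, (Θ t).y ξ = CamassaHolm.yAfter c₁ c₂ t₀ t ξ ∧
        (Θ t).U ξ = CamassaHolm.UAfter c₁ c₂ t₀ t ξ) ∧
      (∀ᵐ ξ, ∀ t, t₀ ≤ t → (Θ t).h ξ = CamassaHolm.hAfter c₁ c₂ t₀ t ξ ∧
        (Θ t).hbar ξ = CamassaHolm.hbarAfter c₁ c₂ t₀ t ξ) ∧
      -- the Eulerian variables after wave breaking
      (∀ t, t₀ ≤ t → ∀ (u : ℝ → ℝ) (μ ν : MeasureTheory.Measure ℝ),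
        CamassaHolm.IsEulerianOf (Θ t) u μ ν ↔
          u = CamassaHolm.onePeakon (c₁ + c₂) t₀ t ∧
          μ = MeasureTheory.volume.withDensity (fun x => ENNReal.ofReal (deriv u x ^ 2)) ∧
          ν = MeasureTheory.volume.withDensity (fun x => ENNReal.ofReal (deriv u x ^ 2)) +
            ENNReal.ofReal (-4 * c₁ * c₂) •
              MeasureTheory.Measure.dirac ((c₁ + c₂) * (t - t₀))) ∧
      -- the energy density and the total energy of the peakon
      (∀ t, t₀ ≤ t →
        (∀ x, x ≠ (c₁ + c₂) * (t - t₀) →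
          HasDerivAt (CamassaHolm.onePeakon (c₁ + c₂) t₀ t)
            (deriv (CamassaHolm.onePeakon (c₁ + c₂) t₀ t) x) x ∧
          deriv (CamassaHolm.onePeakon (c₁ + c₂) t₀ t) x ^ 2 =
            (c₁ + c₂) ^ 2 * Real.exp (-2 * |x - (c₁ + c₂) * (t - t₀)|)) ∧
        MeasureTheory.Integrable (fun x => CamassaHolm.onePeakon (c₁ + c₂) t₀ t x ^ 2 +
          deriv (CamassaHolm.onePeakon (c₁ + c₂) t₀ t) x ^ 2) ∧
        (∫ x, (CamassaHolm.onePeakon (c₁ + c₂) t₀ t x ^ 2 +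
          deriv (CamassaHolm.onePeakon (c₁ + c₂) t₀ t) x ^ 2)) =
            2 * c₁ ^ 2 + 2 * c₂ ^ 2 + 4 * c₁ * c₂ ∧
        2 * c₁ ^ 2 + 2 * c₂ ^ 2 + 4 * c₁ * c₂ = 2 * (c₁ + c₂) ^ 2) ∧
      -- the planar system in the frame of the peakon
      (∀ ξ,
        CamassaHolm.IsPlanarSolution (c₁ + c₂) t₀
          (fun t => (Θ t).y ξ - (c₁ + c₂) * (t - t₀)) (fun t => (Θ t).U ξ - (c₁ + c₂)) ∧
        (∀ z V : ℝ → ℝ, CamassaHolm.IsPlanarSolution (c₁ + c₂) t₀ z V →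
          z t₀ = (Θ t₀).y ξ → V t₀ = (Θ t₀).U ξ - (c₁ + c₂) →
          ∀ t, t₀ ≤ t → z t = (Θ t).y ξ - (c₁ + c₂) * (t - t₀) ∧
            V t = (Θ t).U ξ - (c₁ + c₂))) := by
  refine ⟨⟨CamassaHolm.solution c₁ c₂ t₀, CamassaHolm.solution_isDissipative hc₁ hc₂ ht₀,
    CamassaHolm.solution_hasInitialVelocity hc₁ hc₂ ht₀⟩, fun Θ hΘ h0 => ?_⟩
  obtain ⟨hyU, hae⟩ := hΘ.eq_solution hc₁ hc₂ ht₀ h0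
  have hy : ∀ t, t₀ ≤ t → (Θ t).y = (CamassaHolm.after c₁ c₂ t₀ t).y := fun t ht => by
    rw [(hyU t (ht₀.le.trans ht)).1, CamassaHolm.solution_of_ge ht]
  have hU : ∀ t, t₀ ≤ t → (Θ t).U = (CamassaHolm.after c₁ c₂ t₀ t).U := fun t ht => by
    rw [(hyU t (ht₀.le.trans ht)).2, CamassaHolm.solution_of_ge ht]
  have hh : ∀ᵐ ξ, ∀ t, t₀ ≤ t → (Θ t).h ξ = (CamassaHolm.after c₁ c₂ t₀ t).h ξ ∧
      (Θ t).hbar ξ = (CamassaHolm.after c₁ c₂ t₀ t).hbar ξ := by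
    filter_upwards [hae] with ξ hξ t ht
    rw [← CamassaHolm.solution_of_ge ht]
    exact (hξ t (ht₀.le.trans ht)).2
  refine ⟨?_, fun t ht ξ => ?_, ?_, fun t ht u μ ν => ?_, fun t _ => ⟨fun x hx => ?_, ?_⟩,
    fun ξ => ?_⟩
  · filter_upwards [hae] with ξ hξ t ht
    rw [(hξ t ht).1, CamassaHolm.solution_yξ_eq_zero_iff hc₁ hc₂ ht₀]
  · have h := CamassaHolm.after_eq (t₀ := t₀) hc₁ hc₂ t ξ
    rw [hy t ht, hU t ht]
    exact ⟨h.1, h.2.1⟩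
  · filter_upwards [hh] with ξ hξ t ht
    rw [(hξ t ht).1, (hξ t ht).2]
    exact (CamassaHolm.after_eq hc₁ hc₂ t ξ).2.2
  · rw [CamassaHolm.IsEulerianOf.congr (hy t ht) (hU t ht) (hh.mono fun ξ h => (h t ht).2)
      (hh.mono fun ξ h => (h t ht).1)]
    exact CamassaHolm.isEulerianOf_after_iff hc₁ hc₂ ht₀ t u μ ν
  · exact ⟨(CamassaHolm.hasDerivAt_onePeakon _ t₀ t hx).differentiableAt.hasDerivAt,
      (CamassaHolm.deriv_onePeakon_sq _ t₀ t hx).trans (CamassaHolm.onePeakon_sq _ t₀ t x)⟩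
  · obtain ⟨h1, h2⟩ := CamassaHolm.onePeakon_energy (c₁ + c₂) t₀ t
    exact ⟨h1, h2.trans (by ring), by ring⟩
  · have hp := (CamassaHolm.after_planar hc₁ hc₂ ht₀ ξ).congr
      (z' := fun t => (Θ t).y ξ - (c₁ + c₂) * (t - t₀)) (V' := fun t => (Θ t).U ξ - (c₁ + c₂))
      (fun t ht => by rw [hy t ht]) (fun t ht => by rw [hU t ht])
    refine ⟨hp, fun z V hzV hz hV t ht => ?_⟩
    refine hzV.unique hp (hz.trans (by simp)) hV ?_ ht
    -- The initial point lies on the invariant curve because U = ce^{-|y|} at t₀, when the peak is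
    -- at the origin.
    have hpk := CamassaHolm.onePeakon_after (t₀ := t₀) hc₁ hc₂ t₀ ξ
    rw [CamassaHolm.onePeakon, sub_self, mul_zero, sub_zero] at hpk
    rw [hV, hz, hy t₀ le_rfl, hU t₀ le_rfl, ← hpk]
    ring
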